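/- Consider regular curves $\gamma\colon[0,1]\to\mathbb C$ of class $C^1$, with unit tangent $\mathbf t_\gamma=\dot\gamma/|\dot\gamma|$. An argument of $\mathbf t_\gamma$ is a continuous $\theta_\gamma\colon[0,1]\to\mathbb R$ with $\mathbf t_\gamma=e^{i\theta_\gamma}$; the total turning of $\gamma$ is $\theta_\gamma(1)-\theta_\gamma(0)$, its amplitude is $\sup\theta_\gamma-\inf\theta_\gamma$, and $\gamma$ is condensed if its amplitude is less than $\pi$. Let $\kappa_0>0$, $Q=(q,z)\in\mathbb C\times\mathbb S^1$ and $\theta_1\in\mathbb R$ with $e^{i\theta_1}=z$. Let $\hat{\mathcal L}_{-\kappa_0}^{+\kappa_0}(Q)$ be the set of all $C^1$ regular curves $\gamma\colon[0,1]\to\mathbb C$ with $\gamma(0)=0$, $\mathbf t_\gamma(0)=1$, $\gamma(1)=q$, $\mathbf t_\gamma(1)=z$, such that $\theta_\gamma$, regarded as a function of the arc-length parameter $s$ of $\gamma$, satisfies $-\kappa_0\le\frac{\theta_\gamma(s_1)-\theta_\gamma(s_2)}{s_1-s_2}\le\kappa_0$ for all $s_1\ne s_2$. This set carries the topology of the distance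 $d(\gamma,\eta)=\|\gamma-\eta\|_2+\|\dot\gamma-\dot\eta\|_2+\|\kappa_\gamma-\kappa_\eta\|_2$, where $\kappa_\gamma=\dot\theta_\gamma/|\dot\gamma|$ (defined almost everywhere on $[0,1]$) is the curvature and $\|\cdot\|_2$ is the norm of $L^2[0,1]$. Let $\hat{\mathcal U}_c\subset\hat{\mathcal L}_{-\kappa_0}^{+\kappa_0}(Q;\theta_1)$ be the subspace of all condensed curves in $\hat{\mathcal L}_{-\kappa_0}^{+\kappa_0}(Q)$ of total turning $\theta_1$. If $\hat{\mathcal U}_c\neq\emptyset$, then there exist a continuous map $H\colon[0,1]\times\hat{\mathcal U}_c\to\hat{\mathcal U}_c$ and a curve $\gamma_0\in\hat{\mathcal U}_c$ such that for all $\gamma\in\hat{\mathcal U}_c$: (i) $H(1,\gamma)=\gamma$ and $H(0,\gamma)=\gamma_0$; (ii) the amplitude of $H(s,\gamma)$ is a nondecreasing function of $s\in[0,1]$; (iii) the length of $H(s,\gamma)$ is a nondecreasing function of $s\in[0,1]$. In particular, $\hat{\mathcal U}_c$ is contractible. Moreover, $\gamma_0$ has minimal length among all curves in $\hat{\mathcal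 L}_{-\kappa_0}^{+\kappa_0}(Q)$ (of any total turning), and it is the unique such curve up to orientation-preserving $C^1$ reparametrization: every curve in $\hat{\mathcal L}_{-\kappa_0}^{+\kappa_0}(Q)$ of the same length as $\gamma_0$ is such a reparametrization of $\gamma_0$. -/

import Mathlib

open Set MeasureTheory

noncomputable section

/-- A regular plane curve of class `C¹`, parametrized by `[0,1]`. -/
@[ext]
structure RegularCurve where
  /-- the underlying map `[0,1] → ℂ` -/
  toFun : unitInterval → ℂ
  contDiffOn' : ContDiffOn ℝ 1 (IccExtend (zero_le_one : (0 : ℝ) ≤ 1) toFun) (Icc 0 1)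
  regular' : ∀ t ∈ Icc (0 : ℝ) 1,
    derivWithin (IccExtend (zero_le_one : (0 : ℝ) ≤ 1) toFun) (Icc 0 1) t ≠ 0

namespace RegularCurve

/-- The curve as a function of a real parameter; only the values on `[0,1]` matter. -/
def path (γ : RegularCurve) : ℝ → ℂ := IccExtend (zero_le_one : (0 : ℝ) ≤ 1) γ.toFun

/-- The velocity of the curve on `[0,1]` (one-sided derivatives at the end-points). -/
def velocity (γ : RegularCurve) (t : ℝ) : ℂ := derivWithin γ.path (Icc 0 1) t

/-- The unit tangent of the curve. -/
def unitTangent (γ : RegularCurve) (t : ℝ) : ℂ := γ.velocity t / (‖γ.velocity t‖ : ℂ)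

/-- The arc-length parameter of the curve. -/
def arcLength (γ : RegularCurve) (t : ℝ) : ℝ := ∫ τ in (0 : ℝ)..t, ‖γ.velocity τ‖

/-- The length of the curve. -/
def length (γ : RegularCurve) : ℝ := γ.arcLength 1

/-- A continuous `θ : [0,1] → ℝ` such that the unit tangent is `e^{iθ}`. -/
def IsArgument (γ : RegularCurve) (θ : ℝ → ℝ) : Prop :=
  ContinuousOn θ (Icc 0 1) ∧
    ∀ t ∈ Icc (0 : ℝ) 1, γ.unitTangent t = Complex.exp (θ t * Complex.I)

theorem contDiffOn_path (γ : RegularCurve) : ContDiffOn ℝ 1 γ.path (Icc 0 1) := γ.contDiffOn'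

theorem velocity_ne_zero (γ : RegularCurve) {t : ℝ} (ht : t ∈ Icc (0 : ℝ) 1) :
    γ.velocity t ≠ 0 := γ.regular' t ht

theorem continuousOn_velocity (γ : RegularCurve) : ContinuousOn γ.velocity (Icc 0 1) :=
  γ.contDiffOn_path.continuousOn_derivWithin (uniqueDiffOn_Icc zero_lt_one) le_rfl

theorem continuousOn_unitTangent (γ : RegularCurve) :
    ContinuousOn γ.unitTangent (Icc 0 1) := by
  refine γ.continuousOn_velocity.div
    (Complex.continuous_ofReal.comp_continuousOn γ.continuousOn_velocity.norm) ?_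
  intro t ht
  simpa using γ.velocity_ne_zero ht

theorem norm_unitTangent (γ : RegularCurve) {t : ℝ} (ht : t ∈ Icc (0 : ℝ) 1) :
    ‖γ.unitTangent t‖ = 1 := by
  have := γ.velocity_ne_zero ht
  simp [unitTangent, this]

theorem exists_isArgument (γ : RegularCurve) : ∃ θ : ℝ → ℝ, γ.IsArgument θ := by
  let T : C(unitInterval, Circle) :=
    { toFun := fun t => ⟨γ.unitTangent t, by
        exact mem_sphere_zero_iff_norm.2 (γ.norm_unitTangent t.2)⟩
      continuous_toFun := by
        refine Continuous.subtype_mk ?_ _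
        exact continuousOn_iff_continuous_domRestrict.1 γ.continuousOn_unitTangent }
  obtain ⟨a, ha⟩ : ∃ a, Circle.exp a = T 0 := ⟨_, Circle.exp_arg (T 0)⟩
  obtain ⟨Γ, hΓ, -⟩ := Circle.isCoveringMap_exp.exists_path_lifts T a ha.symm
  refine ⟨IccExtend zero_le_one Γ, (Γ.continuous.Icc_extend').continuousOn, fun t ht => ?_⟩
  rw [IccExtend_of_mem _ _ ht]
  have h := congrArg (fun z : Circle => (z : ℂ)) (congrFun hΓ ⟨t, ht⟩)
  exact h.symm.trans (Circle.coe_exp _)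

/-- An argument of the unit tangent of the curve. -/
def argument (γ : RegularCurve) : ℝ → ℝ := γ.exists_isArgument.choose

theorem isArgument_argument (γ : RegularCurve) : γ.IsArgument γ.argument :=
  γ.exists_isArgument.choose_spec

/-- Two arguments differ by a constant, so that the definitions below do not depend on the
choice of the argument. -/
theorem IsArgument.exists_eq_add {γ : RegularCurve} {θ φ : ℝ → ℝ} (hθ : γ.IsArgument θ)
    (hφ : γ.IsArgument φ) : ∃ c : ℝ, ∀ t ∈ Icc (0 : ℝ) 1, θ t = φ t + c := by
  have h : ∀ t ∈ Icc (0 : ℝ) 1, ∃ n : ℤ, θ t - φ t = n * (2 * Real.pi) := by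
    intro t ht
    obtain ⟨n, hn⟩ := Complex.exp_eq_exp_iff_exists_int.1 ((hθ.2 t ht).symm.trans (hφ.2 t ht))
    refine ⟨n, ?_⟩
    have := congrArg Complex.im hn
    simp at this
    linarith
  let f : unitInterval → ℝ := fun t => (θ t - φ t) / (2 * Real.pi)
  have hf : Continuous f := by
    have := continuousOn_iff_continuous_domRestrict.1 (hθ.1.sub hφ.1)
    exact this.div_const _
  have hpi : (2 * Real.pi) ≠ 0 := by positivity
  have hr : ∀ t, f t ∈ range ((↑) : ℤ → ℝ) := by
    intro t
    obtain ⟨n, hn⟩ := h t t.2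
    exact ⟨n, by simp only [f]; rw [hn]; field_simp⟩
  choose g hg using hr
  have hgc : Continuous g := by
    rw [Int.isClosedEmbedding_coe_real.isInducing.continuous_iff]
    convert hf using 1
    exact funext hg
  refine ⟨θ 0 - φ 0, fun t ht => ?_⟩
  have h1 : g ⟨t, ht⟩ = g 0 := PreconnectedSpace.constant inferInstance hgc
  have h2 : f ⟨t, ht⟩ = f 0 := by rw [← hg, ← hg, h1]
  simp only [f] at h2
  rw [div_left_inj' hpi] at h2
  simp at h2
  linarith

/-- The total turning of the curve. -/
def totalTurning (γ : RegularCurve) : ℝ := γ.argument 1 - γ.argument 0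

/-- The amplitude of the curve. -/
def amplitude (γ : RegularCurve) : ℝ :=
  sSup (γ.argument '' Icc 0 1) - sInf (γ.argument '' Icc 0 1)

/-- The curve is condensed if its amplitude is less than `π`. -/
def IsCondensed (γ : RegularCurve) : Prop := γ.amplitude < Real.pi

/-- The curvature `dθ/ds = (dθ/dt) / (ds/dt)` as a function of `t ∈ [0,1]`; for the curves
considered below, `θ` is a Lipschitz function, and this is meaningful almost everywhere. -/
def curvature (γ : RegularCurve) (t : ℝ) : ℝ := deriv γ.argument t / ‖γ.velocity t‖

/-- `γ` is an orientation-preserving `C¹` reparametrization of `η`. -/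
def IsReparametrization (γ η : RegularCurve) : Prop :=
  ∃ φ : ℝ → ℝ, ContDiffOn ℝ 1 φ (Icc 0 1) ∧ φ 0 = 0 ∧ φ 1 = 1 ∧
    (∀ t ∈ Icc (0 : ℝ) 1, 0 < derivWithin φ (Icc 0 1) t) ∧
    ∀ t ∈ Icc (0 : ℝ) 1, γ.path t = η.path (φ t)

theorem intervalIntegrable_norm_velocity (γ : RegularCurve) {a b : ℝ} (ha : a ∈ Icc (0 : ℝ) 1)
    (hb : b ∈ Icc (0 : ℝ) 1) :
    IntervalIntegrable (fun τ => ‖γ.velocity τ‖) volume a b :=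
  (γ.continuousOn_velocity.norm.mono (uIcc_subset_Icc ha hb)).intervalIntegrable

theorem arcLength_sub (γ : RegularCurve) {a b : ℝ} (ha : a ∈ Icc (0 : ℝ) 1)
    (hb : b ∈ Icc (0 : ℝ) 1) : γ.arcLength b - γ.arcLength a = ∫ τ in a..b, ‖γ.velocity τ‖ :=
  intervalIntegral.integral_interval_sub_left
    (γ.intervalIntegrable_norm_velocity (by simp) hb)
    (γ.intervalIntegrable_norm_velocity (by simp) ha)

theorem strictMonoOn_arcLength (γ : RegularCurve) : StrictMonoOn γ.arcLength (Icc 0 1) := by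
  intro a ha b hb hab
  have h := γ.arcLength_sub ha hb
  have h2 : 0 < ∫ τ in a..b, ‖γ.velocity τ‖ := by
    refine intervalIntegral.intervalIntegral_pos_of_pos_on
      (γ.intervalIntegrable_norm_velocity ha hb) (fun x hx => ?_) hab
    exact norm_pos_iff.2 (γ.velocity_ne_zero ⟨ha.1.trans hx.1.le, hx.2.le.trans hb.2⟩)
  linarith

end RegularCurve

/-- The `C¹` regular curves from `P = (p, w)` to `Q = (q, z)` (initial and final positions and unit
tangents) whose curvature lies in `[κ₁, κ₂]`: the argument `θ` of the unit tangent, as a function of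
the arc-length parameter `s`, has all its difference quotients in `[κ₁, κ₂]`. -/
def CurveSpace (κ₁ κ₂ : ℝ) (P Q : ℂ × Circle) : Type :=
  {γ : RegularCurve //
    (γ.path 0 = P.1 ∧ γ.unitTangent 0 = P.2) ∧
    (γ.path 1 = Q.1 ∧ γ.unitTangent 1 = Q.2) ∧
    ∀ t₁ ∈ Icc (0 : ℝ) 1, ∀ t₂ ∈ Icc (0 : ℝ) 1, t₁ ≠ t₂ →
      κ₁ ≤ (γ.argument t₁ - γ.argument t₂) / (γ.arcLength t₁ - γ.arcLength t₂) ∧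
      (γ.argument t₁ - γ.argument t₂) / (γ.arcLength t₁ - γ.arcLength t₂) ≤ κ₂}

/-- The norm of `L²[0,1]`. -/
def l2norm {E : Type*} [NormedAddCommGroup E] (f : ℝ → E) : ℝ :=
  lpNorm f 2 (volume.restrict (Icc (0 : ℝ) 1))

namespace CurveSpace

variable {κ₁ κ₂ : ℝ} {P Q : ℂ × Circle}

theorem memLp_of_continuousOn {E : Type*} [NormedAddCommGroup E]
    {f : ℝ → E} (hf : ContinuousOn f (Icc 0 1)) :
    MemLp f 2 (volume.restrict (Icc (0 : ℝ) 1)) := by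
  obtain ⟨C, hC⟩ := isCompact_Icc.exists_bound_of_continuousOn hf
  refine MemLp.of_bound (hf.aestronglyMeasurable_of_isCompact isCompact_Icc measurableSet_Icc) C ?_
  exact (ae_restrict_iff' measurableSet_Icc).2 (Filter.Eventually.of_forall hC)

theorem memLp_curvature (γ : CurveSpace κ₁ κ₂ P Q) :
    MemLp γ.1.curvature 2 (volume.restrict (Icc (0 : ℝ) 1)) := by
  obtain ⟨M, hM⟩ := isCompact_Icc.exists_bound_of_continuousOn γ.1.continuousOn_velocity
  have hinv : ContinuousOn (fun t => ‖γ.1.velocity t‖⁻¹) (Icc 0 1) :=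
    γ.1.continuousOn_velocity.norm.inv₀ fun t ht => norm_ne_zero_iff.2 (γ.1.velocity_ne_zero ht)
  obtain ⟨N, hN⟩ := isCompact_Icc.exists_bound_of_continuousOn hinv
  set K := max |κ₁| |κ₂| with hK
  have hM0 : 0 ≤ M := (norm_nonneg _).trans (hM 0 (by simp))
  have hK0 : 0 ≤ K := (abs_nonneg _).trans (le_max_left _ _)
  have hlip : ∀ a ∈ Icc (0 : ℝ) 1, ∀ b ∈ Icc (0 : ℝ) 1,
      ‖γ.1.argument a - γ.1.argument b‖ ≤ K * M * ‖a - b‖ := by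
    intro a ha b hb
    rcases eq_or_ne a b with rfl | hab
    · simp
    have hs : γ.1.arcLength a - γ.1.arcLength b ≠ 0 :=
      sub_ne_zero.2 (γ.1.strictMonoOn_arcLength.injOn.ne ha hb hab)
    have h1 := γ.2.2.2 a ha b hb hab
    have h2 : |(γ.1.argument a - γ.1.argument b) / (γ.1.arcLength a - γ.1.arcLength b)| ≤ K := by
      rw [hK]; exact abs_le_max_abs_abs h1.1 h1.2
    have h3 : ‖γ.1.arcLength a - γ.1.arcLength b‖ ≤ M * |a - b| := by
      rw [γ.1.arcLength_sub hb ha]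
      refine intervalIntegral.norm_integral_le_of_norm_le_const fun x hx => ?_
      rw [norm_norm]
      exact hM x (uIcc_subset_Icc hb ha (uIoc_subset_uIcc hx))
    rw [abs_div, div_le_iff₀ (abs_pos.2 hs)] at h2
    rw [Real.norm_eq_abs, Real.norm_eq_abs] at *
    calc _ ≤ K * |γ.1.arcLength a - γ.1.arcLength b| := h2
      _ ≤ K * (M * |a - b|) := by gcongr
      _ = _ := by ring
  have hmeas : AEStronglyMeasurable γ.1.curvature (volume.restrict (Icc (0 : ℝ) 1)) :=
    (measurable_deriv _).aestronglyMeasurable.mul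
      (hinv.aestronglyMeasurable_of_isCompact isCompact_Icc measurableSet_Icc)
  refine MemLp.of_bound hmeas (K * M * N) ?_
  rw [← restrict_Ioo_eq_restrict_Icc]
  refine (ae_restrict_iff' measurableSet_Ioo).2 (Filter.Eventually.of_forall fun t ht => ?_)
  have ht' := Ioo_subset_Icc_self ht
  have hd : ‖deriv γ.1.argument t‖ ≤ K * M := by
    refine norm_deriv_le_of_lip' (by positivity) ?_
    filter_upwards [Icc_mem_nhds ht.1 ht.2] with x hx using hlip x hx t ht'
  have hn := hN t ht'
  rw [RegularCurve.curvature, div_eq_mul_inv, norm_mul]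
  gcongr

theorem continuousOn_path (γ : CurveSpace κ₁ κ₂ P Q) : ContinuousOn γ.1.path (Icc 0 1) :=
  γ.1.contDiffOn_path.continuousOn

/-- The distance `d(γ,η) = ‖γ-η‖₂ + ‖γ'-η'‖₂ + ‖κ_γ-κ_η‖₂`, the norms being those of `L²[0,1]`. -/
instance : MetricSpace (CurveSpace κ₁ κ₂ P Q) where
  dist γ η := l2norm (γ.1.path - η.1.path) + l2norm (γ.1.velocity - η.1.velocity) +
    l2norm (γ.1.curvature - η.1.curvature)
  dist_self γ := by simp [l2norm]
  dist_comm γ η := by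
    simp only [l2norm]
    rw [lpNorm_sub_comm γ.1.path, lpNorm_sub_comm γ.1.velocity, lpNorm_sub_comm γ.1.curvature]
  dist_triangle γ η ζ := by
    simp only [l2norm]
    have h1 := lpNorm_sub_le_lpNorm_sub_add_lpNorm_sub (h := ζ.1.path)
      (memLp_of_continuousOn γ.continuousOn_path) (memLp_of_continuousOn η.continuousOn_path)
      one_le_two
    have h2 := lpNorm_sub_le_lpNorm_sub_add_lpNorm_sub (h := ζ.1.velocity)
      (memLp_of_continuousOn γ.1.continuousOn_velocity)
      (memLp_of_continuousOn η.1.continuousOn_velocity) one_le_two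
    have h3 := lpNorm_sub_le_lpNorm_sub_add_lpNorm_sub (h := ζ.1.curvature)
      γ.memLp_curvature η.memLp_curvature one_le_two
    linarith
  eq_of_dist_eq_zero {γ η} h := by
    have h1 : 0 ≤ l2norm (γ.1.velocity - η.1.velocity) := lpNorm_nonneg
    have h2 : 0 ≤ l2norm (γ.1.curvature - η.1.curvature) := lpNorm_nonneg
    have h3 : 0 ≤ l2norm (γ.1.path - η.1.path) := lpNorm_nonneg
    have h0 : l2norm (γ.1.path - η.1.path) = 0 := by
      change l2norm (γ.1.path - η.1.path) + l2norm (γ.1.velocity - η.1.velocity) +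
        l2norm (γ.1.curvature - η.1.curvature) = 0 at h
      linarith
    have hc := γ.continuousOn_path.sub η.continuousOn_path
    rw [l2norm, lpNorm_eq_zero (memLp_of_continuousOn hc) two_ne_zero] at h0
    have h4 := Measure.eqOn_Icc_of_ae_eq volume (zero_ne_one) h0 hc continuousOn_const
    apply Subtype.ext
    apply RegularCurve.ext
    funext t
    have h5 := h4 t.2
    simp only [Pi.sub_apply, RegularCurve.path, IccExtend_val, Pi.zero_apply] at h5
    exact sub_eq_zero.1 h5

end CurveSpace

/-- The canonical unit tangent vector: base point `0`, direction `1`. -/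
def originFrame : ℂ × Circle := (0, 1)

/-- The subspace of all condensed curves of total turning `θ₁` among the curves
from the canonical unit tangent vector to `Q` with curvature in `[-κ₀, κ₀]`. -/
def condensedCurves (κ₀ : ℝ) (Q : ℂ × Circle) (θ₁ : ℝ) :
    Set (CurveSpace (-κ₀) κ₀ originFrame Q) :=
  {γ | γ.1.totalTurning = θ₁ ∧ γ.1.IsCondensed}

end

noncomputable section

open Filter Topology

/-! Take the first axis along the middle of the range of the argument. The angle φ of a condensed
curve with this axis stays in (-π/2, π/2), so the curve is a graph. Let g = sin φ and let x be the
abscissa. Since dx/ds = cos φ, the curvature is dg/dx. The curvature bound thus says that g is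
κ₀-Lipschitz in x, the end directions fix g at both ends, and, once the abscissa is kept, the end
position is fixed by the single number ∫ g/√(1-g²) dx (`height`). The length is ∫ dx/√(1-g²).

The first deformation truncates g between two levels, themselves clamped between the extreme
Lipschitz functions with the given end values, so that the ends and the curvature bound survive.
With ρ the maximal sine, the levels are ρ(c - δ) and ρ(c + δ), cut off at ±ρ, and δ = 2s for the
time s. The centre c is found by the intermediate value theorem so as to keep the height. It need
not be unique, but the truncated function is (`truncSine_unique`). Therefore the curve descends
through the projection forgetting c, which is a quotient map because c ranges over a compact
interval. As the metric sees curvature, continuity also needs derivatives of maxima and minima to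
converge almost everywhere (`LipTendsto.max`).

For increasing δ the pairs of levels can be chosen nested (`exists_nested_level`). Monotonicity of
the amplitude follows from equality of heights (`exists_truncSine_le`, `exists_le_truncSine`).
Monotonicity of the length follows from convexity of √(1+p²) in the slope p, a level serving as
Lagrange multiplier for the height constraint (`integral_graphSpeed_le`).

At δ = 0 the two levels agree, and the curve is an arc of curvature ±κ₀, a segment and another such
arc (`exists_truncSine_form`), both arcs of angle less than π. Such a curve is shortest among all
curves with the same end data, whatever their turning (`length_le_of_isCSC`). Indeed, all these
curves have the same displacement along the segment, whereas the curvature bound, read from both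
ends, bounds the rate at which any competitor can advance in that direction. In the equality case
the direction is determined as a function of arc length (`exp_angle_eq_of_length_eq`), so minimizers
differ only by parametrization. Hence all fully truncated curves are reparametrizations of one
another, and interpolating their speeds linearly to a constant joins them to a single curve. The
homotopy of the theorem is this reparametrization followed by the truncation. -/

/-- Lebesgue measure on `[0,1]`. -/
abbrev unitMeasure : Measure ℝ := volume.restrict (Icc (0 : ℝ) 1)

/-! ### Convergence in L² on the unit interval -/

/-- Convergence of a sequence in `L²[0,1]`. -/
def L2Tendsto {E : Type*} [NormedAddCommGroup E] (f : ℕ → ℝ → E) (g : ℝ → E) : Prop :=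
  Tendsto (fun n => eLpNorm (f n - g) 2 unitMeasure) atTop (𝓝 0)

theorem aestronglyMeasurable_unit {E : Type*} [NormedAddCommGroup E] {f : ℝ → E}
    (hf : ContinuousOn f (Icc 0 1)) : AEStronglyMeasurable f unitMeasure :=
  hf.aestronglyMeasurable_of_isCompact isCompact_Icc measurableSet_Icc

theorem ae_unit_of_forall {p : ℝ → Prop} (h : ∀ t ∈ Icc (0 : ℝ) 1, p t) :
    ∀ᵐ t ∂unitMeasure, p t :=
  (ae_restrict_iff' measurableSet_Icc).2 (Eventually.of_forall h)

theorem ae_unit_of_forall_Ioo {p : ℝ → Prop} (h : ∀ t ∈ Ioo (0 : ℝ) 1, p t) :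
    ∀ᵐ t ∂unitMeasure, p t := by
  rw [unitMeasure, ← restrict_Ioo_eq_restrict_Icc]
  exact (ae_restrict_iff' measurableSet_Ioo).2 (Eventually.of_forall h)

theorem ae_unit_mem_Ioo : ∀ᵐ t ∂unitMeasure, t ∈ Ioo (0 : ℝ) 1 :=
  ae_unit_of_forall_Ioo fun _ h => h

theorem tendsto_eLpNorm_two_of_bounded {E : Type*} [NormedAddCommGroup E] {f : ℕ → ℝ → E}
    (hm : ∀ n, AEStronglyMeasurable (f n) unitMeasure) (K : ℝ)
    (hb : ∀ n, ∀ᵐ t ∂unitMeasure, ‖f n t‖ ≤ K)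
    (hlim : ∀ᵐ t ∂unitMeasure, Tendsto (fun n => f n t) atTop (𝓝 0)) :
    Tendsto (fun n => eLpNorm (f n) 2 unitMeasure) atTop (𝓝 0) := by
  have key : Tendsto (fun n => ∫⁻ t, ‖f n t‖ₑ ^ (2 : ENNReal).toReal ∂unitMeasure) atTop
      (𝓝 (∫⁻ _, 0 ∂unitMeasure)) := by
    refine tendsto_lintegral_of_dominated_convergence' (fun _ => ENNReal.ofReal K ^ (2 : ENNReal).toReal)
      (fun n => (hm n).enorm.pow_const _) (fun n => ?_) ?_ ?_
    · filter_upwards [hb n] with t ht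
      gcongr
      rw [← ofReal_norm]
      exact ENNReal.ofReal_le_ofReal ht
    · simp
    · filter_upwards [hlim] with t ht
      have h1 : Tendsto (fun n => ‖f n t‖ₑ) atTop (𝓝 0) := by
        have := (continuous_enorm.tendsto (0 : E)).comp ht
        simpa [Function.comp_def] using this
      have := (ENNReal.continuous_rpow_const (y := (2 : ENNReal).toReal)).tendsto 0 |>.comp h1
      simpa [Function.comp_def] using this
  have h2 := (ENNReal.continuous_rpow_const (y := 1 / (2 : ENNReal).toReal)).tendsto _ |>.comp key
  simp only [lintegral_zero] at h2
  rw [ENNReal.zero_rpow_of_pos (by simp)] at h2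
  refine h2.congr fun n => ?_
  rw [eLpNorm_eq_lintegral_rpow_enorm_toReal two_ne_zero (by simp)]
  rfl

theorem L2Tendsto.of_bounded {E : Type*} [NormedAddCommGroup E] {f : ℕ → ℝ → E} {g : ℝ → E}
    (hm : ∀ n, AEStronglyMeasurable (f n) unitMeasure) (hg : AEStronglyMeasurable g unitMeasure)
    (K : ℝ) (hb : ∀ n, ∀ᵐ t ∂unitMeasure, ‖f n t‖ ≤ K)
    (hgb : ∀ᵐ t ∂unitMeasure, ‖g t‖ ≤ K)
    (hlim : ∀ᵐ t ∂unitMeasure, Tendsto (fun n => f n t) atTop (𝓝 (g t))) : L2Tendsto f g := by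
  refine tendsto_eLpNorm_two_of_bounded (fun n => (hm n).sub hg) (K + K) (fun n => ?_) ?_
  · filter_upwards [hb n, hgb] with t h1 h2
    exact (norm_sub_le _ _).trans (add_le_add h1 h2)
  · filter_upwards [hlim] with t ht
    simpa using ht.sub_const (g t)

/-- vC - wD = (v - w)C + w(C - D). This arrangement needs sup bounds only for the C's and for the
limit w; speeds converging in L² need not be uniformly bounded. -/
theorem L2Tendsto.smul {E : Type*} [NormedAddCommGroup E] [NormedSpace ℝ E] {v : ℕ → ℝ → ℝ}
    {w : ℝ → ℝ} {C : ℕ → ℝ → E} {D : ℝ → E} (hv : L2Tendsto v w) (hCD : L2Tendsto C D)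
    (hvm : ∀ n, AEStronglyMeasurable (v n) unitMeasure) (hw : ContinuousOn w (Icc 0 1))
    (hC : ∀ n, AEStronglyMeasurable (C n) unitMeasure) (hD : AEStronglyMeasurable D unitMeasure)
    (K : ℝ) (hCb : ∀ n, ∀ᵐ t ∂unitMeasure, ‖C n t‖ ≤ K) :
    L2Tendsto (fun n t => v n t • C n t) (fun t => w t • D t) := by
  obtain ⟨M, hM⟩ := isCompact_Icc.exists_bound_of_continuousOn hw
  have hwm := aestronglyMeasurable_unit hw
  have h1 : Tendsto (fun n => eLpNorm (fun t => (v n t - w t) • C n t) 2 unitMeasure) atTop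
      (𝓝 0) := by
    have h0 : Tendsto (fun n => ENNReal.ofReal K * eLpNorm (v n - w) 2 unitMeasure) atTop (𝓝 0) := by
      have := ENNReal.Tendsto.const_mul (a := ENNReal.ofReal K) hv (Or.inr ENNReal.ofReal_ne_top)
      simpa using this
    refine tendsto_of_tendsto_of_tendsto_of_le_of_le tendsto_const_nhds h0 (fun _ => zero_le)
      fun n => ?_
    refine eLpNorm_le_mul_eLpNorm_of_ae_le_mul ?_ 2
    filter_upwards [hCb n] with t ht
    rw [norm_smul, mul_comm]
    exact mul_le_mul_of_nonneg_right ht (norm_nonneg _)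
  have h2 : Tendsto (fun n => eLpNorm (fun t => w t • (C n t - D t)) 2 unitMeasure) atTop
      (𝓝 0) := by
    have h0 : Tendsto (fun n => ENNReal.ofReal M * eLpNorm (C n - D) 2 unitMeasure) atTop (𝓝 0) := by
      have := ENNReal.Tendsto.const_mul (a := ENNReal.ofReal M) hCD (Or.inr ENNReal.ofReal_ne_top)
      simpa using this
    refine tendsto_of_tendsto_of_tendsto_of_le_of_le tendsto_const_nhds h0 (fun _ => zero_le)
      fun n => ?_
    refine eLpNorm_le_mul_eLpNorm_of_ae_le_mul ?_ 2
    filter_upwards [ae_unit_of_forall hM] with t ht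
    rw [norm_smul]
    exact mul_le_mul_of_nonneg_right ht (norm_nonneg _)
  have h3 := h1.add h2
  rw [add_zero] at h3
  refine tendsto_of_tendsto_of_tendsto_of_le_of_le tendsto_const_nhds h3 (fun _ => zero_le)
    fun n => ?_
  have : ((fun t => v n t • C n t) - fun t => w t • D t) =
      (fun t => (v n t - w t) • C n t) + fun t => w t • (C n t - D t) := by
    ext t
    simp [sub_smul, smul_sub]
  change eLpNorm ((fun t => v n t • C n t) - fun t => w t • D t) 2 unitMeasure ≤ _
  rw [this]
  exact eLpNorm_add_le (((hvm n).sub hwm).smul (hC n)) (hwm.smul ((hC n).sub hD)) one_le_two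

theorem L2Tendsto.smul_of_ae {E : Type*} [NormedAddCommGroup E] [NormedSpace ℝ E]
    {v : ℕ → ℝ → ℝ} {w : ℝ → ℝ} {C : ℕ → ℝ → E} {D : ℝ → E} (hv : L2Tendsto v w)
    (hvm : ∀ n, AEStronglyMeasurable (v n) unitMeasure) (hw : ContinuousOn w (Icc 0 1))
    (hC : ∀ n, AEStronglyMeasurable (C n) unitMeasure) (hD : AEStronglyMeasurable D unitMeasure)
    (K : ℝ) (hCb : ∀ n, ∀ᵐ t ∂unitMeasure, ‖C n t‖ ≤ K) (hDb : ∀ᵐ t ∂unitMeasure, ‖D t‖ ≤ K)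
    (hlim : ∀ᵐ t ∂unitMeasure, Tendsto (fun n => C n t) atTop (𝓝 (D t))) :
    L2Tendsto (fun n t => v n t • C n t) (fun t => w t • D t) :=
  hv.smul (.of_bounded hC hD K hCb hDb hlim) hvm hw hC hD K hCb

theorem L2Tendsto.of_uniform {E : Type*} [NormedAddCommGroup E] {f : ℕ → ℝ → E} {g : ℝ → E}
    (h : ∀ ε > 0, ∀ᶠ n in atTop, ∀ t ∈ Icc (0 : ℝ) 1, ‖f n t - g t‖ < ε) : L2Tendsto f g := by
  rw [L2Tendsto, ENNReal.tendsto_nhds_zero]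
  intro ε hε
  obtain ⟨δ, hδ, hle⟩ : ∃ δ : ℝ, 0 < δ ∧ ENNReal.ofReal δ ≤ ε := by
    rcases eq_or_ne ε ⊤ with rfl | htop
    · exact ⟨1, one_pos, le_top⟩
    · exact ⟨ε.toReal, ENNReal.toReal_pos hε.ne' htop, ENNReal.ofReal_toReal_le⟩
  filter_upwards [h δ hδ] with n hn
  refine (eLpNorm_le_of_ae_bound (C := δ) (ae_unit_of_forall fun t ht => (hn t ht).le)).trans ?_
  simpa using hle

theorem L2Tendsto.congr {E : Type*} [NormedAddCommGroup E] {f f' : ℕ → ℝ → E} {g g' : ℝ → E}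
    (h : L2Tendsto f g) (hf : ∀ n, f n =ᵐ[unitMeasure] f' n) (hg : g =ᵐ[unitMeasure] g') :
    L2Tendsto f' g' :=
  Tendsto.congr (fun n => eLpNorm_congr_ae ((hf n).sub hg)) h

theorem L2Tendsto.norm {E : Type*} [NormedAddCommGroup E] {f : ℕ → ℝ → E} {g : ℝ → E}
    (h : L2Tendsto f g) : L2Tendsto (fun n t => ‖f n t‖) (fun t => ‖g t‖) :=
  tendsto_of_tendsto_of_tendsto_of_le_of_le tendsto_const_nhds h (fun _ => zero_le)
    fun n => eLpNorm_mono fun t => abs_norm_sub_norm_le (f n t) (g t)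

theorem L2Tendsto.exists_seq_ae {E : Type*} [NormedAddCommGroup E] {f : ℕ → ℝ → E} {g : ℝ → E}
    (h : L2Tendsto f g) (hm : ∀ n, AEStronglyMeasurable (f n) unitMeasure)
    (hg : AEStronglyMeasurable g unitMeasure) :
    ∃ ns : ℕ → ℕ, StrictMono ns ∧
      ∀ᵐ t ∂unitMeasure, Tendsto (fun i => f (ns i) t) atTop (𝓝 (g t)) :=
  (tendstoInMeasure_of_tendsto_eLpNorm two_ne_zero hm hg h).exists_seq_tendsto_ae

theorem L2Tendsto.comp {E : Type*} [NormedAddCommGroup E] {f : ℕ → ℝ → E} {g : ℝ → E}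
    (h : L2Tendsto f g) {ns : ℕ → ℕ} (hns : Tendsto ns atTop atTop) :
    L2Tendsto (fun n => f (ns n)) g :=
  Tendsto.comp (g := fun n => eLpNorm (f n - g) 2 unitMeasure) h hns

theorem norm_integral_le_eLpNorm_two {E : Type*} [NormedAddCommGroup E] [NormedSpace ℝ E]
    {f : ℝ → E} (hf : MemLp f 2 unitMeasure) {a b : ℝ} (ha : 0 ≤ a) (hab : a ≤ b) (hb : b ≤ 1) :
    ‖∫ t in a..b, f t‖ ≤ (eLpNorm f 2 unitMeasure).toReal := by
  have hμ : unitMeasure univ = 1 := by simp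
  have : IsProbabilityMeasure unitMeasure := ⟨hμ⟩
  have h1 : MemLp f 1 unitMeasure := hf.mono_exponent one_le_two
  have h2 : ‖∫ t in a..b, f t‖ ≤ ∫ t in Icc (0 : ℝ) 1, ‖f t‖ := by
    rw [intervalIntegral.integral_of_le hab]
    refine (norm_integral_le_integral_norm _).trans ?_
    refine setIntegral_mono_set (memLp_one_iff_integrable.1 h1).norm
      (Eventually.of_forall fun _ => norm_nonneg _) (LE.le.eventuallyLE ?_)
    exact fun t ht => ⟨ha.trans ht.1.le, ht.2.trans hb⟩
  refine h2.trans ?_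
  have h3 := eLpNorm_le_eLpNorm_of_exponent_le (p := 1) (q := 2) one_le_two hf.1
  have h4 : ∫ t in Icc (0 : ℝ) 1, ‖f t‖ = (eLpNorm f 1 unitMeasure).toReal := by
    rw [eLpNorm_one_eq_lintegral_enorm, integral_norm_eq_lintegral_enorm hf.1]
  rw [h4]
  exact ENNReal.toReal_mono hf.2.ne h3

theorem L2Tendsto.toReal {E : Type*} [NormedAddCommGroup E] {f : ℕ → ℝ → E} {g : ℝ → E}
    (h : L2Tendsto f g) :
    Tendsto (fun n => (eLpNorm (f n - g) 2 unitMeasure).toReal) atTop (𝓝 0) := by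
  simpa [Function.comp_def] using (ENNReal.tendsto_toReal ENNReal.zero_ne_top).comp h

theorem intervalIntegrable_of_memLp_two {E : Type*} [NormedAddCommGroup E] {f : ℝ → E}
    (hf : MemLp f 2 unitMeasure) {a b : ℝ} (ha : a ∈ Icc (0 : ℝ) 1) (hb : b ∈ Icc (0 : ℝ) 1) :
    IntervalIntegrable f volume a b := by
  have h1 : Integrable f unitMeasure := hf.integrable one_le_two
  refine IntegrableOn.intervalIntegrable ?_
  exact IntegrableOn.mono_set h1 (uIcc_subset_Icc ha hb)

/-- On a probability space the L¹ norm is at most the L² norm, so a single estimate controls the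
primitives uniformly in `t`. -/
theorem L2Tendsto.eventually_integral {E : Type*} [NormedAddCommGroup E] [NormedSpace ℝ E]
    {f : ℕ → ℝ → E} {g : ℝ → E} (h : L2Tendsto f g) (hf : ∀ n, MemLp (f n) 2 unitMeasure)
    (hg : MemLp g 2 unitMeasure) {ε : ℝ} (hε : 0 < ε) :
    ∀ᶠ n in atTop, ∀ t ∈ Icc (0 : ℝ) 1,
      ‖(∫ τ in (0 : ℝ)..t, f n τ) - ∫ τ in (0 : ℝ)..t, g τ‖ < ε := by
  filter_upwards [h.toReal.eventually (gt_mem_nhds hε)] with n hn t ht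
  rw [← intervalIntegral.integral_sub (intervalIntegrable_of_memLp_two (hf n) (by simp) ht)
    (intervalIntegrable_of_memLp_two hg (by simp) ht)]
  exact (norm_integral_le_eLpNorm_two ((hf n).sub hg) le_rfl ht.1 ht.2).trans_lt hn

theorem L2Tendsto.integral {E : Type*} [NormedAddCommGroup E] [NormedSpace ℝ E]
    {f : ℕ → ℝ → E} {g : ℝ → E} (h : L2Tendsto f g) (hf : ∀ n, MemLp (f n) 2 unitMeasure)
    (hg : MemLp g 2 unitMeasure) {t : ℝ} (ht : t ∈ Icc (0 : ℝ) 1) :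
    Tendsto (fun n => ∫ τ in (0 : ℝ)..t, f n τ) atTop (𝓝 (∫ τ in (0 : ℝ)..t, g τ)) := by
  rw [Metric.tendsto_nhds]
  intro ε hε
  filter_upwards [h.eventually_integral hf hg hε] with n hn
  rw [dist_eq_norm]
  exact hn t ht

theorem memLp_two_unit {E : Type*} [NormedAddCommGroup E] {f : ℝ → E}
    (hf : ContinuousOn f (Icc 0 1)) : MemLp f 2 unitMeasure :=
  CurveSpace.memLp_of_continuousOn hf

theorem l2norm_sub_eq {E : Type*} [NormedAddCommGroup E] {f g : ℝ → E}
    (hf : AEStronglyMeasurable f unitMeasure) (hg : AEStronglyMeasurable g unitMeasure) :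
    l2norm (f - g) = (eLpNorm (f - g) 2 unitMeasure).toReal :=
  (toReal_eLpNorm (hf.sub hg)).symm

theorem l2Tendsto_iff_l2norm {E : Type*} [NormedAddCommGroup E] {f : ℕ → ℝ → E} {g : ℝ → E}
    (hf : ∀ n, MemLp (f n) 2 unitMeasure) (hg : MemLp g 2 unitMeasure) :
    L2Tendsto f g ↔ Tendsto (fun n => l2norm (f n - g)) atTop (𝓝 0) := by
  constructor
  · intro h
    exact h.toReal.congr fun n => (l2norm_sub_eq (hf n).1 hg.1).symm
  · intro h
    have h2 : Tendsto (fun n => ENNReal.ofReal (l2norm (f n - g))) atTop (𝓝 0) := by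
      simpa [Function.comp_def] using (ENNReal.continuous_ofReal.tendsto 0).comp h
    refine Tendsto.congr (fun n => ?_) h2
    rw [l2norm_sub_eq (hf n).1 hg.1, ENNReal.ofReal_toReal ((hf n).sub hg).2.ne]

theorem hasDerivWithinAt_integral_unit {E : Type*} [NormedAddCommGroup E] [NormedSpace ℝ E]
    [CompleteSpace E] {w : ℝ → E} (hw : ContinuousOn w (Icc 0 1)) {t : ℝ}
    (ht : t ∈ Icc (0 : ℝ) 1) :
    HasDerivWithinAt (fun u => ∫ τ in (0 : ℝ)..u, w τ) (w t) (Icc 0 1) t := by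
  have : Fact (t ∈ Icc (0 : ℝ) 1) := ⟨ht⟩
  refine intervalIntegral.integral_hasDerivWithinAt_right
    ((hw.mono (uIcc_subset_Icc (by simp) ht)).intervalIntegrable)
    (hw.stronglyMeasurableAtFilter_nhdsWithin measurableSet_Icc t) (hw t ht)

theorem uniqueDiffWithinAt_unit {t : ℝ} (ht : t ∈ Icc (0 : ℝ) 1) :
    UniqueDiffWithinAt ℝ (Icc (0 : ℝ) 1) t := uniqueDiffOn_Icc zero_lt_one t ht

theorem contDiffOn_one_of_hasDerivWithinAt {E : Type*} [NormedAddCommGroup E] [NormedSpace ℝ E]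
    {f w : ℝ → E} (hw : ContinuousOn w (Icc 0 1))
    (hf : ∀ t ∈ Icc (0 : ℝ) 1, HasDerivWithinAt f (w t) (Icc 0 1) t) :
    ContDiffOn ℝ 1 f (Icc 0 1) := by
  rw [contDiffOn_one_iff_derivWithin (uniqueDiffOn_Icc zero_lt_one)]
  exact ⟨fun t ht => (hf t ht).differentiableWithinAt,
    hw.congr fun t ht => (hf t ht).derivWithin (uniqueDiffWithinAt_unit ht)⟩

/-! ### Speed, angle, and reconstruction of a curve from its velocity -/

namespace RegularCurve

theorem hasDerivWithinAt_path (γ : RegularCurve) {t : ℝ} (ht : t ∈ Icc (0 : ℝ) 1) :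
    HasDerivWithinAt γ.path (γ.velocity t) (Icc 0 1) t :=
  (γ.contDiffOn_path.differentiableOn one_ne_zero t ht).hasDerivWithinAt

theorem path_eq_integral (γ : RegularCurve) {t : ℝ} (ht : t ∈ Icc (0 : ℝ) 1) :
    γ.path t = γ.path 0 + ∫ τ in (0 : ℝ)..t, γ.velocity τ := by
  have hsub : Icc 0 t ⊆ Icc (0 : ℝ) 1 := Icc_subset_Icc_right ht.2
  rw [intervalIntegral.integral_eq_sub_of_hasDerivAt_of_le ht.1
    (γ.contDiffOn_path.continuousOn.mono hsub) (f' := γ.velocity)]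
  · ring
  · intro x hx
    exact (γ.hasDerivWithinAt_path ⟨hx.1.le, hx.2.le.trans ht.2⟩).hasDerivAt
      (Icc_mem_nhds hx.1 (hx.2.trans_le ht.2))
  · exact (γ.continuousOn_velocity.mono (uIcc_subset_Icc (by simp) ht)).intervalIntegrable

/-- The speed of the curve. -/
def speed (γ : RegularCurve) (t : ℝ) : ℝ := ‖γ.velocity t‖

/-- The argument of the unit tangent vanishing at `0`. -/
def angle (γ : RegularCurve) (t : ℝ) : ℝ := γ.argument t - γ.argument 0

theorem continuousOn_speed (γ : RegularCurve) : ContinuousOn γ.speed (Icc 0 1) :=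
  γ.continuousOn_velocity.norm

theorem speed_pos (γ : RegularCurve) {t : ℝ} (ht : t ∈ Icc (0 : ℝ) 1) : 0 < γ.speed t :=
  norm_pos_iff.2 (γ.velocity_ne_zero ht)

theorem angle_zero (γ : RegularCurve) : γ.angle 0 = 0 := sub_self _

theorem totalTurning_eq (γ : RegularCurve) : γ.totalTurning = γ.angle 1 := rfl

theorem continuousOn_angle (γ : RegularCurve) : ContinuousOn γ.angle (Icc 0 1) :=
  γ.isArgument_argument.1.sub continuousOn_const

theorem deriv_angle (γ : RegularCurve) : deriv γ.angle = deriv γ.argument := by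
  ext t
  exact deriv_sub_const _

theorem curvature_eq (γ : RegularCurve) (t : ℝ) : γ.curvature t = deriv γ.angle t / γ.speed t := by
  rw [deriv_angle]; rfl

theorem isArgument_angle (γ : RegularCurve) (h : γ.unitTangent 0 = 1) : γ.IsArgument γ.angle := by
  refine ⟨γ.continuousOn_angle, fun t ht => ?_⟩
  have h0 := (γ.isArgument_argument.2 0 (by simp)).symm.trans h
  rw [γ.isArgument_argument.2 t ht, angle]
  push_cast
  rw [sub_mul, Complex.exp_sub, h0, div_one]

theorem velocity_eq_speed_mul (γ : RegularCurve) {t : ℝ} (ht : t ∈ Icc (0 : ℝ) 1) :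
    γ.velocity t = γ.speed t * γ.unitTangent t := by
  have : (‖γ.velocity t‖ : ℂ) ≠ 0 := by simpa using γ.velocity_ne_zero ht
  rw [unitTangent, speed]
  field_simp

theorem velocity_eq_angle (γ : RegularCurve) (h : γ.unitTangent 0 = 1) {t : ℝ}
    (ht : t ∈ Icc (0 : ℝ) 1) :
    γ.velocity t = γ.speed t * Complex.exp (γ.angle t * Complex.I) := by
  rw [γ.velocity_eq_speed_mul ht, (γ.isArgument_angle h).2 t ht]

/-- The curve starting at the origin with a given velocity. -/
def ofVelocity (w : ℝ → ℂ) (hw : ContinuousOn w (Icc 0 1)) (h0 : ∀ t ∈ Icc (0 : ℝ) 1, w t ≠ 0) :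
    RegularCurve :=
  have hf : ∀ t ∈ Icc (0 : ℝ) 1, HasDerivWithinAt
      (IccExtend (zero_le_one : (0 : ℝ) ≤ 1) fun t : unitInterval => ∫ τ in (0 : ℝ)..t, w τ)
      (w t) (Icc 0 1) t := fun t ht =>
    (hasDerivWithinAt_integral_unit hw ht).congr (fun s hs => IccExtend_of_mem _ _ hs)
      (IccExtend_of_mem _ _ ht)
  { toFun := fun t => ∫ τ in (0 : ℝ)..t, w τ
    contDiffOn' := contDiffOn_one_of_hasDerivWithinAt hw hf
    regular' := fun t ht => by
      rw [(hf t ht).derivWithin (uniqueDiffWithinAt_unit ht)]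
      exact h0 t ht }

section ofVelocity
variable {w : ℝ → ℂ} (hw : ContinuousOn w (Icc 0 1)) (h0 : ∀ t ∈ Icc (0 : ℝ) 1, w t ≠ 0)

theorem ofVelocity_path {t : ℝ} (ht : t ∈ Icc (0 : ℝ) 1) :
    (ofVelocity w hw h0).path t = ∫ τ in (0 : ℝ)..t, w τ := IccExtend_of_mem _ _ ht

theorem ofVelocity_velocity {t : ℝ} (ht : t ∈ Icc (0 : ℝ) 1) :
    (ofVelocity w hw h0).velocity t = w t := by
  have h := (hasDerivWithinAt_integral_unit hw ht).congr
    (fun s hs => ofVelocity_path hw h0 hs) (ofVelocity_path hw h0 ht)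
  exact h.derivWithin (uniqueDiffWithinAt_unit ht)

end ofVelocity

theorem ext_of_velocity {γ η : RegularCurve} (h0 : γ.path 0 = η.path 0)
    (h : ∀ t ∈ Icc (0 : ℝ) 1, γ.velocity t = η.velocity t) : γ = η := by
  apply RegularCurve.ext
  funext t
  have h1 : γ.path t = η.path t := by
    rw [γ.path_eq_integral t.2, η.path_eq_integral t.2, h0]
    congr 1
    refine intervalIntegral.integral_congr fun τ hτ => h τ ?_
    exact uIcc_subset_Icc (by simp) t.2 hτ
  simpa [path, IccExtend_val] using h1

theorem IsArgument.angle_eq {γ : RegularCurve} {θ : ℝ → ℝ} (hθ : γ.IsArgument θ) (h0 : θ 0 = 0)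
    {t : ℝ} (ht : t ∈ Icc (0 : ℝ) 1) : γ.angle t = θ t := by
  obtain ⟨c, hc⟩ := γ.isArgument_argument.exists_eq_add hθ
  rw [angle, hc t ht, hc 0 (by simp), h0]
  ring

theorem arcLength_sub_eq (γ : RegularCurve) {a b : ℝ} (ha : a ∈ Icc (0 : ℝ) 1)
    (hb : b ∈ Icc (0 : ℝ) 1) : γ.arcLength b - γ.arcLength a = ∫ τ in a..b, γ.speed τ :=
  γ.arcLength_sub ha hb

/-- Arc length is strictly increasing, so denominators can be cleared. The resulting form survives
maxima and minima and makes sense for `a = b`. -/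
theorem quotient_bounds_iff (γ : RegularCurve) (κ : ℝ) :
    (∀ t₁ ∈ Icc (0 : ℝ) 1, ∀ t₂ ∈ Icc (0 : ℝ) 1, t₁ ≠ t₂ →
      -κ ≤ (γ.argument t₁ - γ.argument t₂) / (γ.arcLength t₁ - γ.arcLength t₂) ∧
      (γ.argument t₁ - γ.argument t₂) / (γ.arcLength t₁ - γ.arcLength t₂) ≤ κ) ↔
    ∀ a ∈ Icc (0 : ℝ) 1, ∀ b ∈ Icc (0 : ℝ) 1, a ≤ b →
      |γ.angle b - γ.angle a| ≤ κ * (γ.arcLength b - γ.arcLength a) := by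
  have hq : ∀ a ∈ Icc (0 : ℝ) 1, ∀ b ∈ Icc (0 : ℝ) 1, a < b →
      ((-κ ≤ (γ.argument b - γ.argument a) / (γ.arcLength b - γ.arcLength a) ∧
      (γ.argument b - γ.argument a) / (γ.arcLength b - γ.arcLength a) ≤ κ) ↔
      |γ.angle b - γ.angle a| ≤ κ * (γ.arcLength b - γ.arcLength a)) := by
    intro a ha b hb hab
    have hs : 0 < γ.arcLength b - γ.arcLength a :=
      sub_pos.2 (γ.strictMonoOn_arcLength ha hb hab)
    rw [le_div_iff₀ hs, div_le_iff₀ hs, abs_le, angle, angle]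
    ring_nf
  constructor
  · intro h a ha b hb hab
    rcases hab.eq_or_lt with rfl | hlt
    · simp
    · exact (hq a ha b hb hlt).1 (h b hb a ha hlt.ne')
  · intro h t₁ h₁ t₂ h₂ hne
    rcases hne.lt_or_gt with hlt | hlt
    · rw [← neg_sub (γ.argument t₂), ← neg_sub (γ.arcLength t₂), neg_div_neg_eq]
      exact (hq t₁ h₁ t₂ h₂ hlt).2 (h t₁ h₁ t₂ h₂ hlt.le)
    · exact (hq t₂ h₂ t₁ h₁ hlt).2 (h t₂ h₂ t₁ h₁ hlt.le)

theorem amplitude_eq (γ : RegularCurve) :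
    γ.amplitude = sSup (γ.angle '' Icc 0 1) - sInf (γ.angle '' Icc 0 1) := by
  have hne : (γ.argument '' Icc 0 1).Nonempty := ⟨_, mem_image_of_mem _ (left_mem_Icc.2 zero_le_one)⟩
  have hc : IsCompact (γ.argument '' Icc 0 1) :=
    isCompact_Icc.image_of_continuousOn γ.isArgument_argument.1
  have himg : γ.angle '' Icc 0 1 = (fun x => x + -γ.argument 0) '' (γ.argument '' Icc 0 1) := by
    rw [image_image]
    rfl
  rw [himg, amplitude]
  have h1 := (OrderIso.addRight (-γ.argument 0)).map_csSup' hne hc.bddAbove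
  have h2 := (OrderIso.addRight (-γ.argument 0)).map_csInf' hne hc.bddBelow
  simp only [OrderIso.addRight_apply] at h1 h2
  rw [← h1, ← h2]
  ring

end RegularCurve

/-! ### Lipschitz functions on the unit interval -/

/-- Lipschitz functions on `[0,1]`, with an unspecified constant. -/
def IsLip (f : ℝ → ℝ) : Prop := ∃ K : NNReal, LipschitzOnWith K f (Icc (0 : ℝ) 1)

namespace IsLip

theorem of_le {f : ℝ → ℝ} {K : ℝ}
    (h : ∀ a ∈ Icc (0 : ℝ) 1, ∀ b ∈ Icc (0 : ℝ) 1, a ≤ b → |f b - f a| ≤ K * (b - a)) :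
    IsLip f := by
  refine ⟨K.toNNReal, LipschitzOnWith.of_dist_le_mul fun a ha b hb => ?_⟩
  rw [Real.dist_eq, Real.dist_eq]
  have hK : K ≤ K.toNNReal := Real.le_coe_toNNReal K
  rcases le_total a b with hab | hab
  · rw [abs_sub_comm, abs_sub_comm a, abs_of_nonneg (sub_nonneg.2 hab)]
    exact (h a ha b hb hab).trans (mul_le_mul_of_nonneg_right hK (sub_nonneg.2 hab))
  · rw [abs_of_nonneg (sub_nonneg.2 hab)]
    exact (h b hb a ha hab).trans (mul_le_mul_of_nonneg_right hK (sub_nonneg.2 hab))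

theorem exists_abs_le {f : ℝ → ℝ} (hf : IsLip f) : ∃ K : ℝ, 0 ≤ K ∧
    ∀ a ∈ Icc (0 : ℝ) 1, ∀ b ∈ Icc (0 : ℝ) 1, |f a - f b| ≤ K * |a - b| := by
  obtain ⟨K, hK⟩ := hf
  exact ⟨K, K.2, fun a ha b hb => hK.dist_le_mul a ha b hb⟩

theorem of_abs_le {f : ℝ → ℝ} {K : ℝ}
    (h : ∀ a ∈ Icc (0 : ℝ) 1, ∀ b ∈ Icc (0 : ℝ) 1, |f a - f b| ≤ K * |a - b|) : IsLip f := by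
  refine of_le (K := K) fun a ha b hb hab => ?_
  simpa [abs_of_nonneg (sub_nonneg.2 hab)] using h b hb a ha

theorem continuousOn {f : ℝ → ℝ} (hf : IsLip f) : ContinuousOn f (Icc 0 1) :=
  hf.choose_spec.continuousOn

theorem absolutelyContinuous {f : ℝ → ℝ} (hf : IsLip f) {a b : ℝ} (ha : a ∈ Icc (0 : ℝ) 1)
    (hb : b ∈ Icc (0 : ℝ) 1) : AbsolutelyContinuousOnInterval f a b :=
  (hf.choose_spec.mono (uIcc_subset_Icc ha hb)).absolutelyContinuousOnInterval

theorem ae_differentiableAt {f : ℝ → ℝ} (hf : IsLip f) :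
    ∀ᵐ t ∂unitMeasure, DifferentiableAt ℝ f t := by
  refine (ae_restrict_iff' measurableSet_Icc).2 ?_
  have h := (hf.absolutelyContinuous (a := 0) (b := 1) (by simp) (by simp)).ae_differentiableAt
  rwa [uIcc_of_le zero_le_one] at h

theorem integral_deriv {f : ℝ → ℝ} (hf : IsLip f) {a b : ℝ} (ha : a ∈ Icc (0 : ℝ) 1)
    (hb : b ∈ Icc (0 : ℝ) 1) : ∫ t in a..b, deriv f t = f b - f a :=
  (hf.absolutelyContinuous ha hb).integral_deriv_eq_sub

theorem const (c : ℝ) : IsLip fun _ => c := of_le (K := 0) (by simp)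

theorem add {f g : ℝ → ℝ} (hf : IsLip f) (hg : IsLip g) : IsLip fun t => f t + g t :=
  ⟨_, hf.choose_spec.add hg.choose_spec⟩

theorem const_mul {f : ℝ → ℝ} (c : ℝ) (hf : IsLip f) : IsLip fun t => c * f t := by
  obtain ⟨K, hK, h⟩ := hf.exists_abs_le
  refine of_abs_le (K := |c| * K) fun a ha b hb => ?_
  rw [← mul_sub, abs_mul, mul_assoc]
  gcongr
  exact h a ha b hb

theorem max {f g : ℝ → ℝ} (hf : IsLip f) (hg : IsLip g) : IsLip fun t => max (f t) (g t) := by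
  obtain ⟨K, hK, h⟩ := hf.exists_abs_le
  obtain ⟨K', hK', h'⟩ := hg.exists_abs_le
  refine of_abs_le (K := K + K') fun a ha b hb => ?_
  refine (abs_max_sub_max_le_max _ _ _ _).trans (max_le ?_ ?_)
  · exact (h a ha b hb).trans (mul_le_mul_of_nonneg_right (by linarith) (abs_nonneg _))
  · exact (h' a ha b hb).trans (mul_le_mul_of_nonneg_right (by linarith) (abs_nonneg _))

theorem comp {f F : ℝ → ℝ} (hf : IsLip f) {K : ℝ} (hK : 0 ≤ K) {s : Set ℝ}
    (hs : ∀ t ∈ Icc (0 : ℝ) 1, f t ∈ s)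
    (hF : ∀ a ∈ s, ∀ b ∈ s, |F a - F b| ≤ K * |a - b|) : IsLip fun t => F (f t) := by
  obtain ⟨K', hK', h⟩ := hf.exists_abs_le
  refine of_abs_le (K := K * K') fun a ha b hb => ?_
  refine (hF _ (hs a ha) _ (hs b hb)).trans ?_
  rw [mul_assoc]
  gcongr
  exact h a ha b hb

theorem integral {v : ℝ → ℝ} (hv : ContinuousOn v (Icc 0 1)) :
    IsLip fun t => ∫ τ in (0 : ℝ)..t, v τ := by
  obtain ⟨M, hM⟩ := isCompact_Icc.exists_bound_of_continuousOn hv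
  refine of_abs_le (K := M) fun a ha b hb => ?_
  have hi : ∀ c ∈ Icc (0 : ℝ) 1, IntervalIntegrable v volume 0 c := fun c hc =>
    (hv.mono (uIcc_subset_Icc (by simp) hc)).intervalIntegrable
  rw [intervalIntegral.integral_interval_sub_left (hi a ha) (hi b hb)]
  exact intervalIntegral.norm_integral_le_of_norm_le_const fun x hx =>
    hM x (uIcc_subset_Icc hb ha (uIoc_subset_uIcc hx))

end IsLip

theorem hasDerivAt_integral_unit {v : ℝ → ℝ} (hv : ContinuousOn v (Icc 0 1)) {t : ℝ}
    (ht : t ∈ Ioo (0 : ℝ) 1) : HasDerivAt (fun u => ∫ τ in (0 : ℝ)..u, v τ) (v t) t :=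
  (hasDerivWithinAt_integral_unit hv (Ioo_subset_Icc_self ht)).hasDerivAt (Icc_mem_nhds ht.1 ht.2)

theorem intervalIntegrable_unit {E : Type*} [NormedAddCommGroup E] {v : ℝ → E}
    (hv : ContinuousOn v (Icc 0 1)) {a b : ℝ}
    (ha : a ∈ Icc (0 : ℝ) 1) (hb : b ∈ Icc (0 : ℝ) 1) : IntervalIntegrable v volume a b :=
  (hv.mono (uIcc_subset_Icc ha hb)).intervalIntegrable

theorem integral_unit_sub {E : Type*} [NormedAddCommGroup E] [NormedSpace ℝ E] {v : ℝ → E}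
    (hv : ContinuousOn v (Icc 0 1)) {a b : ℝ}
    (ha : a ∈ Icc (0 : ℝ) 1) (hb : b ∈ Icc (0 : ℝ) 1) :
    (∫ τ in (0 : ℝ)..b, v τ) - ∫ τ in (0 : ℝ)..a, v τ = ∫ τ in a..b, v τ :=
  intervalIntegral.integral_interval_sub_left (intervalIntegrable_unit hv (by simp) hb)
    (intervalIntegrable_unit hv (by simp) ha)

theorem IsLip.of_le_integral {θ v : ℝ → ℝ} {κ : ℝ} (hκ : 0 ≤ κ) (hv : ContinuousOn v (Icc 0 1))
    (h : ∀ a ∈ Icc (0 : ℝ) 1, ∀ b ∈ Icc (0 : ℝ) 1, a ≤ b → |θ b - θ a| ≤ κ * ∫ τ in a..b, v τ) :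
    IsLip θ := by
  obtain ⟨M, hM⟩ := isCompact_Icc.exists_bound_of_continuousOn hv
  refine IsLip.of_le (K := κ * M) fun a ha b hb hab => (h a ha b hb hab).trans ?_
  rw [mul_assoc]
  gcongr
  have := intervalIntegral.norm_integral_le_of_norm_le_const (a := a) (b := b) (f := v) (C := M)
    fun x hx => hM x (uIcc_subset_Icc ha hb (uIoc_subset_uIcc hx))
  rw [abs_of_nonneg (sub_nonneg.2 hab)] at this
  exact (le_abs_self _).trans this

theorem abs_deriv_le_of_le_integral {θ v : ℝ → ℝ} {κ : ℝ} (hκ : 0 ≤ κ)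
    (hv : ContinuousOn v (Icc 0 1)) (hv0 : ∀ t ∈ Icc (0 : ℝ) 1, 0 ≤ v t)
    (h : ∀ a ∈ Icc (0 : ℝ) 1, ∀ b ∈ Icc (0 : ℝ) 1, a ≤ b → |θ b - θ a| ≤ κ * ∫ τ in a..b, v τ)
    {t : ℝ} (ht : t ∈ Ioo (0 : ℝ) 1) : |deriv θ t| ≤ κ * v t := by
  have ht' := Ioo_subset_Icc_self ht
  by_cases hd : DifferentiableAt ℝ θ t
  · have h1 : Tendsto (slope θ t) (𝓝[>] t) (𝓝 (deriv θ t)) :=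
      (hasDerivAt_iff_tendsto_slope.1 hd.hasDerivAt).mono_left
        (nhdsWithin_mono _ fun x hx => ne_of_gt hx)
    have h2 : Tendsto (slope (fun u => ∫ τ in (0 : ℝ)..u, v τ) t) (𝓝[>] t) (𝓝 (v t)) :=
      (hasDerivAt_iff_tendsto_slope.1 (hasDerivAt_integral_unit hv ht)).mono_left
        (nhdsWithin_mono _ fun x hx => ne_of_gt hx)
    refine le_of_tendsto_of_tendsto h1.abs (h2.const_mul κ) ?_
    filter_upwards [Ioo_mem_nhdsGT ht.2] with b hb
    have hb' : b ∈ Icc (0 : ℝ) 1 := ⟨ht.1.le.trans hb.1.le, hb.2.le⟩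
    have hpos : 0 < b - t := sub_pos.2 hb.1
    rw [slope_def_field, slope_def_field, integral_unit_sub hv ht' hb', abs_div, abs_of_pos hpos,
      ← mul_div_assoc]
    gcongr
    exact h t ht' b hb' hb.1.le
  -- Here `deriv` takes its default value `0`, so the bound holds at every interior point and not
  -- merely almost everywhere.
  · rw [deriv_zero_of_not_differentiableAt hd, abs_zero]
    exact mul_nonneg hκ (hv0 t ht')

/-! ### The amplitude as a difference of attained extrema -/

namespace RegularCurve

theorem isCompact_angle_image (γ : RegularCurve) : IsCompact (γ.angle '' Icc 0 1) :=
  isCompact_Icc.image_of_continuousOn γ.continuousOn_angle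

theorem angle_le_sSup (γ : RegularCurve) {t : ℝ} (ht : t ∈ Icc (0 : ℝ) 1) :
    γ.angle t ≤ sSup (γ.angle '' Icc 0 1) :=
  le_csSup γ.isCompact_angle_image.bddAbove (mem_image_of_mem _ ht)

theorem sInf_le_angle (γ : RegularCurve) {t : ℝ} (ht : t ∈ Icc (0 : ℝ) 1) :
    sInf (γ.angle '' Icc 0 1) ≤ γ.angle t :=
  csInf_le γ.isCompact_angle_image.bddBelow (mem_image_of_mem _ ht)

theorem exists_sSup_eq (γ : RegularCurve) :
    ∃ t ∈ Icc (0 : ℝ) 1, γ.angle t = sSup (γ.angle '' Icc 0 1) :=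
  γ.isCompact_angle_image.sSup_mem ((nonempty_Icc.2 zero_le_one).image _)

theorem exists_sInf_eq (γ : RegularCurve) :
    ∃ t ∈ Icc (0 : ℝ) 1, γ.angle t = sInf (γ.angle '' Icc 0 1) :=
  γ.isCompact_angle_image.sInf_mem ((nonempty_Icc.2 zero_le_one).image _)

theorem angle_sub_le_amplitude (γ : RegularCurve) {a b : ℝ} (ha : a ∈ Icc (0 : ℝ) 1)
    (hb : b ∈ Icc (0 : ℝ) 1) : γ.angle a - γ.angle b ≤ γ.amplitude := by
  rw [amplitude_eq]
  exact sub_le_sub (γ.angle_le_sSup ha) (γ.sInf_le_angle hb)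

theorem exists_amplitude_eq (γ : RegularCurve) :
    ∃ a ∈ Icc (0 : ℝ) 1, ∃ b ∈ Icc (0 : ℝ) 1, γ.amplitude = γ.angle a - γ.angle b := by
  obtain ⟨a, ha, h1⟩ := γ.exists_sSup_eq
  obtain ⟨b, hb, h2⟩ := γ.exists_sInf_eq
  exact ⟨a, ha, b, hb, by rw [amplitude_eq, h1, h2]⟩

theorem amplitude_le_of_range {γ η : RegularCurve}
    (hle : ∀ t ∈ Icc (0 : ℝ) 1, ∃ u ∈ Icc (0 : ℝ) 1, γ.angle t ≤ η.angle u)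
    (hge : ∀ t ∈ Icc (0 : ℝ) 1, ∃ u ∈ Icc (0 : ℝ) 1, η.angle u ≤ γ.angle t) :
    γ.amplitude ≤ η.amplitude := by
  obtain ⟨a, ha, b, hb, h⟩ := γ.exists_amplitude_eq
  obtain ⟨a', ha', h1⟩ := hle a ha
  obtain ⟨b', hb', h2⟩ := hge b hb
  have := η.angle_sub_le_amplitude ha' hb'
  linarith

end RegularCurve

/-! ### Condensed curves encoded by speed and angle -/

/-- Speed and argument of the unit tangent of a condensed curve from the origin to `q`, with
curvature in `[-κ₀, κ₀]` and total turning `θ₁`. -/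
structure CondensedProfile (κ₀ : ℝ) (q : ℂ) (θ₁ : ℝ) where
  /-- the speed -/
  speed : ℝ → ℝ
  /-- the argument of the unit tangent -/
  angle : ℝ → ℝ
  continuousOn_speed : ContinuousOn speed (Icc 0 1)
  speed_pos : ∀ t ∈ Icc (0 : ℝ) 1, 0 < speed t
  abs_angle_sub_le : ∀ a ∈ Icc (0 : ℝ) 1, ∀ b ∈ Icc (0 : ℝ) 1, a ≤ b →
    |angle b - angle a| ≤ κ₀ * ∫ τ in a..b, speed τ
  angle_zero : angle 0 = 0
  angle_one : angle 1 = θ₁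
  integral_eq : ∫ t in (0 : ℝ)..1, (speed t • Complex.exp (angle t * Complex.I) : ℂ) = q
  condensed : ∀ a ∈ Icc (0 : ℝ) 1, ∀ b ∈ Icc (0 : ℝ) 1, angle b - angle a < Real.pi

namespace CondensedProfile

variable {κ₀ : ℝ} {q : ℂ} {z : Circle} {θ₁ : ℝ}

theorem isLip_angle (hκ : 0 < κ₀) (p : CondensedProfile κ₀ q θ₁) : IsLip p.angle :=
  IsLip.of_le_integral hκ.le p.continuousOn_speed p.abs_angle_sub_le

theorem continuousOn_angle (hκ : 0 < κ₀) (p : CondensedProfile κ₀ q θ₁) :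
    ContinuousOn p.angle (Icc 0 1) := (p.isLip_angle hκ).continuousOn

/-- The velocity of the curve. -/
def velocity (p : CondensedProfile κ₀ q θ₁) (t : ℝ) : ℂ :=
  p.speed t • Complex.exp (p.angle t * Complex.I)

theorem continuousOn_direction (hκ : 0 < κ₀) (p : CondensedProfile κ₀ q θ₁) :
    ContinuousOn (fun t => Complex.exp (p.angle t * Complex.I)) (Icc 0 1) := by
  have := Complex.continuous_ofReal.comp_continuousOn (p.continuousOn_angle hκ)
  exact Complex.continuous_exp.comp_continuousOn (this.mul continuousOn_const)

theorem continuousOn_velocity (hκ : 0 < κ₀) (p : CondensedProfile κ₀ q θ₁) :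
    ContinuousOn p.velocity (Icc 0 1) :=
  p.continuousOn_speed.smul (p.continuousOn_direction hκ)

theorem norm_velocity (p : CondensedProfile κ₀ q θ₁) {t : ℝ} (ht : t ∈ Icc (0 : ℝ) 1) :
    ‖p.velocity t‖ = p.speed t := by
  rw [velocity, norm_smul, Complex.norm_exp_ofReal_mul_I, mul_one, Real.norm_eq_abs,
    abs_of_pos (p.speed_pos t ht)]

/-- The underlying regular curve. -/
def toRegular (hκ : 0 < κ₀) (p : CondensedProfile κ₀ q θ₁) : RegularCurve :=
  RegularCurve.ofVelocity p.velocity (p.continuousOn_velocity hκ) fun t ht =>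
    norm_pos_iff.1 ((p.norm_velocity ht).symm ▸ p.speed_pos t ht)

theorem velocity_toRegular (hκ : 0 < κ₀) (p : CondensedProfile κ₀ q θ₁) {t : ℝ}
    (ht : t ∈ Icc (0 : ℝ) 1) : (p.toRegular hκ).velocity t = p.velocity t :=
  RegularCurve.ofVelocity_velocity _ _ ht

theorem path_toRegular (hκ : 0 < κ₀) (p : CondensedProfile κ₀ q θ₁) {t : ℝ}
    (ht : t ∈ Icc (0 : ℝ) 1) : (p.toRegular hκ).path t = ∫ τ in (0 : ℝ)..t, p.velocity τ :=
  RegularCurve.ofVelocity_path _ _ ht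

theorem speed_toRegular (hκ : 0 < κ₀) (p : CondensedProfile κ₀ q θ₁) {t : ℝ}
    (ht : t ∈ Icc (0 : ℝ) 1) : (p.toRegular hκ).speed t = p.speed t := by
  rw [RegularCurve.speed, p.velocity_toRegular hκ ht, p.norm_velocity ht]

theorem unitTangent_toRegular (hκ : 0 < κ₀) (p : CondensedProfile κ₀ q θ₁) {t : ℝ}
    (ht : t ∈ Icc (0 : ℝ) 1) :
    (p.toRegular hκ).unitTangent t = Complex.exp (p.angle t * Complex.I) := by
  have : (p.speed t : ℂ) ≠ 0 := Complex.ofReal_ne_zero.2 (p.speed_pos t ht).ne'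
  rw [RegularCurve.unitTangent, p.velocity_toRegular hκ ht, p.norm_velocity ht, velocity,
    Complex.real_smul, mul_div_cancel_left₀ _ this]

theorem angle_toRegular (hκ : 0 < κ₀) (p : CondensedProfile κ₀ q θ₁) {t : ℝ}
    (ht : t ∈ Icc (0 : ℝ) 1) : (p.toRegular hκ).angle t = p.angle t :=
  RegularCurve.IsArgument.angle_eq
    ⟨p.continuousOn_angle hκ, fun _ hs => p.unitTangent_toRegular hκ hs⟩ p.angle_zero ht

theorem arcLength_toRegular (hκ : 0 < κ₀) (p : CondensedProfile κ₀ q θ₁) {t : ℝ}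
    (ht : t ∈ Icc (0 : ℝ) 1) : (p.toRegular hκ).arcLength t = ∫ τ in (0 : ℝ)..t, p.speed τ :=
  intervalIntegral.integral_congr fun _ hτ =>
    p.speed_toRegular hκ (uIcc_subset_Icc (by simp) ht hτ)

/-- The condensed curve with given speed and argument. -/
def toCurve (hκ : 0 < κ₀) (hz : Circle.exp θ₁ = z) (p : CondensedProfile κ₀ q θ₁) :
    condensedCurves κ₀ (q, z) θ₁ :=
  ⟨⟨p.toRegular hκ, by
    have h0 : (0 : ℝ) ∈ Icc (0 : ℝ) 1 := by simp
    have h1 : (1 : ℝ) ∈ Icc (0 : ℝ) 1 := by simp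
    refine ⟨⟨?_, ?_⟩, ⟨?_, ?_⟩, (RegularCurve.quotient_bounds_iff _ _).2 fun a ha b hb hab => ?_⟩
    · rw [p.path_toRegular hκ h0]
      simp [originFrame]
    · rw [p.unitTangent_toRegular hκ h0, p.angle_zero]
      simp [originFrame]
    · rw [p.path_toRegular hκ h1]
      exact p.integral_eq
    · rw [p.unitTangent_toRegular hκ h1, p.angle_one, ← hz]
      simp
    · rw [p.angle_toRegular hκ ha, p.angle_toRegular hκ hb, p.arcLength_toRegular hκ ha,
        p.arcLength_toRegular hκ hb, integral_unit_sub p.continuousOn_speed ha hb]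
      exact p.abs_angle_sub_le a ha b hb hab⟩, by
    refine ⟨?_, ?_⟩
    · rw [RegularCurve.totalTurning_eq, p.angle_toRegular hκ (by simp), p.angle_one]
    · obtain ⟨a, ha, b, hb, h⟩ := (p.toRegular hκ).exists_amplitude_eq
      change (p.toRegular hκ).amplitude < _
      rw [h, p.angle_toRegular hκ ha, p.angle_toRegular hκ hb]
      exact p.condensed b hb a ha⟩

theorem toCurve_coe (hκ : 0 < κ₀) (hz : Circle.exp θ₁ = z) (p : CondensedProfile κ₀ q θ₁) :
    (p.toCurve hκ hz).1.1 = p.toRegular hκ := rfl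

end CondensedProfile

namespace CurveSpace

variable {κ₀ : ℝ} {Q : ℂ × Circle}

theorem unitTangent_zero (γ : CurveSpace (-κ₀) κ₀ originFrame Q) : γ.1.unitTangent 0 = 1 :=
  γ.2.1.2

theorem path_zero (γ : CurveSpace (-κ₀) κ₀ originFrame Q) : γ.1.path 0 = 0 := γ.2.1.1

theorem velocity_eq (γ : CurveSpace (-κ₀) κ₀ originFrame Q) {t : ℝ} (ht : t ∈ Icc (0 : ℝ) 1) :
    γ.1.velocity t = γ.1.speed t • Complex.exp (γ.1.angle t * Complex.I) := by
  rw [γ.1.velocity_eq_angle γ.unitTangent_zero ht, Complex.real_smul]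

theorem path_eq (γ : CurveSpace (-κ₀) κ₀ originFrame Q) {t : ℝ} (ht : t ∈ Icc (0 : ℝ) 1) :
    γ.1.path t = ∫ τ in (0 : ℝ)..t, (γ.1.speed τ • Complex.exp (γ.1.angle τ * Complex.I) : ℂ) := by
  rw [γ.1.path_eq_integral ht, γ.path_zero, zero_add]
  exact intervalIntegral.integral_congr fun τ hτ =>
    γ.velocity_eq (uIcc_subset_Icc (by simp) ht hτ)

theorem abs_angle_sub_le (γ : CurveSpace (-κ₀) κ₀ originFrame Q) {a b : ℝ}
    (ha : a ∈ Icc (0 : ℝ) 1) (hb : b ∈ Icc (0 : ℝ) 1) (hab : a ≤ b) :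
    |γ.1.angle b - γ.1.angle a| ≤ κ₀ * ∫ τ in a..b, γ.1.speed τ := by
  rw [← γ.1.arcLength_sub_eq ha hb]
  exact (γ.1.quotient_bounds_iff κ₀).1 γ.2.2.2 a ha b hb hab

end CurveSpace

namespace CondensedProfile

variable {κ₀ : ℝ} {q : ℂ} {z : Circle} {θ₁ : ℝ}

/-- Speed and argument of a condensed curve. -/
def ofCurve (γ : condensedCurves κ₀ (q, z) θ₁) : CondensedProfile κ₀ q θ₁ where
  speed := γ.1.1.speed
  angle := γ.1.1.angle
  continuousOn_speed := γ.1.1.continuousOn_speed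
  speed_pos _ ht := γ.1.1.speed_pos ht
  abs_angle_sub_le _ ha _ hb hab := γ.1.abs_angle_sub_le ha hb hab
  angle_zero := γ.1.1.angle_zero
  angle_one := γ.2.1
  integral_eq := by
    rw [← γ.1.path_eq (by simp)]
    exact γ.1.2.2.1.1
  condensed _ ha _ hb := (γ.1.1.angle_sub_le_amplitude hb ha).trans_lt γ.2.2

theorem toCurve_eq (hκ : 0 < κ₀) (hz : Circle.exp θ₁ = z) (p : CondensedProfile κ₀ q θ₁)
    (γ : condensedCurves κ₀ (q, z) θ₁)
    (hs : ∀ t ∈ Icc (0 : ℝ) 1, p.speed t = γ.1.1.speed t)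
    (ha : ∀ t ∈ Icc (0 : ℝ) 1, p.angle t = γ.1.1.angle t) : p.toCurve hκ hz = γ := by
  apply Subtype.ext
  apply Subtype.ext
  refine RegularCurve.ext_of_velocity ?_ fun t ht => ?_
  · rw [γ.1.path_zero, (p.toCurve hκ hz).1.path_zero]
  · rw [γ.1.velocity_eq ht, toCurve_coe, p.velocity_toRegular hκ ht, velocity, hs t ht, ha t ht]

theorem toCurve_congr (hκ : 0 < κ₀) (hz : Circle.exp θ₁ = z) {p p' : CondensedProfile κ₀ q θ₁}
    (hs : ∀ t ∈ Icc (0 : ℝ) 1, p.speed t = p'.speed t)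
    (ha : ∀ t ∈ Icc (0 : ℝ) 1, p.angle t = p'.angle t) : p.toCurve hκ hz = p'.toCurve hκ hz :=
  toCurve_eq hκ hz p _
    (fun t ht => by rw [hs t ht, toCurve_coe, p'.speed_toRegular hκ ht])
    (fun t ht => by rw [ha t ht, toCurve_coe, p'.angle_toRegular hκ ht])

end CondensedProfile

/-! ### Consequences of convergence in the metric -/

namespace CurveSpace

variable {κ₀ : ℝ} {Q : ℂ × Circle}

theorem abs_curvature_le (hκ : 0 < κ₀) (γ : CurveSpace (-κ₀) κ₀ originFrame Q) {t : ℝ}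
    (ht : t ∈ Ioo (0 : ℝ) 1) : |γ.1.curvature t| ≤ κ₀ := by
  have hp := γ.1.speed_pos (Ioo_subset_Icc_self ht)
  rw [γ.1.curvature_eq, abs_div, abs_of_pos hp, div_le_iff₀ hp]
  exact abs_deriv_le_of_le_integral hκ.le γ.1.continuousOn_speed
    (fun t ht => (γ.1.speed_pos ht).le) (fun a ha b hb hab => γ.abs_angle_sub_le ha hb hab) ht

theorem tendsto_iff (γ : ℕ → CurveSpace (-κ₀) κ₀ originFrame Q)
    (η : CurveSpace (-κ₀) κ₀ originFrame Q) :
    Tendsto γ atTop (𝓝 η) ↔ L2Tendsto (fun n => (γ n).1.path) η.1.path ∧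
      L2Tendsto (fun n => (γ n).1.velocity) η.1.velocity ∧
      L2Tendsto (fun n => (γ n).1.curvature) η.1.curvature := by
  rw [l2Tendsto_iff_l2norm (fun n => memLp_two_unit (γ n).continuousOn_path)
      (memLp_two_unit η.continuousOn_path),
    l2Tendsto_iff_l2norm (fun n => memLp_two_unit (γ n).1.continuousOn_velocity)
      (memLp_two_unit η.1.continuousOn_velocity),
    l2Tendsto_iff_l2norm (fun n => (γ n).memLp_curvature) η.memLp_curvature,
    tendsto_iff_dist_tendsto_zero]
  have hd : ∀ n, dist (γ n) η = l2norm ((γ n).1.path - η.1.path) +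
    l2norm ((γ n).1.velocity - η.1.velocity) + l2norm ((γ n).1.curvature - η.1.curvature) :=
    fun _ => rfl
  simp only [hd]
  constructor
  · intro h
    have h0 : ∀ {E : Type} [NormedAddCommGroup E] (f : ℝ → E), 0 ≤ l2norm f :=
      fun f => lpNorm_nonneg
    refine ⟨?_, ?_, ?_⟩ <;>
    · refine squeeze_zero (fun _ => h0 _) (fun n => ?_) h
      have h1 := h0 ((γ n).1.path - η.1.path)
      have h2 := h0 ((γ n).1.velocity - η.1.velocity)
      have h3 := h0 ((γ n).1.curvature - η.1.curvature)
      linarith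
  · rintro ⟨h1, h2, h3⟩
    simpa using (h1.add h2).add h3

theorem deriv_angle_eq (γ : CurveSpace (-κ₀) κ₀ originFrame Q) {t : ℝ}
    (ht : t ∈ Icc (0 : ℝ) 1) : deriv γ.1.angle t = γ.1.speed t * γ.1.curvature t := by
  have hp := γ.1.speed_pos ht
  rw [γ.1.curvature_eq]
  field_simp

theorem isLip_angle (hκ : 0 < κ₀) (γ : CurveSpace (-κ₀) κ₀ originFrame Q) : IsLip γ.1.angle :=
  IsLip.of_le_integral hκ.le γ.1.continuousOn_speed fun _ ha _ hb hab =>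
    γ.abs_angle_sub_le ha hb hab

theorem angle_eq_integral (hκ : 0 < κ₀) (γ : CurveSpace (-κ₀) κ₀ originFrame Q) {t : ℝ}
    (ht : t ∈ Icc (0 : ℝ) 1) :
    γ.1.angle t = ∫ τ in (0 : ℝ)..t, γ.1.speed τ • γ.1.curvature τ := by
  have h := (γ.isLip_angle hκ).integral_deriv (a := 0) (by simp) ht
  rw [γ.1.angle_zero, sub_zero] at h
  rw [← h]
  exact intervalIntegral.integral_congr fun τ hτ =>
    γ.deriv_angle_eq (uIcc_subset_Icc (by simp) ht hτ)

theorem l2Tendsto_speed {γ : ℕ → CurveSpace (-κ₀) κ₀ originFrame Q}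
    {η : CurveSpace (-κ₀) κ₀ originFrame Q} (h : Tendsto γ atTop (𝓝 η)) :
    L2Tendsto (fun n => (γ n).1.speed) η.1.speed := ((tendsto_iff γ η).1 h).2.1.norm

theorem memLp_speed_smul_curvature (hκ : 0 < κ₀) (γ : CurveSpace (-κ₀) κ₀ originFrame Q) :
    MemLp (fun t => γ.1.speed t • γ.1.curvature t) 2 unitMeasure := by
  obtain ⟨M, hM⟩ := isCompact_Icc.exists_bound_of_continuousOn γ.1.continuousOn_speed
  refine MemLp.of_bound
    ((aestronglyMeasurable_unit γ.1.continuousOn_speed).smul γ.memLp_curvature.1) (M * κ₀) ?_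
  refine ae_unit_of_forall_Ioo fun t ht => ?_
  rw [norm_smul]
  exact mul_le_mul (hM t (Ioo_subset_Icc_self ht)) (γ.abs_curvature_le hκ ht) (norm_nonneg _)
    ((norm_nonneg _).trans (hM t (Ioo_subset_Icc_self ht)))

/-- The angle is the primitive of speed times curvature. Curvatures are bounded by `κ₀`, so the
products converge in L² and their primitives uniformly. -/
theorem eventually_angle (hκ : 0 < κ₀) {γ : ℕ → CurveSpace (-κ₀) κ₀ originFrame Q}
    {η : CurveSpace (-κ₀) κ₀ originFrame Q} (h : Tendsto γ atTop (𝓝 η)) {ε : ℝ} (hε : 0 < ε) :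
    ∀ᶠ n in atTop, ∀ t ∈ Icc (0 : ℝ) 1, |(γ n).1.angle t - η.1.angle t| < ε := by
  have h1 : L2Tendsto (fun n t => (γ n).1.speed t • (γ n).1.curvature t)
      (fun t => η.1.speed t • η.1.curvature t) :=
    (l2Tendsto_speed h).smul ((tendsto_iff γ η).1 h).2.2
      (fun n => aestronglyMeasurable_unit (γ n).1.continuousOn_speed) η.1.continuousOn_speed
      (fun n => (γ n).memLp_curvature.1) η.memLp_curvature.1 κ₀
      fun n => ae_unit_of_forall_Ioo fun t ht => (γ n).abs_curvature_le hκ ht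
  filter_upwards [h1.eventually_integral (fun n => (γ n).memLp_speed_smul_curvature hκ)
    (η.memLp_speed_smul_curvature hκ) hε] with n hn t ht
  rw [(γ n).angle_eq_integral hκ ht, η.angle_eq_integral hκ ht]
  exact hn t ht

theorem tendsto_angle (hκ : 0 < κ₀) {γ : ℕ → CurveSpace (-κ₀) κ₀ originFrame Q}
    {η : CurveSpace (-κ₀) κ₀ originFrame Q} (h : Tendsto γ atTop (𝓝 η)) {t : ℝ}
    (ht : t ∈ Icc (0 : ℝ) 1) : Tendsto (fun n => (γ n).1.angle t) atTop (𝓝 (η.1.angle t)) := by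
  rw [Metric.tendsto_nhds]
  intro ε hε
  filter_upwards [eventually_angle hκ h hε] with n hn
  exact hn t ht

/-- Pointwise information is available only along a subsequence. This suffices, since a sequence
converges as soon as each of its subsequences has a further subsequence with the same limit. -/
theorem exists_seq_ae {γ : ℕ → CurveSpace (-κ₀) κ₀ originFrame Q}
    {η : CurveSpace (-κ₀) κ₀ originFrame Q} (h : Tendsto γ atTop (𝓝 η)) :
    ∃ ns : ℕ → ℕ, StrictMono ns ∧ ∀ᵐ t ∂unitMeasure,
      Tendsto (fun i => (γ (ns i)).1.speed t) atTop (𝓝 (η.1.speed t)) ∧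
      Tendsto (fun i => deriv (γ (ns i)).1.angle t) atTop (𝓝 (deriv η.1.angle t)) := by
  obtain ⟨ns, hns, h1⟩ := (l2Tendsto_speed h).exists_seq_ae
    (fun n => aestronglyMeasurable_unit (γ n).1.continuousOn_speed)
    (aestronglyMeasurable_unit η.1.continuousOn_speed)
  obtain ⟨ms, hms, h2⟩ := (((tendsto_iff γ η).1 h).2.2.comp hns.tendsto_atTop).exists_seq_ae
    (fun n => (γ (ns n)).memLp_curvature.1) η.memLp_curvature.1
  refine ⟨ns ∘ ms, hns.comp hms, ?_⟩
  filter_upwards [h1, h2, ae_unit_mem_Ioo] with t h1 h2 ht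
  have h1' : Tendsto (fun i => (γ (ns (ms i))).1.speed t) atTop (𝓝 (η.1.speed t)) :=
    h1.comp hms.tendsto_atTop
  refine ⟨h1', ?_⟩
  have ht' := Ioo_subset_Icc_self ht
  simp only [Function.comp_apply, deriv_angle_eq _ ht']
  exact h1'.mul h2

end CurveSpace

namespace CondensedProfile

variable {κ₀ : ℝ} {q : ℂ} {z : Circle} {θ₁ : ℝ}

theorem curvature_toRegular (hκ : 0 < κ₀) (p : CondensedProfile κ₀ q θ₁) {t : ℝ}
    (ht : t ∈ Ioo (0 : ℝ) 1) : (p.toRegular hκ).curvature t = deriv p.angle t / p.speed t := by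
  rw [RegularCurve.curvature_eq, p.speed_toRegular hκ (Ioo_subset_Icc_self ht)]
  congr 1
  refine Filter.EventuallyEq.deriv_eq ?_
  filter_upwards [Icc_mem_nhds ht.1 ht.2] with s hs using p.angle_toRegular hκ hs

theorem l2Tendsto_velocity (hκ : 0 < κ₀) {p : ℕ → CondensedProfile κ₀ q θ₁}
    {r : CondensedProfile κ₀ q θ₁} (hs : L2Tendsto (fun n => (p n).speed) r.speed)
    (ha : ∀ t ∈ Icc (0 : ℝ) 1, Tendsto (fun n => (p n).angle t) atTop (𝓝 (r.angle t))) :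
    L2Tendsto (fun n => (p n).velocity) r.velocity :=
  hs.smul_of_ae (fun n => aestronglyMeasurable_unit (p n).continuousOn_speed)
    r.continuousOn_speed
    (fun n => aestronglyMeasurable_unit ((p n).continuousOn_direction hκ))
    (aestronglyMeasurable_unit (r.continuousOn_direction hκ)) 1
    (fun _ => Eventually.of_forall fun _ => (Complex.norm_exp_ofReal_mul_I _).le)
    (Eventually.of_forall fun _ => (Complex.norm_exp_ofReal_mul_I _).le)
    (ae_unit_of_forall fun t ht => (Complex.continuous_exp.tendsto _).comp
      (((Complex.continuous_ofReal.tendsto _).comp (ha t ht)).mul_const _))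

/-- Curvatures share the bound `κ₀`, so almost everywhere convergence upgrades to L² by domination.
For the speeds, which have no common bound, L² convergence is assumed. -/
theorem tendsto_toCurve (hκ : 0 < κ₀) (hz : Circle.exp θ₁ = z) {p : ℕ → CondensedProfile κ₀ q θ₁}
    {r : CondensedProfile κ₀ q θ₁} (hs : L2Tendsto (fun n => (p n).speed) r.speed)
    (ha : ∀ t ∈ Icc (0 : ℝ) 1, Tendsto (fun n => (p n).angle t) atTop (𝓝 (r.angle t)))
    (hd : ∀ᵐ t ∂unitMeasure, Tendsto (fun n => deriv (p n).angle t / (p n).speed t) atTop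
      (𝓝 (deriv r.angle t / r.speed t))) :
    Tendsto (fun n => (p n).toCurve hκ hz) atTop (𝓝 (r.toCurve hκ hz)) := by
  rw [tendsto_subtype_rng, CurveSpace.tendsto_iff]
  have hvel := l2Tendsto_velocity hκ hs ha
  refine ⟨L2Tendsto.of_uniform fun ε hε => ?_, hvel.congr (fun n => ?_) ?_, ?_⟩
  · filter_upwards [hvel.eventually_integral
      (fun n => memLp_two_unit ((p n).continuousOn_velocity hκ))
      (memLp_two_unit (r.continuousOn_velocity hκ)) hε] with n hn t ht
    rw [toCurve_coe, toCurve_coe, path_toRegular hκ _ ht, path_toRegular hκ _ ht]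
    exact hn t ht
  · exact ae_unit_of_forall fun t ht => ((p n).velocity_toRegular hκ ht).symm
  · exact ae_unit_of_forall fun t ht => (r.velocity_toRegular hκ ht).symm
  · refine L2Tendsto.of_bounded (fun n => ((p n).toCurve hκ hz).1.memLp_curvature.1)
      (r.toCurve hκ hz).1.memLp_curvature.1 κ₀
      (fun n => ae_unit_of_forall_Ioo fun t ht =>
        ((p n).toCurve hκ hz).1.abs_curvature_le hκ ht)
      (ae_unit_of_forall_Ioo fun t ht => (r.toCurve hκ hz).1.abs_curvature_le hκ ht) ?_
    filter_upwards [hd, ae_unit_mem_Ioo] with t h1 ht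
    simpa only [toCurve_coe, curvature_toRegular hκ _ ht] using h1

end CondensedProfile

/-! ### Convergence of derivatives under maxima and minima -/

/-- Pointwise convergence on `[0,1]` of Lipschitz functions, together with the convergence of
the derivatives almost everywhere. -/
structure LipTendsto (f : ℕ → ℝ → ℝ) (g : ℝ → ℝ) : Prop where
  isLip : ∀ n, IsLip (f n)
  isLip_lim : IsLip g
  tendsto : ∀ t ∈ Icc (0 : ℝ) 1, Tendsto (fun n => f n t) atTop (𝓝 (g t))
  tendsto_deriv : ∀ᵐ t ∂unitMeasure, Tendsto (fun n => deriv (f n) t) atTop (𝓝 (deriv g t))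

theorem deriv_max_of_lt {f g : ℝ → ℝ} {t : ℝ} (hf : ContinuousAt f t) (hg : ContinuousAt g t)
    (h : f t < g t) : deriv (fun s => max (f s) (g s)) t = deriv g t := by
  refine Filter.EventuallyEq.deriv_eq ?_
  filter_upwards [hf.eventually_lt hg h] with s hs using max_eq_right hs.le

/-- The nonnegative function max(f, g) - f vanishes at `t`, hence has a minimum there. -/
theorem deriv_max_of_eq {f g : ℝ → ℝ} {t : ℝ} (hf : DifferentiableAt ℝ f t)
    (hm : DifferentiableAt ℝ (fun s => max (f s) (g s)) t) (h : f t = g t) :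
    deriv (fun s => max (f s) (g s)) t = deriv f t := by
  have hmin : IsLocalMin (fun s => max (f s) (g s) - f s) t :=
    Eventually.of_forall fun s => by simp [h]
  have h1 := hmin.deriv_eq_zero
  rw [show (fun s => max (f s) (g s) - f s) = (fun s => max (f s) (g s)) - f from rfl,
    deriv_sub hm hf] at h1
  linarith

theorem deriv_max_eq_or {f g : ℝ → ℝ} {t : ℝ} (hf : DifferentiableAt ℝ f t)
    (hg : DifferentiableAt ℝ g t) (hm : DifferentiableAt ℝ (fun s => max (f s) (g s)) t) :
    deriv (fun s => max (f s) (g s)) t = deriv f t ∨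
      deriv (fun s => max (f s) (g s)) t = deriv g t := by
  rcases lt_trichotomy (f t) (g t) with h | h | h
  · exact Or.inr (deriv_max_of_lt hf.continuousAt hg.continuousAt h)
  · exact Or.inl (deriv_max_of_eq hf hm h)
  · simp only [max_comm (f _)]
    exact Or.inl (deriv_max_of_lt hg.continuousAt hf.continuousAt h)

namespace LipTendsto

theorem const {c : ℕ → ℝ} {d : ℝ} (h : Tendsto c atTop (𝓝 d)) :
    LipTendsto (fun n _ => c n) (fun _ => d) where
  isLip _ := IsLip.const _
  isLip_lim := IsLip.const _
  tendsto _ _ := h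
  tendsto_deriv := Eventually.of_forall fun t => by simp

theorem add {f f' : ℕ → ℝ → ℝ} {g g' : ℝ → ℝ} (h : LipTendsto f g) (h' : LipTendsto f' g') :
    LipTendsto (fun n t => f n t + f' n t) (fun t => g t + g' t) where
  isLip n := (h.isLip n).add (h'.isLip n)
  isLip_lim := h.isLip_lim.add h'.isLip_lim
  tendsto t ht := (h.tendsto t ht).add (h'.tendsto t ht)
  tendsto_deriv := by
    filter_upwards [h.tendsto_deriv, h'.tendsto_deriv,
      ae_all_iff.2 fun n => (h.isLip n).ae_differentiableAt,
      ae_all_iff.2 fun n => (h'.isLip n).ae_differentiableAt,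
      h.isLip_lim.ae_differentiableAt, h'.isLip_lim.ae_differentiableAt]
      with t h1 h2 h3 h4 h5 h6
    rw [deriv_fun_add h5 h6]
    exact (h1.add h2).congr fun n => (deriv_fun_add (h3 n) (h4 n)).symm

theorem const_mul {f : ℕ → ℝ → ℝ} {g : ℝ → ℝ} (c : ℝ) (h : LipTendsto f g) :
    LipTendsto (fun n t => c * f n t) (fun t => c * g t) where
  isLip n := (h.isLip n).const_mul c
  isLip_lim := h.isLip_lim.const_mul c
  tendsto t ht := (h.tendsto t ht).const_mul c
  tendsto_deriv := by
    filter_upwards [h.tendsto_deriv] with t h1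
    simpa only [deriv_const_mul_field] using h1.const_mul c

/-- Where the limits differ, the larger one also wins eventually along the sequence. Where they
agree, almost everywhere their derivatives agree as well, so it does not matter which of the two
functions the maximum follows. -/
theorem max {f f' : ℕ → ℝ → ℝ} {g g' : ℝ → ℝ} (h : LipTendsto f g) (h' : LipTendsto f' g') :
    LipTendsto (fun n t => max (f n t) (f' n t)) (fun t => max (g t) (g' t)) where
  isLip n := (h.isLip n).max (h'.isLip n)
  isLip_lim := h.isLip_lim.max h'.isLip_lim
  tendsto t ht := (h.tendsto t ht).max (h'.tendsto t ht)
  tendsto_deriv := by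
    filter_upwards [h.tendsto_deriv, h'.tendsto_deriv,
      ae_all_iff.2 fun n => (h.isLip n).ae_differentiableAt,
      ae_all_iff.2 fun n => (h'.isLip n).ae_differentiableAt,
      ae_all_iff.2 fun n => ((h.isLip n).max (h'.isLip n)).ae_differentiableAt,
      h.isLip_lim.ae_differentiableAt, h'.isLip_lim.ae_differentiableAt,
      (h.isLip_lim.max h'.isLip_lim).ae_differentiableAt, ae_unit_mem_Ioo]
      with t h1 h2 h3 h4 h5 h6 h7 h8 ht
    have ht' := Ioo_subset_Icc_self ht
    rcases lt_trichotomy (g t) (g' t) with hlt | heq | hlt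
    · rw [deriv_max_of_lt h6.continuousAt h7.continuousAt hlt]
      refine h2.congr' ?_
      filter_upwards [(h.tendsto t ht').eventually_lt (h'.tendsto t ht') hlt] with n hn
      exact (deriv_max_of_lt (h3 n).continuousAt (h4 n).continuousAt hn).symm
    -- Contact set of the limits: both limiting derivatives equal that of the maximum. For each `n`
    -- the derivative is one of the two candidates, and both candidates tend to this common value.
    · have e1 := deriv_max_of_eq h6 h8 heq
      have h8' : DifferentiableAt ℝ (fun s => Max.max (g' s) (g s)) t := by
        simpa only [max_comm (g _)] using h8
      have e2 := deriv_max_of_eq h7 h8' heq.symm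
      simp only [max_comm (g' _)] at e2
      rw [Metric.tendsto_nhds] at h1 h2 ⊢
      intro ε hε
      filter_upwards [h1 ε hε, h2 ε hε] with n hn1 hn2
      rcases deriv_max_eq_or (h3 n) (h4 n) (h5 n) with h | h
      · rw [h, e1]; exact hn1
      · rw [h, e2]; exact hn2
    · simp only [max_comm (g _), max_comm (f _ _)]
      rw [deriv_max_of_lt h7.continuousAt h6.continuousAt hlt]
      refine h1.congr' ?_
      filter_upwards [(h'.tendsto t ht').eventually_lt (h.tendsto t ht') hlt] with n hn
      exact (deriv_max_of_lt (h4 n).continuousAt (h3 n).continuousAt hn).symm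

theorem min {f f' : ℕ → ℝ → ℝ} {g g' : ℝ → ℝ} (h : LipTendsto f g) (h' : LipTendsto f' g') :
    LipTendsto (fun n t => min (f n t) (f' n t)) (fun t => min (g t) (g' t)) := by
  have h1 := ((h.const_mul (-1)).max (h'.const_mul (-1))).const_mul (-1)
  simpa only [neg_one_mul, max_neg_neg, neg_neg] using h1

end LipTendsto

/-! ### Truncation of a real number inside an interval -/

/-- The value closest to `g` between the values closest to `lam` and to `mu` in `[l, u]`. -/
def truncate (l u g lam mu : ℝ) : ℝ := max (max l (min lam u)) (min g (max l (min mu u)))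

namespace truncate

variable {l u g lam mu : ℝ}

theorem eq_self_of_eq (hl : l = g) (hu : u = g) : truncate l u g lam mu = g := by
  subst hl
  subst hu
  simp [truncate]

theorem eq_level : truncate l u g lam lam = max l (min lam u) := by
  rw [truncate, max_eq_left (min_le_right _ _)]

theorem mono {lam' mu' : ℝ} (h1 : lam ≤ lam') (h2 : mu ≤ mu') :
    truncate l u g lam mu ≤ truncate l u g lam' mu' := by
  unfold truncate
  gcongr

theorem le_upper (hl : l ≤ u) (hu : g ≤ u) : truncate l u g lam mu ≤ u :=
  max_le (max_le hl (min_le_right _ _)) ((min_le_left _ _).trans hu)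

theorem lower_le : l ≤ truncate l u g lam mu :=
  le_max_of_le_left (le_max_left _ _)

/-- Clamping to an interval absorbs an earlier clamping to a larger one. The clamped levels inherit
the order a ≤ b ≤ c ≤ d from the levels. -/
theorem nested {lam' mu' : ℝ} (h1 : lam' ≤ lam) (h2 : lam ≤ mu)
    (h3 : mu ≤ mu') :
    truncate l u (truncate l u g lam' mu') lam mu = truncate l u g lam mu := by
  have e1 : max l (min lam' u) ≤ max l (min lam u) := by gcongr
  have e2 : max l (min lam u) ≤ max l (min mu u) := by gcongr
  have e3 : max l (min mu u) ≤ max l (min mu' u) := by gcongr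
  simp only [truncate]
  generalize max l (min lam' u) = a at *
  generalize max l (min lam u) = b at *
  generalize max l (min mu u) = c at *
  generalize max l (min mu' u) = d at *
  have h3 : max a d = d := max_eq_right (e1.trans (e2.trans e3))
  -- An extra `max b` under the outer one changes nothing, and it absorbs the inner lower clamp
  -- because a ≤ b.
  have h4 : max b (min (max a (min g d)) c) = max b (min (max b (max a (min g d))) c) := by
    rw [max_min_distrib_left b (max b _), max_min_distrib_left b (max a _), ← max_assoc b b,
      max_self]
  rw [h4, ← max_assoc, max_eq_left e1, max_min_distrib_left b g d, max_eq_right (e2.trans e3),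
    min_assoc, min_eq_right e3, max_min_distrib_left, ← max_assoc, max_self,
    ← max_min_distrib_left]

/-- A raised value is the lower level clamped to [l, u]. It exceeds g ≥ l, so it does not come from
`l`, and is therefore min(lam, u). -/
theorem le_lam (hl : l ≤ g) (h : g < truncate l u g lam mu) :
    truncate l u g lam mu ≤ lam := by
  rcases lt_max_iff.1 h with h1 | h1
  · have h2 : min g (max l (min mu u)) ≤ max l (min lam u) := (min_le_left _ _).trans h1.le
    rw [truncate, max_eq_left h2]
    rcases lt_max_iff.1 h1 with h3 | h3
    · exact absurd h3 hl.not_gt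
    · rw [max_eq_right (hl.trans h3.le)]
      exact min_le_left _ _
  · exact absurd h1 (min_le_left _ _).not_gt

theorem mu_le (hu : g ≤ u) (h : truncate l u g lam mu < g) :
    mu ≤ truncate l u g lam mu := by
  have h1 : min g (max l (min mu u)) < g := (le_max_right _ _).trans_lt h
  have h2 : max l (min mu u) < g := by
    by_contra! h3
    rw [min_eq_left h3] at h1
    exact lt_irrefl _ h1
  have h3 : mu ≤ min mu u := by
    refine le_min le_rfl ?_
    by_contra! h4
    have : min mu u = u := min_eq_right h4.le
    have := (le_max_right l (min mu u)).trans_lt h2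
    linarith
  calc mu ≤ max l (min mu u) := le_max_of_le_right h3
    _ = min g (max l (min mu u)) := (min_eq_right h2.le).symm
    _ ≤ _ := le_max_right _ _

theorem le_of_le {r : ℝ} (hl : l ≤ r) (h1 : lam ≤ r) (hg : g ≤ r) :
    truncate l u g lam mu ≤ r :=
  max_le (max_le hl ((min_le_left _ _).trans h1)) ((min_le_left _ _).trans hg)

theorem ge_of_ge {r : ℝ} (hu : r ≤ u) (h2 : r ≤ mu) (hg : r ≤ g) :
    r ≤ truncate l u g lam mu :=
  le_max_of_le_right (le_min hg (le_max_of_le_right (le_min h2 hu)))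

end truncate

/-! ### The graph coordinates: abscissa and sine of the relative angle -/

theorem abs_sub_le_integral_of_ae {f w : ℝ → ℝ} {κ : ℝ} (hf : IsLip f)
    (hw : ContinuousOn w (Icc 0 1)) (h : ∀ᵐ t ∂unitMeasure, |deriv f t| ≤ κ * w t) :
    ∀ a ∈ Icc (0 : ℝ) 1, ∀ b ∈ Icc (0 : ℝ) 1, a ≤ b → |f b - f a| ≤ κ * ∫ τ in a..b, w τ := by
  intro a ha b hb hab
  rw [← hf.integral_deriv ha hb, ← intervalIntegral.integral_const_mul]
  rw [← Real.norm_eq_abs]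
  refine intervalIntegral.norm_integral_le_of_norm_le hab ?_
    ((intervalIntegrable_unit hw ha hb).const_mul κ)
  rw [unitMeasure, ae_restrict_iff' measurableSet_Icc] at h
  filter_upwards [h] with t ht hmem
  exact ht ⟨ha.1.trans hmem.1.le, hmem.2.trans hb.2⟩

/-- The slope of a line whose angle with the horizontal axis has a given sine. -/
def slopeOfSine (g : ℝ) : ℝ := g / √(1 - g ^ 2)

theorem one_sub_sq_pos {g ρ : ℝ} (hρ : ρ < 1) (hg : |g| ≤ ρ) : 0 < 1 - g ^ 2 := by
  have := sq_abs g
  nlinarith [abs_nonneg g]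

theorem continuousAt_slopeOfSine {g ρ : ℝ} (hρ : ρ < 1) (hg : |g| ≤ ρ) :
    ContinuousAt slopeOfSine g := by
  have h := one_sub_sq_pos hρ hg
  unfold slopeOfSine
  refine ContinuousAt.div continuousAt_id (by fun_prop) (Real.sqrt_pos.2 h).ne'

theorem abs_arcsin_le {g ρ : ℝ} (hg : |g| ≤ ρ) : |Real.arcsin g| ≤ Real.arcsin ρ := by
  rw [abs_le] at hg ⊢
  rw [← Real.arcsin_neg]
  exact ⟨Real.monotone_arcsin hg.1, Real.monotone_arcsin hg.2⟩

/-- The derivative of arcsin blows up only at ±1, and condensedness keeps the sines at distance 1 -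
ρ from these values. -/
theorem abs_arcsin_sub_le {ρ a b : ℝ} (hρ : ρ < 1) (ha : |a| ≤ ρ) (hb : |b| ≤ ρ) :
    |Real.arcsin a - Real.arcsin b| ≤ 1 / √(1 - ρ ^ 2) * |a - b| := by
  have hmem : ∀ x ∈ Icc (-ρ) ρ, |x| ≤ ρ := fun x hx => abs_le.2 hx
  refine Convex.norm_image_sub_le_of_norm_hasDerivWithin_le (f := Real.arcsin)
    (f' := fun x => 1 / √(1 - x ^ 2)) (s := Icc (-ρ) ρ) (fun x hx => ?_) (fun x hx => ?_)
    (convex_Icc _ _) (abs_le.1 hb) (abs_le.1 ha)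
  · have := abs_le.1 (hmem x hx)
    exact (Real.hasDerivAt_arcsin (by linarith) (by linarith)).hasDerivWithinAt
  · have h1 := hmem x hx
    have h2 := one_sub_sq_pos hρ (le_refl |ρ| |>.trans (abs_of_nonneg ((abs_nonneg _).trans ha)).le)
    rw [Real.norm_eq_abs, abs_of_nonneg (by positivity)]
    refine one_div_le_one_div_of_le (Real.sqrt_pos.2 h2) (Real.sqrt_le_sqrt ?_)
    have := sq_le_sq' (abs_le.1 h1).1 (abs_le.1 h1).2
    linarith

namespace RegularCurve

/-- The middle of the range of the argument. -/
def midAngle (γ : RegularCurve) : ℝ :=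
  (sSup (γ.angle '' Icc 0 1) + sInf (γ.angle '' Icc 0 1)) / 2

/-- The sine of the half of the amplitude. -/
def maxSine (γ : RegularCurve) : ℝ := Real.sin (γ.amplitude / 2)

/-- The speed of the projection to the line of direction `midAngle`. -/
def axialSpeed (γ : RegularCurve) (t : ℝ) : ℝ := γ.speed t * Real.cos (γ.angle t - γ.midAngle)

/-- The sine of the angle with the direction `midAngle`. -/
def sine (γ : RegularCurve) (t : ℝ) : ℝ := Real.sin (γ.angle t - γ.midAngle)

/-- The coordinate along the line of direction `midAngle`. -/
def abscissa (γ : RegularCurve) (t : ℝ) : ℝ := ∫ τ in (0 : ℝ)..t, γ.axialSpeed τ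

theorem abs_angle_sub_midAngle_le (γ : RegularCurve) {t : ℝ} (ht : t ∈ Icc (0 : ℝ) 1) :
    |γ.angle t - γ.midAngle| ≤ γ.amplitude / 2 := by
  have h1 := γ.angle_le_sSup ht
  have h2 := γ.sInf_le_angle ht
  rw [abs_le, midAngle, amplitude_eq]
  constructor <;> linarith

theorem amplitude_nonneg (γ : RegularCurve) : 0 ≤ γ.amplitude := by
  simpa using γ.angle_sub_le_amplitude (a := 0) (b := 0) (by simp) (by simp)

theorem continuousOn_axialSpeed (γ : RegularCurve) : ContinuousOn γ.axialSpeed (Icc 0 1) :=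
  γ.continuousOn_speed.mul
    (Real.continuous_cos.comp_continuousOn (γ.continuousOn_angle.sub continuousOn_const))

theorem continuousOn_sine (γ : RegularCurve) : ContinuousOn γ.sine (Icc 0 1) :=
  Real.continuous_sin.comp_continuousOn (γ.continuousOn_angle.sub continuousOn_const)

theorem abscissa_sub (γ : RegularCurve) {a b : ℝ} (ha : a ∈ Icc (0 : ℝ) 1)
    (hb : b ∈ Icc (0 : ℝ) 1) :
    γ.abscissa b - γ.abscissa a = ∫ τ in a..b, γ.axialSpeed τ :=
  integral_unit_sub γ.continuousOn_axialSpeed ha hb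

theorem maxSine_nonneg {γ : RegularCurve} (hγ : γ.IsCondensed) : 0 ≤ γ.maxSine :=
  Real.sin_nonneg_of_nonneg_of_le_pi (by linarith [γ.amplitude_nonneg])
    (by have : γ.amplitude < Real.pi := hγ
        linarith [γ.amplitude_nonneg])

theorem maxSine_lt_one {γ : RegularCurve} (hγ : γ.IsCondensed) : γ.maxSine < 1 := by
  have h1 : γ.amplitude < Real.pi := hγ
  have h2 := γ.amplitude_nonneg
  rw [maxSine, ← Real.sin_pi_div_two]
  exact Real.sin_lt_sin_of_lt_of_le_pi_div_two (by linarith) le_rfl (by linarith)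

theorem abs_sine_le {γ : RegularCurve} (hγ : γ.IsCondensed) {t : ℝ} (ht : t ∈ Icc (0 : ℝ) 1) :
    |γ.sine t| ≤ γ.maxSine := by
  have h1 : γ.amplitude < Real.pi := hγ
  have h2 := abs_le.1 (γ.abs_angle_sub_midAngle_le ht)
  rw [abs_le, maxSine, sine, ← Real.sin_neg]
  exact ⟨Real.sin_le_sin_of_le_of_le_pi_div_two (by linarith) (by linarith) h2.1,
    Real.sin_le_sin_of_le_of_le_pi_div_two (by linarith) (by linarith) h2.2⟩

theorem abs_angle_sub_midAngle_lt {γ : RegularCurve} (hγ : γ.IsCondensed) {t : ℝ}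
    (ht : t ∈ Icc (0 : ℝ) 1) :
    -(Real.pi / 2) < γ.angle t - γ.midAngle ∧ γ.angle t - γ.midAngle < Real.pi / 2 := by
  have h1 : γ.amplitude < Real.pi := hγ
  have h2 := abs_le.1 (γ.abs_angle_sub_midAngle_le ht)
  exact ⟨by linarith, by linarith⟩

theorem cos_pos {γ : RegularCurve} (hγ : γ.IsCondensed) {t : ℝ} (ht : t ∈ Icc (0 : ℝ) 1) :
    0 < Real.cos (γ.angle t - γ.midAngle) :=
  Real.cos_pos_of_mem_Ioo (abs_angle_sub_midAngle_lt hγ ht)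

theorem axialSpeed_pos {γ : RegularCurve} (hγ : γ.IsCondensed) {t : ℝ} (ht : t ∈ Icc (0 : ℝ) 1) :
    0 < γ.axialSpeed t := mul_pos (γ.speed_pos ht) (cos_pos hγ ht)

theorem sqrt_one_sub_sine_sq {γ : RegularCurve} (hγ : γ.IsCondensed) {t : ℝ}
    (ht : t ∈ Icc (0 : ℝ) 1) :
    √(1 - γ.sine t ^ 2) = Real.cos (γ.angle t - γ.midAngle) := by
  rw [sine, ← Real.cos_sq', Real.sqrt_sq (cos_pos hγ ht).le]

theorem arcsin_sine {γ : RegularCurve} (hγ : γ.IsCondensed) {t : ℝ}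
    (ht : t ∈ Icc (0 : ℝ) 1) : Real.arcsin (γ.sine t) = γ.angle t - γ.midAngle := by
  have h := abs_angle_sub_midAngle_lt hγ ht
  exact Real.arcsin_sin h.1.le h.2.le

/-- The speed of the curve whose angle with the direction `midAngle` has sine `f`, and with the
same coordinate along this direction. -/
def graphSpeed (γ : RegularCurve) (f : ℝ → ℝ) (t : ℝ) : ℝ := γ.axialSpeed t / √(1 - f t ^ 2)

/-- The argument of the curve whose angle with the direction `midAngle` has sine `f`. -/
def graphAngle (γ : RegularCurve) (f : ℝ → ℝ) (t : ℝ) : ℝ := γ.midAngle + Real.arcsin (f t)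

theorem graphSpeed_sine {γ : RegularCurve} (hγ : γ.IsCondensed) {t : ℝ}
    (ht : t ∈ Icc (0 : ℝ) 1) : γ.graphSpeed γ.sine t = γ.speed t := by
  rw [graphSpeed, sqrt_one_sub_sine_sq hγ ht, axialSpeed, mul_div_cancel_right₀ _ (cos_pos hγ ht).ne']

theorem graphAngle_sine {γ : RegularCurve} (hγ : γ.IsCondensed) {t : ℝ}
    (ht : t ∈ Icc (0 : ℝ) 1) : γ.graphAngle γ.sine t = γ.angle t := by
  rw [graphAngle, arcsin_sine hγ ht]
  ring

/-- In the frame rotated by `midAngle` the velocity is axialSpeed · (1 + i · slope). Changing `f`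
thus leaves the abscissa alone and affects only the transverse displacement, which is why one scalar
equation preserves the end point. -/
theorem graph_velocity (γ : RegularCurve) {f : ℝ → ℝ} {ρ t : ℝ} (hρ : ρ < 1) (hf : |f t| ≤ ρ) :
    (γ.graphSpeed f t • Complex.exp (γ.graphAngle f t * Complex.I) : ℂ) =
      Complex.exp (γ.midAngle * Complex.I) *
        (γ.axialSpeed t + (γ.axialSpeed t * slopeOfSine (f t) : ℝ) * Complex.I) := by
  have h := one_sub_sq_pos hρ hf
  have hs : (√(1 - f t ^ 2) : ℂ) ≠ 0 := Complex.ofReal_ne_zero.2 (Real.sqrt_pos.2 h).ne'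
  have hf' := abs_le.1 hf
  have h1 : Complex.exp (Real.arcsin (f t) * Complex.I) =
      √(1 - f t ^ 2) + f t * Complex.I := by
    rw [Complex.exp_mul_I, ← Complex.ofReal_cos, ← Complex.ofReal_sin, Real.cos_arcsin,
      Real.sin_arcsin (by linarith) (by linarith)]
  rw [graphSpeed, graphAngle, Complex.ofReal_add, add_mul, Complex.exp_add, h1, Complex.real_smul,
    slopeOfSine]
  push_cast
  field_simp

/-- Functions which are the sine of the angle with the direction `midAngle` of a curve with
curvature bounded by `κ₀`, the same end-points as `γ` and a smaller range of the argument. -/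
structure IsAdmissible (γ : RegularCurve) (κ₀ : ℝ) (f : ℝ → ℝ) : Prop where
  abs_le : ∀ t ∈ Icc (0 : ℝ) 1, |f t| ≤ γ.maxSine
  abs_sub_le : ∀ a ∈ Icc (0 : ℝ) 1, ∀ b ∈ Icc (0 : ℝ) 1, a ≤ b →
    |f b - f a| ≤ κ₀ * ∫ τ in a..b, γ.axialSpeed τ
  zero : f 0 = γ.sine 0
  one : f 1 = γ.sine 1
  integral_eq : ∫ t in (0 : ℝ)..1, γ.axialSpeed t * slopeOfSine (f t) =
    ∫ t in (0 : ℝ)..1, γ.axialSpeed t * slopeOfSine (γ.sine t)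

theorem continuousOn_slope {γ : RegularCurve} {f : ℝ → ℝ} {ρ : ℝ}
    (hf : ContinuousOn f (Icc 0 1)) (hρ : ρ < 1) (hb : ∀ t ∈ Icc (0 : ℝ) 1, |f t| ≤ ρ) :
    ContinuousOn (fun t => γ.axialSpeed t * slopeOfSine (f t)) (Icc 0 1) :=
  γ.continuousOn_axialSpeed.mul fun t ht =>
    (continuousAt_slopeOfSine hρ (hb t ht)).comp_continuousWithinAt (hf t ht)

theorem integral_graph_velocity {γ : RegularCurve} {f : ℝ → ℝ} {ρ : ℝ}
    (hf : ContinuousOn f (Icc 0 1)) (hρ : ρ < 1) (hb : ∀ t ∈ Icc (0 : ℝ) 1, |f t| ≤ ρ) :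
    ∫ t in (0 : ℝ)..1, (γ.graphSpeed f t • Complex.exp (γ.graphAngle f t * Complex.I) : ℂ) =
      Complex.exp (γ.midAngle * Complex.I) *
        ((∫ t in (0 : ℝ)..1, γ.axialSpeed t : ℝ) +
          (∫ t in (0 : ℝ)..1, γ.axialSpeed t * slopeOfSine (f t) : ℝ) * Complex.I) := by
  have h0 : (0 : ℝ) ∈ Icc (0 : ℝ) 1 := by simp
  have h1 : (1 : ℝ) ∈ Icc (0 : ℝ) 1 := by simp
  rw [← intervalIntegral.integral_ofReal, ← intervalIntegral.integral_ofReal,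
    ← intervalIntegral.integral_mul_const, ← intervalIntegral.integral_add,
    ← intervalIntegral.integral_const_mul]
  · refine intervalIntegral.integral_congr fun t ht => ?_
    exact γ.graph_velocity hρ (hb t (uIcc_subset_Icc h0 h1 ht))
  · exact intervalIntegrable_unit
      (Complex.continuous_ofReal.comp_continuousOn γ.continuousOn_axialSpeed) h0 h1
  · exact (intervalIntegrable_unit
      (Complex.continuous_ofReal.comp_continuousOn (continuousOn_slope hf hρ hb)) h0 h1).mul_const _

namespace IsAdmissible

variable {γ : RegularCurve} {κ₀ : ℝ} {f : ℝ → ℝ}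

theorem isLip (hκ : 0 < κ₀) (hf : γ.IsAdmissible κ₀ f) : IsLip f :=
  IsLip.of_le_integral hκ.le γ.continuousOn_axialSpeed hf.abs_sub_le

theorem isLip_graphAngle (hκ : 0 < κ₀) (hγ : γ.IsCondensed) (hf : γ.IsAdmissible κ₀ f) :
    IsLip (γ.graphAngle f) :=
  (IsLip.const _).add ((hf.isLip hκ).comp (s := {g | |g| ≤ γ.maxSine})
    (K := 1 / √(1 - γ.maxSine ^ 2)) (by positivity) hf.abs_le
    fun _ ha _ hb => abs_arcsin_sub_le (maxSine_lt_one hγ) ha hb)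

theorem sqrt_pos (hγ : γ.IsCondensed) (hf : γ.IsAdmissible κ₀ f) {t : ℝ}
    (ht : t ∈ Icc (0 : ℝ) 1) : 0 < √(1 - f t ^ 2) :=
  Real.sqrt_pos.2 (one_sub_sq_pos (maxSine_lt_one hγ) (hf.abs_le t ht))

theorem deriv_graphAngle (hγ : γ.IsCondensed) (hf : γ.IsAdmissible κ₀ f) {t : ℝ}
    (ht : t ∈ Icc (0 : ℝ) 1) (hd : DifferentiableAt ℝ f t) :
    deriv (γ.graphAngle f) t = deriv f t / √(1 - f t ^ 2) := by
  have h1 := _root_.abs_le.1 (hf.abs_le t ht)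
  have h2 := maxSine_lt_one hγ
  have h3 := ((Real.hasDerivAt_arcsin (x := f t) (by linarith) (by linarith)).comp t
    hd.hasDerivAt).const_add γ.midAngle
  rw [show γ.graphAngle f = fun s => γ.midAngle + (Real.arcsin ∘ f) s from rfl, h3.deriv]
  ring

theorem continuousOn_graphSpeed (hκ : 0 < κ₀) (hγ : γ.IsCondensed) (hf : γ.IsAdmissible κ₀ f) :
    ContinuousOn (γ.graphSpeed f) (Icc 0 1) :=
  γ.continuousOn_axialSpeed.div
    (Real.continuous_sqrt.comp_continuousOn
      (continuousOn_const.sub ((hf.isLip hκ).continuousOn.pow 2)))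
    fun _ ht => (hf.sqrt_pos hγ ht).ne'

end IsAdmissible

theorem isLip_sine {κ₀ : ℝ} {Q : ℂ × Circle} (hκ : 0 < κ₀)
    (γ : CurveSpace (-κ₀) κ₀ originFrame Q) : IsLip γ.1.sine := by
  have h := (γ.isLip_angle hκ).add (IsLip.const (-γ.1.midAngle))
  refine h.comp (F := Real.sin) (s := univ) zero_le_one (fun _ _ => mem_univ _) fun a _ b _ => ?_
  have := Real.lipschitzWith_sin.dist_le_mul a b
  simpa [Real.dist_eq] using this

theorem deriv_sine {γ : RegularCurve} {t : ℝ} (hd : DifferentiableAt ℝ γ.angle t) :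
    deriv γ.sine t = Real.cos (γ.angle t - γ.midAngle) * deriv γ.angle t :=
  ((hd.hasDerivAt.sub_const γ.midAngle).sin).deriv

/-- The derivative of sin φ is cos φ · speed · curvature, that is, axial speed times curvature: as a
function of the abscissa, the sine has the curvature as its slope. -/
theorem isAdmissible_sine {κ₀ : ℝ} {Q : ℂ × Circle} (hκ : 0 < κ₀)
    (γ : CurveSpace (-κ₀) κ₀ originFrame Q) (hγ : γ.1.IsCondensed) :
    γ.1.IsAdmissible κ₀ γ.1.sine where
  abs_le _ ht := abs_sine_le hγ ht
  abs_sub_le := by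
    refine abs_sub_le_integral_of_ae (isLip_sine hκ γ) γ.1.continuousOn_axialSpeed ?_
    filter_upwards [(γ.isLip_angle hκ).ae_differentiableAt, ae_unit_mem_Ioo] with t hd ht
    have ht' := Ioo_subset_Icc_self ht
    rw [deriv_sine hd, abs_mul, abs_of_pos (cos_pos hγ ht'), γ.deriv_angle_eq ht', abs_mul,
      abs_of_pos (γ.1.speed_pos ht'), axialSpeed]
    have h1 := γ.abs_curvature_le hκ ht
    have h2 := mul_pos (γ.1.speed_pos ht') (cos_pos hγ ht')
    nlinarith
  zero := rfl
  one := rfl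
  integral_eq := rfl

/-- The curve in the condensed class given by an admissible function. -/
def graphProfile {κ₀ : ℝ} {q : ℂ} {z : Circle} {θ₁ : ℝ} (hκ : 0 < κ₀)
    (γ : condensedCurves κ₀ (q, z) θ₁) {f : ℝ → ℝ} (hf : γ.1.1.IsAdmissible κ₀ f) :
    CondensedProfile κ₀ q θ₁ where
  speed := γ.1.1.graphSpeed f
  angle := γ.1.1.graphAngle f
  continuousOn_speed := hf.continuousOn_graphSpeed hκ γ.2.2
  speed_pos t ht := div_pos (axialSpeed_pos γ.2.2 ht) (hf.sqrt_pos γ.2.2 ht)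
  abs_angle_sub_le := by
    refine abs_sub_le_integral_of_ae (hf.isLip_graphAngle hκ γ.2.2)
      (hf.continuousOn_graphSpeed hκ γ.2.2) ?_
    filter_upwards [(hf.isLip hκ).ae_differentiableAt, ae_unit_mem_Ioo] with t hd ht
    have ht' := Ioo_subset_Icc_self ht
    have hs := hf.sqrt_pos γ.2.2 ht'
    -- Derivative of the angle and speed carry the same factor 1/√(1 - f²). After cancellation the
    -- curvature bound is the Lipschitz bound for `f` in the abscissa.
    rw [hf.deriv_graphAngle γ.2.2 ht' hd, abs_div, abs_of_pos hs, graphSpeed, ← mul_div_assoc]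
    gcongr
    exact abs_deriv_le_of_le_integral hκ.le γ.1.1.continuousOn_axialSpeed
      (fun s hs => (axialSpeed_pos γ.2.2 hs).le) hf.abs_sub_le ht
  angle_zero := by
    have h := graphAngle_sine γ.2.2 (t := 0) (by simp)
    rw [graphAngle] at h ⊢
    rw [hf.zero, h, angle_zero]
  angle_one := by
    have h := graphAngle_sine γ.2.2 (t := 1) (by simp)
    rw [graphAngle] at h ⊢
    rw [hf.one, h]
    exact γ.2.1
  integral_eq := by
    rw [integral_graph_velocity (hf.isLip hκ).continuousOn (maxSine_lt_one γ.2.2) hf.abs_le,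
      hf.integral_eq, ← integral_graph_velocity γ.1.1.continuousOn_sine (maxSine_lt_one γ.2.2)
        fun t ht => abs_sine_le γ.2.2 ht]
    refine Eq.trans ?_ (CondensedProfile.ofCurve γ).integral_eq
    refine intervalIntegral.integral_congr fun t ht => ?_
    have ht' := uIcc_subset_Icc (by simp : (0 : ℝ) ∈ Icc (0 : ℝ) 1) (by simp) ht
    simp only [graphSpeed_sine γ.2.2 ht', graphAngle_sine γ.2.2 ht']
    rfl
  condensed a ha b hb := by
    have h1 := _root_.abs_le.1 (abs_arcsin_le (hf.abs_le a ha))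
    have h2 := _root_.abs_le.1 (abs_arcsin_le (hf.abs_le b hb))
    have h3 : Real.arcsin γ.1.1.maxSine < Real.pi / 2 :=
      Real.arcsin_lt_pi_div_two.2 (maxSine_lt_one γ.2.2)
    simp only [graphAngle]
    linarith

end RegularCurve

theorem csSup_image_le_add {f g : ℝ → ℝ} {ε : ℝ} (hg : BddAbove (g '' Icc 0 1))
    (h : ∀ t ∈ Icc (0 : ℝ) 1, f t ≤ g t + ε) :
    sSup (f '' Icc 0 1) ≤ sSup (g '' Icc 0 1) + ε := by
  refine csSup_le ((nonempty_Icc.2 zero_le_one).image _) ?_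
  rintro _ ⟨t, ht, rfl⟩
  exact (h t ht).trans (add_le_add_left (le_csSup hg (mem_image_of_mem _ ht)) _)

theorem csInf_image_le_add {f g : ℝ → ℝ} {ε : ℝ} (hf : BddBelow (f '' Icc 0 1))
    (h : ∀ t ∈ Icc (0 : ℝ) 1, f t ≤ g t + ε) :
    sInf (f '' Icc 0 1) ≤ sInf (g '' Icc 0 1) + ε := by
  rw [← sub_le_iff_le_add]
  refine le_csInf ((nonempty_Icc.2 zero_le_one).image _) ?_
  rintro _ ⟨t, ht, rfl⟩
  have h1 := csInf_le hf (mem_image_of_mem _ ht)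
  have h2 := h t ht
  linarith

/-! ### Continuous dependence of the graph coordinates on the curve -/

namespace RegularCurve

variable {κ₀ : ℝ} {Q : ℂ × Circle} {γ : ℕ → CurveSpace (-κ₀) κ₀ originFrame Q}
  {η : CurveSpace (-κ₀) κ₀ originFrame Q}

theorem tendsto_sSup_angle (hκ : 0 < κ₀) (h : Tendsto γ atTop (𝓝 η)) :
    Tendsto (fun n => sSup ((γ n).1.angle '' Icc 0 1)) atTop (𝓝 (sSup (η.1.angle '' Icc 0 1))) := by
  rw [Metric.tendsto_nhds]
  intro ε hε
  filter_upwards [CurveSpace.eventually_angle hκ h (half_pos hε)] with n hn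
  have h1 := csSup_image_le_add (f := (γ n).1.angle) (ε := ε / 2)
    η.1.isCompact_angle_image.bddAbove fun t ht => by linarith [(abs_lt.1 (hn t ht)).2]
  have h2 := csSup_image_le_add (f := η.1.angle) (ε := ε / 2)
    (γ n).1.isCompact_angle_image.bddAbove fun t ht => by linarith [(abs_lt.1 (hn t ht)).1]
  rw [Real.dist_eq, abs_lt]
  constructor <;> linarith

theorem tendsto_sInf_angle (hκ : 0 < κ₀) (h : Tendsto γ atTop (𝓝 η)) :
    Tendsto (fun n => sInf ((γ n).1.angle '' Icc 0 1)) atTop (𝓝 (sInf (η.1.angle '' Icc 0 1))) := by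
  rw [Metric.tendsto_nhds]
  intro ε hε
  filter_upwards [CurveSpace.eventually_angle hκ h (half_pos hε)] with n hn
  have h1 := csInf_image_le_add (f := (γ n).1.angle) (g := η.1.angle) (ε := ε / 2)
    (γ n).1.isCompact_angle_image.bddBelow fun t ht => by linarith [(abs_lt.1 (hn t ht)).2]
  have h2 := csInf_image_le_add (f := η.1.angle) (g := (γ n).1.angle) (ε := ε / 2)
    η.1.isCompact_angle_image.bddBelow fun t ht => by linarith [(abs_lt.1 (hn t ht)).1]
  rw [Real.dist_eq, abs_lt]
  constructor <;> linarith

theorem tendsto_midAngle (hκ : 0 < κ₀) (h : Tendsto γ atTop (𝓝 η)) :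
    Tendsto (fun n => (γ n).1.midAngle) atTop (𝓝 η.1.midAngle) :=
  ((tendsto_sSup_angle hκ h).add (tendsto_sInf_angle hκ h)).div_const 2

theorem tendsto_maxSine (hκ : 0 < κ₀) (h : Tendsto γ atTop (𝓝 η)) :
    Tendsto (fun n => (γ n).1.maxSine) atTop (𝓝 η.1.maxSine) := by
  simp only [maxSine, amplitude_eq]
  exact (Real.continuous_sin.tendsto _).comp
    (((tendsto_sSup_angle hκ h).sub (tendsto_sInf_angle hκ h)).div_const 2)

theorem tendsto_relAngle (hκ : 0 < κ₀) (h : Tendsto γ atTop (𝓝 η)) {t : ℝ}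
    (ht : t ∈ Icc (0 : ℝ) 1) :
    Tendsto (fun n => (γ n).1.angle t - (γ n).1.midAngle) atTop
      (𝓝 (η.1.angle t - η.1.midAngle)) :=
  (CurveSpace.tendsto_angle hκ h ht).sub (tendsto_midAngle hκ h)

theorem tendsto_sine (hκ : 0 < κ₀) (h : Tendsto γ atTop (𝓝 η)) {t : ℝ} (ht : t ∈ Icc (0 : ℝ) 1) :
    Tendsto (fun n => (γ n).1.sine t) atTop (𝓝 (η.1.sine t)) :=
  (Real.continuous_sin.tendsto _).comp (tendsto_relAngle hκ h ht)

theorem tendsto_cos (hκ : 0 < κ₀) (h : Tendsto γ atTop (𝓝 η)) {t : ℝ} (ht : t ∈ Icc (0 : ℝ) 1) :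
    Tendsto (fun n => Real.cos ((γ n).1.angle t - (γ n).1.midAngle)) atTop
      (𝓝 (Real.cos (η.1.angle t - η.1.midAngle))) :=
  (Real.continuous_cos.tendsto _).comp (tendsto_relAngle hκ h ht)

theorem continuousOn_cos (γ : RegularCurve) :
    ContinuousOn (fun t => Real.cos (γ.angle t - γ.midAngle)) (Icc 0 1) :=
  Real.continuous_cos.comp_continuousOn (γ.continuousOn_angle.sub continuousOn_const)

theorem l2Tendsto_axialSpeed (hκ : 0 < κ₀) (h : Tendsto γ atTop (𝓝 η)) :
    L2Tendsto (fun n => (γ n).1.axialSpeed) η.1.axialSpeed :=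
  (CurveSpace.l2Tendsto_speed h).smul_of_ae
    (fun n => aestronglyMeasurable_unit (γ n).1.continuousOn_speed) η.1.continuousOn_speed
    (fun n => aestronglyMeasurable_unit (γ n).1.continuousOn_cos)
    (aestronglyMeasurable_unit η.1.continuousOn_cos) 1
    (fun _ => Eventually.of_forall fun _ => Real.abs_cos_le_one _)
    (Eventually.of_forall fun _ => Real.abs_cos_le_one _)
    (ae_unit_of_forall fun _ ht => tendsto_cos hκ h ht)

theorem tendsto_abscissa (hκ : 0 < κ₀) (h : Tendsto γ atTop (𝓝 η)) {t : ℝ}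
    (ht : t ∈ Icc (0 : ℝ) 1) : Tendsto (fun n => (γ n).1.abscissa t) atTop (𝓝 (η.1.abscissa t)) :=
  (l2Tendsto_axialSpeed hκ h).integral
    (fun n => memLp_two_unit (γ n).1.continuousOn_axialSpeed)
    (memLp_two_unit η.1.continuousOn_axialSpeed) ht

theorem isLip_abscissa (γ : RegularCurve) : IsLip γ.abscissa :=
  IsLip.integral γ.continuousOn_axialSpeed

theorem lipTendsto_abscissa (hκ : 0 < κ₀) (h : Tendsto γ atTop (𝓝 η))
    (hae : ∀ᵐ t ∂unitMeasure, Tendsto (fun n => (γ n).1.speed t) atTop (𝓝 (η.1.speed t))) :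
    LipTendsto (fun n => (γ n).1.abscissa) η.1.abscissa where
  isLip n := (γ n).1.isLip_abscissa
  isLip_lim := η.1.isLip_abscissa
  tendsto _ ht := tendsto_abscissa hκ h ht
  tendsto_deriv := by
    filter_upwards [hae, ae_unit_mem_Ioo] with t h1 ht
    have hd : ∀ ζ : RegularCurve, deriv ζ.abscissa t = ζ.axialSpeed t := fun ζ =>
      (hasDerivAt_integral_unit ζ.continuousOn_axialSpeed ht).deriv
    simp only [hd]
    exact h1.mul (tendsto_cos hκ h (Ioo_subset_Icc_self ht))

theorem lipTendsto_sine (hκ : 0 < κ₀) (h : Tendsto γ atTop (𝓝 η))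
    (hae : ∀ᵐ t ∂unitMeasure,
      Tendsto (fun n => deriv (γ n).1.angle t) atTop (𝓝 (deriv η.1.angle t))) :
    LipTendsto (fun n => (γ n).1.sine) η.1.sine where
  isLip n := isLip_sine hκ (γ n)
  isLip_lim := isLip_sine hκ η
  tendsto _ ht := tendsto_sine hκ h ht
  tendsto_deriv := by
    filter_upwards [hae, ae_unit_mem_Ioo, (η.isLip_angle hκ).ae_differentiableAt,
      ae_all_iff.2 fun n => ((γ n).isLip_angle hκ).ae_differentiableAt] with t h1 ht h2 h3
    rw [deriv_sine h2]
    exact ((tendsto_cos hκ h (Ioo_subset_Icc_self ht)).mul h1).congr fun n =>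
      (deriv_sine (h3 n)).symm

theorem continuousOn_inv_sqrt {f : ℝ → ℝ} {ρ : ℝ} (hf : ContinuousOn f (Icc 0 1)) (hρ : ρ < 1)
    (hb : ∀ t ∈ Icc (0 : ℝ) 1, |f t| ≤ ρ) :
    ContinuousOn (fun t => (√(1 - f t ^ 2))⁻¹) (Icc 0 1) :=
  (Real.continuous_sqrt.comp_continuousOn (continuousOn_const.sub (hf.pow 2))).inv₀
    fun t ht => (Real.sqrt_pos.2 (one_sub_sq_pos hρ (hb t ht))).ne'

theorem inv_sqrt_le {g ρ : ℝ} (hρ : ρ < 1) (hg : |g| ≤ ρ) :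
    (√(1 - g ^ 2))⁻¹ ≤ (√(1 - ρ ^ 2))⁻¹ := by
  have h2 := one_sub_sq_pos hρ (abs_of_nonneg ((abs_nonneg _).trans hg)).le
  refine inv_anti₀ (Real.sqrt_pos.2 h2) (Real.sqrt_le_sqrt ?_)
  have := sq_le_sq' (abs_le.1 hg).1 (abs_le.1 hg).2
  linarith

theorem tendsto_inv_sqrt {g : ℕ → ℝ} {g' ρ : ℝ} (hρ : ρ < 1) (hg : |g'| ≤ ρ)
    (h : Tendsto g atTop (𝓝 g')) :
    Tendsto (fun n => (√(1 - g n ^ 2))⁻¹) atTop (𝓝 (√(1 - g' ^ 2))⁻¹) :=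
  (((Real.continuous_sqrt.tendsto _).comp (tendsto_const_nhds.sub (h.pow 2)))).inv₀
    (Real.sqrt_pos.2 (one_sub_sq_pos hρ hg)).ne'

/-- A uniform bound for the quantities `(1 - f ^ 2)^(-1/2)`. -/
theorem exists_inv_sqrt_bound (hκ : 0 < κ₀) (h : Tendsto γ atTop (𝓝 η))
    (hη : η.1.IsCondensed) : ∃ K, (√(1 - η.1.maxSine ^ 2))⁻¹ ≤ K ∧
      ∀ n, (√(1 - (γ n).1.maxSine ^ 2))⁻¹ ≤ K := by
  have h1 := tendsto_inv_sqrt (maxSine_lt_one hη) (abs_of_nonneg (maxSine_nonneg hη)).le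
    (tendsto_maxSine hκ h)
  obtain ⟨K, hK⟩ := h1.bddAbove_range
  exact ⟨K, le_of_tendsto' h1 fun n => hK (mem_range_self n), fun n => hK (mem_range_self n)⟩

theorem l2Tendsto_graphSpeed (hκ : 0 < κ₀) (h : Tendsto γ atTop (𝓝 η))
    (hγ : ∀ n, (γ n).1.IsCondensed) (hη : η.1.IsCondensed) {f : ℕ → ℝ → ℝ} {g : ℝ → ℝ}
    (hf : ∀ n, ContinuousOn (f n) (Icc 0 1)) (hg : ContinuousOn g (Icc 0 1))
    (hfb : ∀ n, ∀ t ∈ Icc (0 : ℝ) 1, |f n t| ≤ (γ n).1.maxSine)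
    (hgb : ∀ t ∈ Icc (0 : ℝ) 1, |g t| ≤ η.1.maxSine)
    (hlim : ∀ t ∈ Icc (0 : ℝ) 1, Tendsto (fun n => f n t) atTop (𝓝 (g t))) :
    L2Tendsto (fun n => (γ n).1.graphSpeed (f n)) (η.1.graphSpeed g) := by
  obtain ⟨K, hK, hK'⟩ := exists_inv_sqrt_bound hκ h hη
  refine (l2Tendsto_axialSpeed hκ h).smul_of_ae
    (fun n => aestronglyMeasurable_unit (γ n).1.continuousOn_axialSpeed)
    η.1.continuousOn_axialSpeed
    (fun n => aestronglyMeasurable_unit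
      (continuousOn_inv_sqrt (hf n) (maxSine_lt_one (hγ n)) (hfb n)))
    (aestronglyMeasurable_unit (continuousOn_inv_sqrt hg (maxSine_lt_one hη) hgb)) K
    (fun n => ae_unit_of_forall fun t ht => ?_) (ae_unit_of_forall fun t ht => ?_)
    (ae_unit_of_forall fun t ht => tendsto_inv_sqrt (maxSine_lt_one hη) (hgb t ht) (hlim t ht))
  · rw [Real.norm_eq_abs, abs_of_nonneg (by positivity)]
    exact (inv_sqrt_le (maxSine_lt_one (hγ n)) (hfb n t ht)).trans (hK' n)
  · rw [Real.norm_eq_abs, abs_of_nonneg (by positivity)]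
    exact (inv_sqrt_le (maxSine_lt_one hη) (hgb t ht)).trans hK

theorem continuousOn_graphSpeed_of_le {γ : RegularCurve} {f : ℝ → ℝ} {ρ : ℝ}
    (hf : ContinuousOn f (Icc 0 1)) (hρ : ρ < 1) (hb : ∀ t ∈ Icc (0 : ℝ) 1, |f t| ≤ ρ) :
    ContinuousOn (γ.graphSpeed f) (Icc 0 1) := by
  refine (γ.continuousOn_axialSpeed.mul (continuousOn_inv_sqrt hf hρ hb)).congr fun t _ => ?_
  rw [graphSpeed, div_eq_mul_inv]
  rfl

theorem axialSpeed_mul_slope (γ : RegularCurve) (f : ℝ → ℝ) (t : ℝ) :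
    γ.axialSpeed t * slopeOfSine (f t) = γ.graphSpeed f t * f t := by
  rw [graphSpeed, slopeOfSine]
  ring

/-- Axial speed times slope equals graph speed times `f`. The first factor converges in L² and the
second is bounded by 1 and converges pointwise. -/
theorem tendsto_integral_slope (hκ : 0 < κ₀) (h : Tendsto γ atTop (𝓝 η))
    (hγ : ∀ n, (γ n).1.IsCondensed) (hη : η.1.IsCondensed) {f : ℕ → ℝ → ℝ} {g : ℝ → ℝ}
    (hf : ∀ n, ContinuousOn (f n) (Icc 0 1)) (hg : ContinuousOn g (Icc 0 1))
    (hfb : ∀ n, ∀ t ∈ Icc (0 : ℝ) 1, |f n t| ≤ (γ n).1.maxSine)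
    (hgb : ∀ t ∈ Icc (0 : ℝ) 1, |g t| ≤ η.1.maxSine)
    (hlim : ∀ t ∈ Icc (0 : ℝ) 1, Tendsto (fun n => f n t) atTop (𝓝 (g t))) :
    Tendsto (fun n => ∫ t in (0 : ℝ)..1, (γ n).1.axialSpeed t * slopeOfSine (f n t)) atTop
      (𝓝 (∫ t in (0 : ℝ)..1, η.1.axialSpeed t * slopeOfSine (g t))) := by
  simp only [axialSpeed_mul_slope]
  have hc := fun n => continuousOn_graphSpeed_of_le (γ := (γ n).1) (hf n) (maxSine_lt_one (hγ n))
    (hfb n)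
  have hc' := continuousOn_graphSpeed_of_le (γ := η.1) hg (maxSine_lt_one hη) hgb
  refine L2Tendsto.integral ?_ (fun n => memLp_two_unit ((hc n).mul (hf n)))
    (memLp_two_unit (hc'.mul hg)) (by simp)
  refine (l2Tendsto_graphSpeed hκ h hγ hη hf hg hfb hgb hlim).smul_of_ae
    (fun n => aestronglyMeasurable_unit (hc n)) hc'
    (fun n => aestronglyMeasurable_unit (hf n)) (aestronglyMeasurable_unit hg) 1
    (fun n => ae_unit_of_forall fun t ht => ?_) (ae_unit_of_forall fun t ht => ?_)
    (ae_unit_of_forall hlim)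
  · exact (hfb n t ht).trans (maxSine_lt_one (hγ n)).le
  · exact (hgb t ht).trans (maxSine_lt_one hη).le

theorem tendsto_graphProfile {q : ℂ} {z : Circle} {θ₁ : ℝ} (hκ : 0 < κ₀) (hz : Circle.exp θ₁ = z)
    {γ : ℕ → condensedCurves κ₀ (q, z) θ₁} {η : condensedCurves κ₀ (q, z) θ₁}
    (h : Tendsto γ atTop (𝓝 η)) {f : ℕ → ℝ → ℝ} {g : ℝ → ℝ}
    (hf : ∀ n, (γ n).1.1.IsAdmissible κ₀ (f n)) (hg : η.1.1.IsAdmissible κ₀ g)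
    (hae : ∀ᵐ t ∂unitMeasure, Tendsto (fun n => (γ n).1.1.speed t) atTop (𝓝 (η.1.1.speed t)))
    (hfg : LipTendsto f g) :
    Tendsto (fun n => (graphProfile hκ (γ n) (hf n)).toCurve hκ hz) atTop
      (𝓝 ((graphProfile hκ η hg).toCurve hκ hz)) := by
  have h' : Tendsto (fun n => (γ n).1) atTop (𝓝 η.1) := tendsto_subtype_rng.1 h
  refine CondensedProfile.tendsto_toCurve hκ hz ?_ (fun t ht => ?_) ?_
  · exact l2Tendsto_graphSpeed hκ h' (fun n => (γ n).2.2) η.2.2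
      (fun n => ((hf n).isLip hκ).continuousOn) (hg.isLip hκ).continuousOn
      (fun n => (hf n).abs_le) hg.abs_le hfg.tendsto
  · exact (tendsto_midAngle hκ h').add ((Real.continuous_arcsin.tendsto _).comp (hfg.tendsto t ht))
  · filter_upwards [hae, ae_unit_mem_Ioo, hfg.tendsto_deriv,
      ae_all_iff.2 fun n => (hfg.isLip n).ae_differentiableAt,
      hfg.isLip_lim.ae_differentiableAt] with t h1 ht h2 h3 h4
    have ht' := Ioo_subset_Icc_self ht
    -- The square roots cancel and the curvature is f' divided by the axial speed, whose limit is
    -- positive because the limit curve is condensed.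
    have hq : ∀ (ζ : condensedCurves κ₀ (q, z) θ₁) (k : ℝ → ℝ) (hk : ζ.1.1.IsAdmissible κ₀ k),
        DifferentiableAt ℝ k t → deriv (graphProfile hκ ζ hk).angle t /
          (graphProfile hκ ζ hk).speed t = deriv k t / ζ.1.1.axialSpeed t := by
      intro ζ k hk hd
      change deriv (ζ.1.1.graphAngle k) t / ζ.1.1.graphSpeed k t = _
      have hs := (hk.sqrt_pos ζ.2.2 ht').ne'
      have ha := (axialSpeed_pos ζ.2.2 ht').ne'
      rw [hk.deriv_graphAngle ζ.2.2 ht' hd, graphSpeed]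
      field_simp
    rw [hq η g hg h4]
    refine Tendsto.congr (fun n => (hq (γ n) (f n) (hf n) (h3 n)).symm) ?_
    exact h2.div (h1.mul (tendsto_cos hκ h' ht')) (axialSpeed_pos η.2.2 ht').ne'

end RegularCurve

/-! ### Envelopes and the truncated sine -/

/-- `f` has modulus of continuity `κ ∫ w`. -/
def IntegralLip (κ : ℝ) (w f : ℝ → ℝ) : Prop :=
  ∀ a ∈ Icc (0 : ℝ) 1, ∀ b ∈ Icc (0 : ℝ) 1, a ≤ b → |f b - f a| ≤ κ * ∫ τ in a..b, w τ

namespace IntegralLip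

variable {κ : ℝ} {w f g : ℝ → ℝ}

theorem max (hf : IntegralLip κ w f) (hg : IntegralLip κ w g) :
    IntegralLip κ w fun t => max (f t) (g t) := fun a ha b hb hab =>
  (abs_max_sub_max_le_max _ _ _ _).trans (max_le (hf a ha b hb hab) (hg a ha b hb hab))

theorem min (hf : IntegralLip κ w f) (hg : IntegralLip κ w g) :
    IntegralLip κ w fun t => min (f t) (g t) := fun a ha b hb hab =>
  (abs_min_sub_min_le_max _ _ _ _).trans (max_le (hf a ha b hb hab) (hg a ha b hb hab))

theorem const (hκ : 0 ≤ κ) (hw : ∀ t ∈ Icc (0 : ℝ) 1, 0 ≤ w t) (c : ℝ) :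
    IntegralLip κ w fun _ => c := fun a ha b hb hab => by
  rw [sub_self, abs_zero]
  exact mul_nonneg hκ (intervalIntegral.integral_nonneg hab fun t ht =>
    hw t ⟨ha.1.trans ht.1, ht.2.trans hb.2⟩)

end IntegralLip

namespace RegularCurve

/-- The lower envelope of the sines of curves with curvature at most `κ`. -/
def lowerEnvelope (γ : RegularCurve) (κ t : ℝ) : ℝ :=
  max (γ.sine 0 + -κ * γ.abscissa t) ((γ.sine 1 + -κ * γ.abscissa 1) + κ * γ.abscissa t)

/-- The upper envelope of the sines of curves with curvature at most `κ`. -/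
def upperEnvelope (γ : RegularCurve) (κ t : ℝ) : ℝ :=
  min (γ.sine 0 + κ * γ.abscissa t) ((γ.sine 1 + κ * γ.abscissa 1) + -κ * γ.abscissa t)

/-- The lower level of truncation. -/
def lowLevel (γ : RegularCurve) (c δ : ℝ) : ℝ := γ.maxSine * max (-1) (c - δ)

/-- The upper level of truncation. -/
def highLevel (γ : RegularCurve) (c δ : ℝ) : ℝ := γ.maxSine * min 1 (c + δ)

/-- The truncation of the sine at the levels `lowLevel` and `highLevel`. -/
def truncSine (γ : RegularCurve) (κ c δ t : ℝ) : ℝ :=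
  truncate (γ.lowerEnvelope κ t) (γ.upperEnvelope κ t) (γ.sine t) (γ.lowLevel c δ)
    (γ.highLevel c δ)

/-- The displacement orthogonal to the direction `midAngle` after truncation. -/
def truncHeight (γ : RegularCurve) (κ c δ : ℝ) : ℝ :=
  ∫ t in (0 : ℝ)..1, γ.axialSpeed t * slopeOfSine (γ.truncSine κ c δ t)

/-- The displacement orthogonal to the direction `midAngle`. -/
def height (γ : RegularCurve) : ℝ := ∫ t in (0 : ℝ)..1, γ.axialSpeed t * slopeOfSine (γ.sine t)

theorem abscissa_zero (γ : RegularCurve) : γ.abscissa 0 = 0 := intervalIntegral.integral_same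

section pointwise

variable {κ₀ : ℝ} {Q : ℂ × Circle} {γ : CurveSpace (-κ₀) κ₀ originFrame Q}

theorem abs_sine_sub_le (hκ : 0 < κ₀) (hγ : γ.1.IsCondensed) {a b : ℝ} (ha : a ∈ Icc (0 : ℝ) 1)
    (hb : b ∈ Icc (0 : ℝ) 1) (hab : a ≤ b) :
    |γ.1.sine b - γ.1.sine a| ≤ κ₀ * (γ.1.abscissa b - γ.1.abscissa a) := by
  rw [γ.1.abscissa_sub ha hb]
  exact (isAdmissible_sine hκ γ hγ).abs_sub_le a ha b hb hab

theorem lowerEnvelope_le (hκ : 0 < κ₀) (hγ : γ.1.IsCondensed) {t : ℝ} (ht : t ∈ Icc (0 : ℝ) 1) :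
    γ.1.lowerEnvelope κ₀ t ≤ γ.1.sine t := by
  have h0 := abs_le.1 (abs_sine_sub_le hκ hγ (a := 0) (by simp) ht ht.1)
  have h1 := abs_le.1 (abs_sine_sub_le hκ hγ (b := 1) ht (by simp) ht.2)
  rw [abscissa_zero] at h0
  refine max_le ?_ ?_ <;> linarith

theorem le_upperEnvelope (hκ : 0 < κ₀) (hγ : γ.1.IsCondensed) {t : ℝ} (ht : t ∈ Icc (0 : ℝ) 1) :
    γ.1.sine t ≤ γ.1.upperEnvelope κ₀ t := by
  have h0 := abs_le.1 (abs_sine_sub_le hκ hγ (a := 0) (by simp) ht ht.1)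
  have h1 := abs_le.1 (abs_sine_sub_le hκ hγ (b := 1) ht (by simp) ht.2)
  rw [abscissa_zero] at h0
  refine le_min ?_ ?_ <;> linarith

theorem le_lowerEnvelope_zero (γ : RegularCurve) (κ : ℝ) : γ.sine 0 ≤ γ.lowerEnvelope κ 0 :=
  le_max_of_le_left (by simp [abscissa_zero])

theorem le_lowerEnvelope_one (γ : RegularCurve) (κ : ℝ) : γ.sine 1 ≤ γ.lowerEnvelope κ 1 :=
  le_max_of_le_right (by linarith)

theorem upperEnvelope_zero_le (γ : RegularCurve) (κ : ℝ) : γ.upperEnvelope κ 0 ≤ γ.sine 0 :=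
  min_le_of_left_le (by simp [abscissa_zero])

theorem upperEnvelope_one_le (γ : RegularCurve) (κ : ℝ) : γ.upperEnvelope κ 1 ≤ γ.sine 1 :=
  min_le_of_right_le (by linarith)

theorem lowLevel_mem {γ : RegularCurve} (hγ : γ.IsCondensed) {c δ : ℝ} (hc : c ∈ Icc (-1 : ℝ) 1)
    (hδ : 0 ≤ δ) : γ.lowLevel c δ ∈ Icc (-γ.maxSine) γ.maxSine := by
  have h := maxSine_nonneg hγ
  have h1 : -1 ≤ max (-1) (c - δ) := le_max_left _ _
  have h2 : max (-1) (c - δ) ≤ 1 := max_le (by norm_num) (by linarith [hc.2])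
  rw [lowLevel]
  constructor <;> nlinarith

theorem highLevel_mem {γ : RegularCurve} (hγ : γ.IsCondensed) {c δ : ℝ} (hc : c ∈ Icc (-1 : ℝ) 1)
    (hδ : 0 ≤ δ) : γ.highLevel c δ ∈ Icc (-γ.maxSine) γ.maxSine := by
  have h := maxSine_nonneg hγ
  have h1 : min 1 (c + δ) ≤ 1 := min_le_left _ _
  have h2 : -1 ≤ min 1 (c + δ) := le_min (by norm_num) (by linarith [hc.1])
  rw [highLevel]
  constructor <;> nlinarith

theorem lowLevel_le_highLevel {γ : RegularCurve} (hγ : γ.IsCondensed) {c δ : ℝ}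
    (hc : c ∈ Icc (-1 : ℝ) 1) (hδ : 0 ≤ δ) : γ.lowLevel c δ ≤ γ.highLevel c δ :=
  mul_le_mul_of_nonneg_left (max_le (le_min (by norm_num) (by linarith [hc.1]))
    (le_min (by linarith [hc.2]) (by linarith))) (maxSine_nonneg hγ)

theorem abs_truncSine_le (hκ : 0 < κ₀) (hγ : γ.1.IsCondensed) {c δ : ℝ}
    (hc : c ∈ Icc (-1 : ℝ) 1) (hδ : 0 ≤ δ) {t : ℝ} (ht : t ∈ Icc (0 : ℝ) 1) :
    |γ.1.truncSine κ₀ c δ t| ≤ γ.1.maxSine := by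
  have hs := abs_le.1 (abs_sine_le hγ ht)
  have hl := lowerEnvelope_le hκ hγ ht
  have hu := le_upperEnvelope hκ hγ ht
  rw [abs_le]
  exact ⟨truncate.ge_of_ge (hs.1.trans hu) (highLevel_mem hγ hc hδ).1 hs.1,
    truncate.le_of_le (hl.trans hs.2) (lowLevel_mem hγ hc hδ).2 hs.2⟩

/-- The envelopes meet at the end points, so no choice of levels can move the end directions. -/
theorem truncSine_zero (hκ : 0 < κ₀) (hγ : γ.1.IsCondensed) (c δ : ℝ) :
    γ.1.truncSine κ₀ c δ 0 = γ.1.sine 0 :=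
  truncate.eq_self_of_eq
    (le_antisymm (lowerEnvelope_le hκ hγ (by simp)) (γ.1.le_lowerEnvelope_zero _))
    (le_antisymm (γ.1.upperEnvelope_zero_le _) (le_upperEnvelope hκ hγ (by simp)))

theorem truncSine_one (hκ : 0 < κ₀) (hγ : γ.1.IsCondensed) (c δ : ℝ) :
    γ.1.truncSine κ₀ c δ 1 = γ.1.sine 1 :=
  truncate.eq_self_of_eq
    (le_antisymm (lowerEnvelope_le hκ hγ (by simp)) (γ.1.le_lowerEnvelope_one _))
    (le_antisymm (γ.1.upperEnvelope_one_le _) (le_upperEnvelope hκ hγ (by simp)))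

theorem integralLip_line (γ : RegularCurve) {κ : ℝ} (hγ : γ.IsCondensed) (c σ : ℝ)
    (hσ : |σ| ≤ κ) :
    IntegralLip κ γ.axialSpeed fun t => c + σ * γ.abscissa t := fun a ha b hb hab => by
  rw [← γ.abscissa_sub ha hb, show c + σ * γ.abscissa b - (c + σ * γ.abscissa a) =
    σ * (γ.abscissa b - γ.abscissa a) by ring, abs_mul, γ.abscissa_sub ha hb]
  have h0 : 0 ≤ ∫ τ in a..b, γ.axialSpeed τ := intervalIntegral.integral_nonneg hab fun t ht =>
    (axialSpeed_pos hγ ⟨ha.1.trans ht.1, ht.2.trans hb.2⟩).le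
  rw [abs_of_nonneg h0]
  exact mul_le_mul_of_nonneg_right hσ h0

/-- The truncation is a lattice expression in the sine, constants, and lines of slope ±κ₀ in the
abscissa. Maxima and minima preserve the common Lipschitz bound. -/
theorem integralLip_truncSine (hκ : 0 < κ₀) (hγ : γ.1.IsCondensed) (c δ : ℝ) :
    IntegralLip κ₀ γ.1.axialSpeed (γ.1.truncSine κ₀ c δ) := by
  have hline := γ.1.integralLip_line (κ := κ₀) hγ
  have h1 := fun x => hline x κ₀ (abs_of_pos hκ).le
  have h2 := fun x => hline x (-κ₀) (by rw [abs_neg, abs_of_pos hκ])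
  have hc := IntegralLip.const (κ := κ₀) hκ.le fun t ht => (axialSpeed_pos hγ ht).le
  have hl := (h2 (γ.1.sine 0)).max (h1 (γ.1.sine 1 + -κ₀ * γ.1.abscissa 1))
  have hu := (h1 (γ.1.sine 0)).min (h2 (γ.1.sine 1 + κ₀ * γ.1.abscissa 1))
  have hs : IntegralLip κ₀ γ.1.axialSpeed γ.1.sine := (isAdmissible_sine hκ γ hγ).abs_sub_le
  exact (hl.max ((hc _).min hu)).max (hs.min (hl.max ((hc _).min hu)))

theorem isAdmissible_truncSine (hκ : 0 < κ₀) (hγ : γ.1.IsCondensed) {c δ : ℝ}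
    (hc : c ∈ Icc (-1 : ℝ) 1) (hδ : 0 ≤ δ) (h : γ.1.truncHeight κ₀ c δ = γ.1.height) :
    γ.1.IsAdmissible κ₀ (γ.1.truncSine κ₀ c δ) where
  abs_le _ ht := abs_truncSine_le hκ hγ hc hδ ht
  abs_sub_le := integralLip_truncSine hκ hγ c δ
  zero := truncSine_zero hκ hγ c δ
  one := truncSine_one hκ hγ c δ
  integral_eq := h

theorem continuousOn_truncSine (hκ : 0 < κ₀) (hγ : γ.1.IsCondensed) (c δ : ℝ) :
    ContinuousOn (γ.1.truncSine κ₀ c δ) (Icc 0 1) :=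
  (IsLip.of_le_integral hκ.le γ.1.continuousOn_axialSpeed
    (integralLip_truncSine hκ hγ c δ)).continuousOn

theorem slopeOfSine_lt {a b ρ : ℝ} (hρ : ρ < 1) (ha : |a| ≤ ρ) (hb : |b| ≤ ρ) (h : a < b) :
    slopeOfSine a < slopeOfSine b := by
  have e : ∀ x, slopeOfSine x = Real.tan (Real.arcsin x) := fun x => (Real.tan_arcsin x).symm
  have hb1 := abs_le.1 hb
  have ha1 := abs_le.1 ha
  rw [e, e]
  refine Real.tan_lt_tan_of_lt_of_lt_pi_div_two ?_ ?_ ?_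
  · exact Real.neg_pi_div_two_lt_arcsin.2 (by linarith)
  · exact Real.arcsin_lt_pi_div_two.2 (by linarith)
  · exact Real.strictMonoOn_arcsin ⟨by linarith, by linarith⟩ ⟨by linarith, by linarith⟩ h

theorem slopeOfSine_le {a b ρ : ℝ} (hρ : ρ < 1) (ha : |a| ≤ ρ) (hb : |b| ≤ ρ) (h : a ≤ b) :
    slopeOfSine a ≤ slopeOfSine b := by
  rcases h.eq_or_lt with rfl | h
  · exact le_rfl
  · exact (slopeOfSine_lt hρ ha hb h).le

theorem integral_slope_mono {γ : RegularCurve} (hγ : γ.IsCondensed) {f g : ℝ → ℝ}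
    (hf : ContinuousOn f (Icc 0 1)) (hg : ContinuousOn g (Icc 0 1))
    (hfb : ∀ t ∈ Icc (0 : ℝ) 1, |f t| ≤ γ.maxSine) (hgb : ∀ t ∈ Icc (0 : ℝ) 1, |g t| ≤ γ.maxSine)
    (h : ∀ t ∈ Icc (0 : ℝ) 1, f t ≤ g t) :
    ∫ t in (0 : ℝ)..1, γ.axialSpeed t * slopeOfSine (f t) ≤
      ∫ t in (0 : ℝ)..1, γ.axialSpeed t * slopeOfSine (g t) := by
  have hρ := maxSine_lt_one hγ
  refine intervalIntegral.integral_mono_on zero_le_one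
    (intervalIntegrable_unit (continuousOn_slope hf hρ hfb) (by simp) (by simp))
    (intervalIntegrable_unit (continuousOn_slope hg hρ hgb) (by simp) (by simp)) fun t ht => ?_
  exact mul_le_mul_of_nonneg_left (slopeOfSine_le hρ (hfb t ht) (hgb t ht) (h t ht))
    (axialSpeed_pos hγ ht).le

/-- The slope is strictly increasing in the sine and the axial speed is positive, so a strict
inequality at one point would, by continuity, make the integrals differ. This rigidity gives
uniqueness of truncations and monotonicity of the amplitude. -/
theorem eq_of_integral_slope_eq {γ : RegularCurve} (hγ : γ.IsCondensed) {f g : ℝ → ℝ}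
    (hf : ContinuousOn f (Icc 0 1)) (hg : ContinuousOn g (Icc 0 1))
    (hfb : ∀ t ∈ Icc (0 : ℝ) 1, |f t| ≤ γ.maxSine) (hgb : ∀ t ∈ Icc (0 : ℝ) 1, |g t| ≤ γ.maxSine)
    (h : ∀ t ∈ Icc (0 : ℝ) 1, f t ≤ g t)
    (heq : ∫ t in (0 : ℝ)..1, γ.axialSpeed t * slopeOfSine (f t) =
      ∫ t in (0 : ℝ)..1, γ.axialSpeed t * slopeOfSine (g t)) :
    ∀ t ∈ Icc (0 : ℝ) 1, f t = g t := by
  have hρ := maxSine_lt_one hγ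
  by_contra! hne
  obtain ⟨t, ht, hne⟩ := hne
  refine heq.not_lt (intervalIntegral.integral_lt_integral_of_continuousOn_of_le_of_exists_lt
    zero_lt_one (continuousOn_slope hf hρ hfb) (continuousOn_slope hg hρ hgb) (fun s hs => ?_)
    ⟨t, ht, ?_⟩)
  · have hs' := Ioc_subset_Icc_self hs
    exact mul_le_mul_of_nonneg_left (slopeOfSine_le hρ (hfb s hs') (hgb s hs') (h s hs'))
      (axialSpeed_pos hγ hs').le
  · exact mul_lt_mul_of_pos_left
      (slopeOfSine_lt hρ (hfb t ht) (hgb t ht) (lt_of_le_of_ne (h t ht) hne))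
      (axialSpeed_pos hγ ht)

end pointwise

/-! ### Convergence of truncations when curve and levels vary -/

section limits

variable {κ₀ : ℝ} {Q : ℂ × Circle} {γ : ℕ → CurveSpace (-κ₀) κ₀ originFrame Q}
  {η : CurveSpace (-κ₀) κ₀ originFrame Q} {c δ : ℕ → ℝ} {c' δ' : ℝ}

theorem tendsto_lowLevel (hκ : 0 < κ₀) (h : Tendsto γ atTop (𝓝 η)) (hc : Tendsto c atTop (𝓝 c'))
    (hδ : Tendsto δ atTop (𝓝 δ')) :
    Tendsto (fun n => (γ n).1.lowLevel (c n) (δ n)) atTop (𝓝 (η.1.lowLevel c' δ')) :=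
  (tendsto_maxSine hκ h).mul (tendsto_const_nhds.max (hc.sub hδ))

theorem tendsto_highLevel (hκ : 0 < κ₀) (h : Tendsto γ atTop (𝓝 η)) (hc : Tendsto c atTop (𝓝 c'))
    (hδ : Tendsto δ atTop (𝓝 δ')) :
    Tendsto (fun n => (γ n).1.highLevel (c n) (δ n)) atTop (𝓝 (η.1.highLevel c' δ')) :=
  (tendsto_maxSine hκ h).mul (tendsto_const_nhds.min (hc.add hδ))

theorem tendsto_lowerEnvelope (hκ : 0 < κ₀) (h : Tendsto γ atTop (𝓝 η)) {t : ℝ}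
    (ht : t ∈ Icc (0 : ℝ) 1) :
    Tendsto (fun n => (γ n).1.lowerEnvelope κ₀ t) atTop (𝓝 (η.1.lowerEnvelope κ₀ t)) :=
  ((tendsto_sine hκ h (by simp)).add ((tendsto_abscissa hκ h ht).const_mul _)).max
    (((tendsto_sine hκ h (by simp)).add ((tendsto_abscissa hκ h (by simp)).const_mul _)).add
      ((tendsto_abscissa hκ h ht).const_mul _))

theorem tendsto_upperEnvelope (hκ : 0 < κ₀) (h : Tendsto γ atTop (𝓝 η)) {t : ℝ}
    (ht : t ∈ Icc (0 : ℝ) 1) :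
    Tendsto (fun n => (γ n).1.upperEnvelope κ₀ t) atTop (𝓝 (η.1.upperEnvelope κ₀ t)) :=
  ((tendsto_sine hκ h (by simp)).add ((tendsto_abscissa hκ h ht).const_mul _)).min
    (((tendsto_sine hκ h (by simp)).add ((tendsto_abscissa hκ h (by simp)).const_mul _)).add
      ((tendsto_abscissa hκ h ht).const_mul _))

theorem tendsto_truncSine (hκ : 0 < κ₀) (h : Tendsto γ atTop (𝓝 η)) (hc : Tendsto c atTop (𝓝 c'))
    (hδ : Tendsto δ atTop (𝓝 δ')) {t : ℝ} (ht : t ∈ Icc (0 : ℝ) 1) :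
    Tendsto (fun n => (γ n).1.truncSine κ₀ (c n) (δ n) t) atTop
      (𝓝 (η.1.truncSine κ₀ c' δ' t)) := by
  have hl := tendsto_lowerEnvelope hκ h ht
  have hu := tendsto_upperEnvelope hκ h ht
  exact (hl.max ((tendsto_lowLevel hκ h hc hδ).min hu)).max
    ((tendsto_sine hκ h ht).min (hl.max ((tendsto_highLevel hκ h hc hδ).min hu)))

theorem lipTendsto_truncSine (hκ : 0 < κ₀) (h : Tendsto γ atTop (𝓝 η))
    (hc : Tendsto c atTop (𝓝 c')) (hδ : Tendsto δ atTop (𝓝 δ'))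
    (hae : ∀ᵐ t ∂unitMeasure, Tendsto (fun n => (γ n).1.speed t) atTop (𝓝 (η.1.speed t)) ∧
      Tendsto (fun n => deriv (γ n).1.angle t) atTop (𝓝 (deriv η.1.angle t))) :
    LipTendsto (fun n => (γ n).1.truncSine κ₀ (c n) (δ n)) (η.1.truncSine κ₀ c' δ') := by
  have hx := lipTendsto_abscissa hκ h (hae.mono fun _ => And.left)
  have hg := lipTendsto_sine hκ h (hae.mono fun _ => And.right)
  have h0 := tendsto_sine hκ h (t := 0) (by simp)
  have h1 := tendsto_sine hκ h (t := 1) (by simp)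
  have hX := tendsto_abscissa hκ h (t := 1) (by simp)
  have hl := ((LipTendsto.const h0).add (hx.const_mul (-κ₀))).max
    ((LipTendsto.const (h1.add (hX.const_mul (-κ₀)))).add (hx.const_mul κ₀))
  have hu := ((LipTendsto.const h0).add (hx.const_mul κ₀)).min
    ((LipTendsto.const (h1.add (hX.const_mul κ₀))).add (hx.const_mul (-κ₀)))
  exact (hl.max ((LipTendsto.const (tendsto_lowLevel hκ h hc hδ)).min hu)).max
    (hg.min (hl.max ((LipTendsto.const (tendsto_highLevel hκ h hc hδ)).min hu)))

theorem tendsto_truncHeight (hκ : 0 < κ₀) (h : Tendsto γ atTop (𝓝 η))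
    (hγ : ∀ n, (γ n).1.IsCondensed) (hη : η.1.IsCondensed)
    (hc : Tendsto c atTop (𝓝 c')) (hδ : Tendsto δ atTop (𝓝 δ'))
    (hcI : ∀ n, c n ∈ Icc (-1 : ℝ) 1) (hδI : ∀ n, 0 ≤ δ n) :
    Tendsto (fun n => (γ n).1.truncHeight κ₀ (c n) (δ n)) atTop (𝓝 (η.1.truncHeight κ₀ c' δ')) :=
  tendsto_integral_slope hκ h hγ hη (fun n => continuousOn_truncSine hκ (hγ n) _ _)
    (continuousOn_truncSine hκ hη _ _)
    (fun n _ ht => abs_truncSine_le hκ (hγ n) (hcI n) (hδI n) ht)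
    (fun _ ht => abs_truncSine_le hκ hη
      (isClosed_Icc.mem_of_tendsto hc (Eventually.of_forall hcI))
      (ge_of_tendsto' hδ hδI) ht)
    fun _ ht => tendsto_truncSine hκ h hc hδ ht

theorem tendsto_height (hκ : 0 < κ₀) (h : Tendsto γ atTop (𝓝 η))
    (hγ : ∀ n, (γ n).1.IsCondensed) (hη : η.1.IsCondensed) :
    Tendsto (fun n => (γ n).1.height) atTop (𝓝 η.1.height) :=
  tendsto_integral_slope hκ h hγ hη (fun n => (γ n).1.continuousOn_sine) η.1.continuousOn_sine
    (fun n _ ht => abs_sine_le (hγ n) ht) (fun _ ht => abs_sine_le hη ht)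
    fun _ ht => tendsto_sine hκ h ht

end limits

end RegularCurve

/-! ### Balanced levels; monotonicity of amplitude and length -/

namespace RegularCurve

section levels

variable {κ₀ : ℝ} {Q : ℂ × Circle} {γ : CurveSpace (-κ₀) κ₀ originFrame Q}

theorem truncSine_mono {γ : RegularCurve} (hγ : γ.IsCondensed) {κ c δ c' δ' : ℝ}
    (h1 : c - δ ≤ c' - δ') (h2 : c + δ ≤ c' + δ') (t : ℝ) :
    γ.truncSine κ c δ t ≤ γ.truncSine κ c' δ' t := by
  have h := maxSine_nonneg hγ
  refine truncate.mono ?_ ?_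
  · unfold lowLevel
    gcongr
  · unfold highLevel
    gcongr

theorem truncSine_le_sine (hκ : 0 < κ₀) (hγ : γ.1.IsCondensed) {c δ : ℝ} (h : c - δ ≤ -1)
    {t : ℝ} (ht : t ∈ Icc (0 : ℝ) 1) : γ.1.truncSine κ₀ c δ t ≤ γ.1.sine t := by
  refine truncate.le_of_le (lowerEnvelope_le hκ hγ ht) ?_ le_rfl
  rw [lowLevel, max_eq_left h, mul_neg_one]
  exact (abs_le.1 (abs_sine_le hγ ht)).1

theorem sine_le_truncSine (hκ : 0 < κ₀) (hγ : γ.1.IsCondensed) {c δ : ℝ} (h : 1 ≤ c + δ)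
    {t : ℝ} (ht : t ∈ Icc (0 : ℝ) 1) : γ.1.sine t ≤ γ.1.truncSine κ₀ c δ t := by
  refine truncate.ge_of_ge (le_upperEnvelope hκ hγ ht) ?_ le_rfl
  rw [highLevel, min_eq_left h, mul_one]
  exact (abs_le.1 (abs_sine_le hγ ht)).2

theorem truncHeight_mono (hκ : 0 < κ₀) (hγ : γ.1.IsCondensed) {c δ c' δ' : ℝ}
    (hc : c ∈ Icc (-1 : ℝ) 1) (hc' : c' ∈ Icc (-1 : ℝ) 1) (hδ : 0 ≤ δ) (hδ' : 0 ≤ δ')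
    (h1 : c - δ ≤ c' - δ') (h2 : c + δ ≤ c' + δ') :
    γ.1.truncHeight κ₀ c δ ≤ γ.1.truncHeight κ₀ c' δ' :=
  integral_slope_mono hγ (continuousOn_truncSine hκ hγ _ _) (continuousOn_truncSine hκ hγ _ _)
    (fun _ ht => abs_truncSine_le hκ hγ hc hδ ht) (fun _ ht => abs_truncSine_le hκ hγ hc' hδ' ht)
    fun t _ => truncSine_mono hγ h1 h2 t

theorem truncHeight_le_height (hκ : 0 < κ₀) (hγ : γ.1.IsCondensed) {c δ : ℝ}
    (hc : c ∈ Icc (-1 : ℝ) 1) (hδ : 0 ≤ δ) (h : c - δ ≤ -1) :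
    γ.1.truncHeight κ₀ c δ ≤ γ.1.height :=
  integral_slope_mono hγ (continuousOn_truncSine hκ hγ _ _) γ.1.continuousOn_sine
    (fun _ ht => abs_truncSine_le hκ hγ hc hδ ht) (fun _ ht => abs_sine_le hγ ht)
    fun _ ht => truncSine_le_sine hκ hγ h ht

theorem height_le_truncHeight (hκ : 0 < κ₀) (hγ : γ.1.IsCondensed) {c δ : ℝ}
    (hc : c ∈ Icc (-1 : ℝ) 1) (hδ : 0 ≤ δ) (h : 1 ≤ c + δ) :
    γ.1.height ≤ γ.1.truncHeight κ₀ c δ :=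
  integral_slope_mono hγ γ.1.continuousOn_sine (continuousOn_truncSine hκ hγ _ _)
    (fun _ ht => abs_sine_le hγ ht) (fun _ ht => abs_truncSine_le hκ hγ hc hδ ht)
    fun _ ht => sine_le_truncSine hκ hγ h ht

theorem continuousOn_truncHeight (hκ : 0 < κ₀) (hγ : γ.1.IsCondensed) {δ : ℝ} (hδ : 0 ≤ δ) :
    ContinuousOn (fun c => γ.1.truncHeight κ₀ c δ) (Icc (-1) 1) := by
  rw [continuousOn_iff_continuous_domRestrict, continuous_iff_seqContinuous]
  intro c c' hc
  exact tendsto_truncHeight (γ := fun _ => γ) hκ tendsto_const_nhds (fun _ => hγ) hγ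
    (tendsto_subtype_rng.1 hc) tendsto_const_nhds (fun n => (c n).2) fun _ => hδ

theorem exists_level_between (hκ : 0 < κ₀) (hγ : γ.1.IsCondensed) {a b δ : ℝ} (hab : a ≤ b)
    (ha : -1 ≤ a) (hb : b ≤ 1) (hδ : 0 ≤ δ) (h1 : γ.1.truncHeight κ₀ a δ ≤ γ.1.height)
    (h2 : γ.1.height ≤ γ.1.truncHeight κ₀ b δ) :
    ∃ c ∈ Icc a b, γ.1.truncHeight κ₀ c δ = γ.1.height :=
  intermediate_value_Icc hab
    ((continuousOn_truncHeight hκ hγ hδ).mono (Icc_subset_Icc ha hb)) ⟨h1, h2⟩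

/-- At c = -1 the lower level is -ρ and nothing is raised, so the height does not increase. At c = 1
nothing is lowered. In between, the height depends continuously on c. -/
theorem exists_level (hκ : 0 < κ₀) (hγ : γ.1.IsCondensed) {δ : ℝ} (hδ : 0 ≤ δ) :
    ∃ c ∈ Icc (-1 : ℝ) 1, γ.1.truncHeight κ₀ c δ = γ.1.height :=
  exists_level_between hκ hγ (by norm_num) le_rfl le_rfl hδ
    (truncHeight_le_height hκ hγ (by simp) hδ (by linarith))
    (height_le_truncHeight hκ hγ (by simp) hδ (by linarith))

theorem exists_nested_level (hκ : 0 < κ₀) (hγ : γ.1.IsCondensed) {c δ δ' : ℝ}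
    (hc : c ∈ Icc (-1 : ℝ) 1) (hδ : 0 ≤ δ) (hδδ' : δ ≤ δ')
    (h : γ.1.truncHeight κ₀ c δ = γ.1.height) :
    ∃ c' ∈ Icc (-1 : ℝ) 1, γ.1.truncHeight κ₀ c' δ' = γ.1.height ∧ c' - δ' ≤ c - δ ∧
      c + δ ≤ c' + δ' := by
  have hδ' : 0 ≤ δ' := hδ.trans hδδ'
  -- Nestedness of the levels means |c' - c| ≤ δ' - δ, so c' is sought in this window cut to [-1,
  -- 1]. At its left end, either the cut is active and nothing is raised, or c' + δ' = c + δ while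
  -- c' - δ' ≤ c - δ. Both give a height at most the desired one. The right end is symmetric.
  set a := max (-1) (c - (δ' - δ)) with ha
  set b := min 1 (c + (δ' - δ)) with hb
  have hac : a ≤ c := max_le hc.1 (by linarith)
  have hcb : c ≤ b := le_min hc.2 (by linarith)
  have ha1 : -1 ≤ a := le_max_left _ _
  have hb1 : b ≤ 1 := min_le_left _ _
  have ha2 : c - (δ' - δ) ≤ a := le_max_right _ _
  have hb2 : b ≤ c + (δ' - δ) := min_le_right _ _
  have haI : a ∈ Icc (-1 : ℝ) 1 := ⟨ha1, by linarith [hc.2]⟩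
  have hbI : b ∈ Icc (-1 : ℝ) 1 := ⟨by linarith [hc.1], hb1⟩
  obtain ⟨c', hc', heq⟩ := exists_level_between hκ hγ (hac.trans hcb) ha1 hb1 hδ' (by
    rcases max_choice (-1) (c - (δ' - δ)) with h3 | h3
    · exact truncHeight_le_height hκ hγ haI hδ' (by rw [ha, h3]; linarith)
    · rw [← h]
      exact truncHeight_mono hκ hγ haI hc hδ' hδ (by rw [ha, h3]; linarith)
        (by rw [ha, h3]; linarith)) (by
    rcases min_choice 1 (c + (δ' - δ)) with h3 | h3
    · exact height_le_truncHeight hκ hγ hbI hδ' (by rw [hb, h3]; linarith)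
    · rw [← h]
      exact truncHeight_mono hκ hγ hc hbI hδ hδ' (by rw [hb, h3]; linarith)
        (by rw [hb, h3]; linarith))
  exact ⟨c', ⟨ha1.trans hc'.1, hc'.2.trans hb1⟩, heq, by linarith [hc'.2], by linarith [hc'.1]⟩

/-- Truncations with the same δ are monotone in c. Two that are comparable and have equal height
coincide, even if the centres do not. -/
theorem truncSine_unique (hκ : 0 < κ₀) (hγ : γ.1.IsCondensed) {c c' δ : ℝ}
    (hc : c ∈ Icc (-1 : ℝ) 1) (hc' : c' ∈ Icc (-1 : ℝ) 1) (hδ : 0 ≤ δ)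
    (h : γ.1.truncHeight κ₀ c δ = γ.1.height) (h' : γ.1.truncHeight κ₀ c' δ = γ.1.height) :
    ∀ t ∈ Icc (0 : ℝ) 1, γ.1.truncSine κ₀ c δ t = γ.1.truncSine κ₀ c' δ t := by
  wlog hle : c ≤ c' generalizing c c'
  · exact fun t ht => (this hc' hc h' h (le_of_not_ge hle) t ht).symm
  · exact eq_of_integral_slope_eq hγ (continuousOn_truncSine hκ hγ _ _)
      (continuousOn_truncSine hκ hγ _ _) (fun _ ht => abs_truncSine_le hκ hγ hc hδ ht)
      (fun _ ht => abs_truncSine_le hκ hγ hc' hδ ht)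
      (fun t _ => truncSine_mono hγ (by linarith) (by linarith) t) (h.trans h'.symm)

/-- The value 2 is the width of [-1, 1]: for every admissible centre both levels then reach their
extremes ∓ρ, and nothing is cut. This fixes the scaling δ = 2s. -/
theorem truncSine_eq_sine (hκ : 0 < κ₀) (hγ : γ.1.IsCondensed) {c : ℝ}
    (hc : c ∈ Icc (-1 : ℝ) 1) {t : ℝ} (ht : t ∈ Icc (0 : ℝ) 1) :
    γ.1.truncSine κ₀ c 2 t = γ.1.sine t :=
  le_antisymm (truncSine_le_sine hκ hγ (by linarith [hc.2]) ht)
    (sine_le_truncSine hκ hγ (by linarith [hc.1]) ht)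

theorem truncSine_nested (hγ : γ.1.IsCondensed) {c δ c' δ' : ℝ}
    (hc : c ∈ Icc (-1 : ℝ) 1) (hδ : 0 ≤ δ) (h1 : c' - δ' ≤ c - δ) (h2 : c + δ ≤ c' + δ') (t : ℝ) :
    truncate (γ.1.lowerEnvelope κ₀ t) (γ.1.upperEnvelope κ₀ t) (γ.1.truncSine κ₀ c' δ' t)
      (γ.1.lowLevel c δ) (γ.1.highLevel c δ) = γ.1.truncSine κ₀ c δ t := by
  have h := maxSine_nonneg hγ
  exact truncate.nested (by unfold lowLevel; gcongr) (lowLevel_le_highLevel hγ hc hδ)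
    (by unfold highLevel; gcongr)

/-- If the narrower truncation exceeded at `t` every value of the wider one, it would have been
raised there, so its value would be at most the lower level. The whole wider function would then lie
below that level, and narrowing could only raise it. Equal heights would force equality everywhere,
a contradiction at `t`. -/
theorem exists_truncSine_le (hκ : 0 < κ₀) (hγ : γ.1.IsCondensed) {c δ c' δ' : ℝ}
    (hc : c ∈ Icc (-1 : ℝ) 1) (hc' : c' ∈ Icc (-1 : ℝ) 1) (hδ : 0 ≤ δ) (hδ' : 0 ≤ δ')
    (h1 : c' - δ' ≤ c - δ) (h2 : c + δ ≤ c' + δ')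
    (h : γ.1.truncHeight κ₀ c δ = γ.1.height) (h' : γ.1.truncHeight κ₀ c' δ' = γ.1.height)
    {t : ℝ} (ht : t ∈ Icc (0 : ℝ) 1) :
    ∃ u ∈ Icc (0 : ℝ) 1, γ.1.truncSine κ₀ c δ t ≤ γ.1.truncSine κ₀ c' δ' u := by
  by_contra! hlt
  have hn := truncSine_nested (κ₀ := κ₀) hγ hc hδ h1 h2
  have hlam : γ.1.truncSine κ₀ c δ t ≤ γ.1.lowLevel c δ := by
    rw [← hn t]
    exact truncate.le_lam truncate.lower_le (by rw [hn]; exact hlt t ht)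
  refine (hlt t ht).ne (eq_of_integral_slope_eq hγ (continuousOn_truncSine hκ hγ _ _)
    (continuousOn_truncSine hκ hγ _ _) (fun _ hs => abs_truncSine_le hκ hγ hc' hδ' hs)
    (fun _ hs => abs_truncSine_le hκ hγ hc hδ hs) (fun s hs => ?_) (h'.trans h.symm) t ht)
  refine le_max_of_le_left (le_max_of_le_right (le_min ((hlt s hs).le.trans hlam) ?_))
  exact truncate.le_upper ((lowerEnvelope_le hκ hγ hs).trans (le_upperEnvelope hκ hγ hs))
    (le_upperEnvelope hκ hγ hs)

theorem exists_le_truncSine (hκ : 0 < κ₀) (hγ : γ.1.IsCondensed) {c δ c' δ' : ℝ}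
    (hc : c ∈ Icc (-1 : ℝ) 1) (hc' : c' ∈ Icc (-1 : ℝ) 1) (hδ : 0 ≤ δ) (hδ' : 0 ≤ δ')
    (h1 : c' - δ' ≤ c - δ) (h2 : c + δ ≤ c' + δ')
    (h : γ.1.truncHeight κ₀ c δ = γ.1.height) (h' : γ.1.truncHeight κ₀ c' δ' = γ.1.height)
    {t : ℝ} (ht : t ∈ Icc (0 : ℝ) 1) :
    ∃ u ∈ Icc (0 : ℝ) 1, γ.1.truncSine κ₀ c' δ' u ≤ γ.1.truncSine κ₀ c δ t := by
  by_contra! hlt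
  have hn := truncSine_nested (κ₀ := κ₀) hγ hc hδ h1 h2
  have hub : ∀ s ∈ Icc (0 : ℝ) 1, γ.1.truncSine κ₀ c' δ' s ≤ γ.1.upperEnvelope κ₀ s :=
    fun s hs => truncate.le_upper
      ((lowerEnvelope_le hκ hγ hs).trans (le_upperEnvelope hκ hγ hs)) (le_upperEnvelope hκ hγ hs)
  have hmu : γ.1.highLevel c δ ≤ γ.1.truncSine κ₀ c δ t := by
    rw [← hn t]
    exact truncate.mu_le (hub t ht) (by rw [hn]; exact hlt t ht)
  refine (hlt t ht).ne (eq_of_integral_slope_eq hγ (continuousOn_truncSine hκ hγ _ _)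
    (continuousOn_truncSine hκ hγ _ _) (fun _ hs => abs_truncSine_le hκ hγ hc hδ hs)
    (fun _ hs => abs_truncSine_le hκ hγ hc' hδ' hs) (fun s hs => ?_) (h.trans h'.symm) t ht)
  rw [← hn s]
  exact truncate.le_of_le truncate.lower_le
    (((lowLevel_le_highLevel hγ hc hδ).trans hmu).trans (hlt s hs).le) le_rfl

/-- With p the slope, 1/√(1 - a²) = √(1 + p²), and the derivative of this convex function of p is
the sine a. The inequality is the tangent line inequality at the slope of `a`. -/
theorem inv_sqrt_sub_le {a b ρ : ℝ} (hρ : ρ < 1) (ha : |a| ≤ ρ) (hb : |b| ≤ ρ) :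
    (√(1 - a ^ 2))⁻¹ - (√(1 - b ^ 2))⁻¹ ≤ a * (slopeOfSine a - slopeOfSine b) := by
  have ha' := one_sub_sq_pos hρ ha
  have hb' := one_sub_sq_pos hρ hb
  have hx := Real.sqrt_pos.2 ha'
  have hy := Real.sqrt_pos.2 hb'
  have hx2 := Real.sq_sqrt ha'.le
  have hy2 := Real.sq_sqrt hb'.le
  unfold slopeOfSine
  set x := √(1 - a ^ 2)
  set y := √(1 - b ^ 2)
  -- For a = sin α and b = sin β this is cos(α - β) ≤ 1.
  have key : x * y + a * b ≤ 1 := by nlinarith [sq_nonneg (x - y), sq_nonneg (a - b)]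
  have e1 : a * (a / x - b / y) - (x⁻¹ - y⁻¹) = ((1 - a * b) - x * y) / y := by
    field_simp
    have : a ^ 2 = 1 - x ^ 2 := by linarith
    ring_nf
    rw [this]
    ring
  have e2 : 0 ≤ ((1 - a * b) - x * y) / y := div_nonneg (by linarith) hy.le
  linarith

/-- `lam` is the Lagrange multiplier of the height constraint. By convexity the change of length is
at most the integral of axial speed · f · (change of slope). The sign conditions allow replacing the
factor f by the constant `lam`, and then the integral vanishes by equality of heights. -/
theorem integral_graphSpeed_le {γ : RegularCurve} (hγ : γ.IsCondensed) {f g : ℝ → ℝ} {lam : ℝ}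
    (hf : ContinuousOn f (Icc 0 1)) (hg : ContinuousOn g (Icc 0 1))
    (hfb : ∀ t ∈ Icc (0 : ℝ) 1, |f t| ≤ γ.maxSine) (hgb : ∀ t ∈ Icc (0 : ℝ) 1, |g t| ≤ γ.maxSine)
    (h1 : ∀ t ∈ Icc (0 : ℝ) 1, g t < f t → f t ≤ lam)
    (h2 : ∀ t ∈ Icc (0 : ℝ) 1, f t < g t → lam ≤ f t)
    (heq : ∫ t in (0 : ℝ)..1, γ.axialSpeed t * slopeOfSine (f t) =
      ∫ t in (0 : ℝ)..1, γ.axialSpeed t * slopeOfSine (g t)) :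
    ∫ t in (0 : ℝ)..1, γ.graphSpeed f t ≤ ∫ t in (0 : ℝ)..1, γ.graphSpeed g t := by
  have hρ := maxSine_lt_one hγ
  have h0 : (0 : ℝ) ∈ Icc (0 : ℝ) 1 := by simp
  have h1' : (1 : ℝ) ∈ Icc (0 : ℝ) 1 := by simp
  have if1 := intervalIntegrable_unit (continuousOn_slope (γ := γ) hf hρ hfb) h0 h1'
  have ig1 := intervalIntegrable_unit (continuousOn_slope (γ := γ) hg hρ hgb) h0 h1'
  have if2 := intervalIntegrable_unit (continuousOn_graphSpeed_of_le (γ := γ) hf hρ hfb) h0 h1'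
  have ig2 := intervalIntegrable_unit (continuousOn_graphSpeed_of_le (γ := γ) hg hρ hgb) h0 h1'
  have key : ∫ t in (0 : ℝ)..1, (γ.graphSpeed f t - γ.graphSpeed g t) ≤
      ∫ t in (0 : ℝ)..1, lam * (γ.axialSpeed t * slopeOfSine (f t) -
        γ.axialSpeed t * slopeOfSine (g t)) := by
    refine intervalIntegral.integral_mono_on zero_le_one (if2.sub ig2)
      ((if1.sub ig1).const_mul _) fun t ht => ?_
    have hv := axialSpeed_pos hγ ht
    have e1 := inv_sqrt_sub_le hρ (hfb t ht) (hgb t ht)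
    have e2 : f t * (slopeOfSine (f t) - slopeOfSine (g t)) ≤
        lam * (slopeOfSine (f t) - slopeOfSine (g t)) := by
      rcases lt_trichotomy (f t) (g t) with h | h | h
      · have h3 := slopeOfSine_lt hρ (hfb t ht) (hgb t ht) h
        have h4 := h2 t ht h
        nlinarith
      · simp [h]
      · have h3 := slopeOfSine_lt hρ (hgb t ht) (hfb t ht) h
        have h4 := h1 t ht h
        nlinarith
    rw [graphSpeed, graphSpeed, div_eq_mul_inv, div_eq_mul_inv, ← mul_sub, ← mul_sub,
      mul_left_comm]
    exact mul_le_mul_of_nonneg_left (e1.trans e2) hv.le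
  rw [intervalIntegral.integral_sub if2 ig2, intervalIntegral.integral_const_mul,
    intervalIntegral.integral_sub if1 ig1, heq, sub_self, mul_zero] at key
  linarith

/-- The lower level can serve as the multiplier: raised values end at or below it, and lowered
values end at or above the upper level, hence above it too. -/
theorem length_trunc_le (hκ : 0 < κ₀) (hγ : γ.1.IsCondensed) {c δ c' δ' : ℝ}
    (hc : c ∈ Icc (-1 : ℝ) 1) (hc' : c' ∈ Icc (-1 : ℝ) 1) (hδ : 0 ≤ δ) (hδ' : 0 ≤ δ')
    (h1 : c' - δ' ≤ c - δ) (h2 : c + δ ≤ c' + δ')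
    (h : γ.1.truncHeight κ₀ c δ = γ.1.height) (h' : γ.1.truncHeight κ₀ c' δ' = γ.1.height) :
    ∫ t in (0 : ℝ)..1, γ.1.graphSpeed (γ.1.truncSine κ₀ c δ) t ≤
      ∫ t in (0 : ℝ)..1, γ.1.graphSpeed (γ.1.truncSine κ₀ c' δ') t := by
  have hn := truncSine_nested (κ₀ := κ₀) hγ hc hδ h1 h2
  refine integral_graphSpeed_le hγ (lam := γ.1.lowLevel c δ) (continuousOn_truncSine hκ hγ _ _)
    (continuousOn_truncSine hκ hγ _ _) (fun _ hs => abs_truncSine_le hκ hγ hc hδ hs)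
    (fun _ hs => abs_truncSine_le hκ hγ hc' hδ' hs) (fun t ht hlt => ?_) (fun t ht hlt => ?_)
    (h.trans h'.symm)
  · rw [← hn t]
    exact truncate.le_lam truncate.lower_le (by rw [hn]; exact hlt)
  · refine (lowLevel_le_highLevel hγ hc hδ).trans ?_
    rw [← hn t]
    exact truncate.mu_le (truncate.le_upper
      ((lowerEnvelope_le hκ hγ ht).trans (le_upperEnvelope hκ hγ ht)) (le_upperEnvelope hκ hγ ht))
      (by rw [hn]; exact hlt)

end levels

end RegularCurve

/-! ### The truncation homotopy -/

section truncation

open RegularCurve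

variable {κ₀ : ℝ} {q : ℂ} {z : Circle} {θ₁ : ℝ}

/-- The pairs of a curve and a level for which the truncated curve has the same end-points. -/
def BalancedLevel (κ₀ : ℝ) (q : ℂ) (z : Circle) (θ₁ : ℝ) : Type :=
  {w : (unitInterval × condensedCurves κ₀ (q, z) θ₁) × Icc (-1 : ℝ) 1 //
    w.1.2.1.1.truncHeight κ₀ w.2 (2 * w.1.1) = w.1.2.1.1.height}

instance : TopologicalSpace (BalancedLevel κ₀ q z θ₁) := instTopologicalSpaceSubtype

theorem two_mul_coe_nonneg (s : unitInterval) : (0 : ℝ) ≤ 2 * s := mul_nonneg zero_le_two s.2.1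

theorem BalancedLevel.isAdmissible (hκ : 0 < κ₀) (w : BalancedLevel κ₀ q z θ₁) :
    w.1.1.2.1.1.IsAdmissible κ₀ (w.1.1.2.1.1.truncSine κ₀ w.1.2 (2 * w.1.1.1)) :=
  isAdmissible_truncSine hκ w.1.1.2.2.2 w.1.2.2 (two_mul_coe_nonneg _) w.2

/-- The truncated curve. -/
def BalancedLevel.curve (hκ : 0 < κ₀) (hz : Circle.exp θ₁ = z) (w : BalancedLevel κ₀ q z θ₁) :
    condensedCurves κ₀ (q, z) θ₁ :=
  (graphProfile hκ w.1.1.2 (w.isAdmissible hκ)).toCurve hκ hz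

instance : FirstCountableTopology (BalancedLevel κ₀ q z θ₁) :=
  inferInstanceAs (FirstCountableTopology {w : (unitInterval × condensedCurves κ₀ (q, z) θ₁) ×
    Icc (-1 : ℝ) 1 // w.1.2.1.1.truncHeight κ₀ w.2 (2 * w.1.1) = w.1.2.1.1.height})

theorem BalancedLevel.continuous_curve (hκ : 0 < κ₀) (hz : Circle.exp θ₁ = z) :
    Continuous (BalancedLevel.curve (q := q) hκ hz) := by
  rw [continuous_iff_seqContinuous]
  intro w w' hw
  have hw' : Tendsto (fun n => (w n).1) atTop (𝓝 w'.1) := tendsto_subtype_rng.1 hw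
  -- Passing to subsequences supplies the pointwise convergence of speeds and angle derivatives,
  -- which the metric alone does not give for the full sequence.
  refine tendsto_of_subseq_tendsto fun ns hns => ?_
  have hγ : Tendsto (fun n => (w (ns n)).1.1.2) atTop (𝓝 w'.1.1.2) :=
    ((((continuous_snd.comp continuous_fst).tendsto _).comp hw').comp hns :)
  have hs : Tendsto (fun n => (2 * ((w (ns n)).1.1.1 : ℝ))) atTop (𝓝 (2 * (w'.1.1.1 : ℝ))) :=
    (((continuous_subtype_val.comp (continuous_fst.comp continuous_fst)).tendsto _).comp
      (hw'.comp hns) :).const_mul 2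
  have hc : Tendsto (fun n => ((w (ns n)).1.2 : ℝ)) atTop (𝓝 (w'.1.2 : ℝ)) :=
    (((continuous_subtype_val.comp continuous_snd).tendsto _).comp (hw'.comp hns) :)
  have hγ' : Tendsto (fun n => (w (ns n)).1.1.2.1) atTop (𝓝 w'.1.1.2.1) :=
    tendsto_subtype_rng.1 hγ
  obtain ⟨ms, hms, hae⟩ := CurveSpace.exists_seq_ae hγ'
  refine ⟨ms, ?_⟩
  exact tendsto_graphProfile hκ hz (hγ.comp hms.tendsto_atTop)
    (fun n => (w (ns (ms n))).isAdmissible hκ) (w'.isAdmissible hκ) (hae.mono fun _ => And.left)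
    (lipTendsto_truncSine hκ (hγ'.comp hms.tendsto_atTop) (hc.comp hms.tendsto_atTop)
      (hs.comp hms.tendsto_atTop) hae)

/-- The projection forgetting the level. -/
def BalancedLevel.proj (w : BalancedLevel κ₀ q z θ₁) :
    unitInterval × condensedCurves κ₀ (q, z) θ₁ := w.1.1

/-- The balance condition is closed, and projecting away the compact factor [-1, 1] is a closed map.
A closed continuous surjection is a quotient map. This yields continuity of the homotopy without any
continuous choice of the centre. -/
theorem BalancedLevel.isQuotientMap_proj (hκ : 0 < κ₀) :
    IsQuotientMap (BalancedLevel.proj (κ₀ := κ₀) (q := q) (z := z) (θ₁ := θ₁)) := by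
  have hclosed : IsClosed {w : (unitInterval × condensedCurves κ₀ (q, z) θ₁) × Icc (-1 : ℝ) 1 |
      w.1.2.1.1.truncHeight κ₀ w.2 (2 * w.1.1) = w.1.2.1.1.height} := by
    refine isClosed_eq ?_ ?_
    · rw [continuous_iff_seqContinuous]
      intro w w' hw
      refine tendsto_truncHeight (γ := fun n => (w n).1.2.1) (η := w'.1.2.1)
        (c := fun n => (w n).2) (δ := fun n => 2 * (w n).1.1) hκ
        (((continuous_subtype_val.comp (continuous_snd.comp continuous_fst)).tendsto w').comp hw)
        (fun n => (w n).1.2.2.2) w'.1.2.2.2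
        (((continuous_subtype_val.comp continuous_snd).tendsto w').comp hw)
        ((((continuous_subtype_val.comp (continuous_fst.comp continuous_fst)).tendsto w').comp
          hw).const_mul 2)
        (fun n => (w n).2.2) fun n => two_mul_coe_nonneg _
    · rw [continuous_iff_seqContinuous]
      intro w w' hw
      exact tendsto_height (γ := fun n => (w n).1.2.1) (η := w'.1.2.1) hκ
        (((continuous_subtype_val.comp (continuous_snd.comp continuous_fst)).tendsto w').comp hw)
        (fun n => (w n).1.2.2.2) w'.1.2.2.2
  refine IsClosedMap.isQuotientMap ?_ (continuous_fst.comp continuous_subtype_val) ?_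
  · exact (isClosedMap_fst_of_compactSpace).comp hclosed.isClosedEmbedding_subtypeVal.isClosedMap
  · rintro ⟨s, γ⟩
    obtain ⟨c, hc, h⟩ := exists_level hκ γ.2.2 (two_mul_coe_nonneg s)
    exact ⟨⟨((s, γ), ⟨c, hc⟩), h⟩, rfl⟩

theorem BalancedLevel.curve_eq (hκ : 0 < κ₀) (hz : Circle.exp θ₁ = z)
    {w w' : BalancedLevel κ₀ q z θ₁} (h : w.proj = w'.proj) : w.curve hκ hz = w'.curve hκ hz := by
  obtain ⟨⟨⟨s, γ⟩, c, hc⟩, hw⟩ := w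
  obtain ⟨⟨⟨s', γ'⟩, c', hc'⟩, hw'⟩ := w'
  obtain ⟨rfl, rfl⟩ : s = s' ∧ γ = γ' := Prod.ext_iff.1 h
  have := truncSine_unique hκ γ.2.2 hc hc' (two_mul_coe_nonneg s) hw hw'
  refine CondensedProfile.toCurve_congr hκ hz (fun t ht => ?_) fun t ht => ?_
  · exact congrArg (fun y => γ.1.1.axialSpeed t / √(1 - y ^ 2)) (this t ht)
  · exact congrArg (fun y => γ.1.1.midAngle + Real.arcsin y) (this t ht)

/-- The homotopy given by truncation. -/
def truncHomotopy (hκ : 0 < κ₀) (hz : Circle.exp θ₁ = z) :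
    C(unitInterval × condensedCurves κ₀ (q, z) θ₁, condensedCurves κ₀ (q, z) θ₁) where
  toFun x := BalancedLevel.curve hκ hz ((BalancedLevel.isQuotientMap_proj hκ).surjective x).choose
  continuous_toFun := by
    rw [(BalancedLevel.isQuotientMap_proj hκ).continuous_iff]
    refine (BalancedLevel.continuous_curve (q := q) hκ hz).congr fun w => ?_
    exact BalancedLevel.curve_eq hκ hz
      ((BalancedLevel.isQuotientMap_proj hκ).surjective w.proj).choose_spec.symm

theorem truncHomotopy_eq (hκ : 0 < κ₀) (hz : Circle.exp θ₁ = z) (w : BalancedLevel κ₀ q z θ₁) :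
    truncHomotopy hκ hz w.proj = w.curve hκ hz :=
  BalancedLevel.curve_eq hκ hz
    ((BalancedLevel.isQuotientMap_proj hκ).surjective w.proj).choose_spec

theorem truncHomotopy_one (hκ : 0 < κ₀) (hz : Circle.exp θ₁ = z)
    (γ : condensedCurves κ₀ (q, z) θ₁) : truncHomotopy hκ hz (1, γ) = γ := by
  obtain ⟨w, hw⟩ := (BalancedLevel.isQuotientMap_proj hκ).surjective ((1 : unitInterval), γ)
  obtain ⟨⟨⟨s, γ'⟩, c, hc⟩, hw'⟩ := w
  obtain ⟨rfl, rfl⟩ : s = 1 ∧ γ' = γ := Prod.ext_iff.1 hw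
  refine (truncHomotopy_eq hκ hz ⟨((1, γ'), ⟨c, hc⟩), hw'⟩).trans ?_
  have hs : ∀ t ∈ Icc (0 : ℝ) 1,
      γ'.1.1.truncSine κ₀ c (2 * ((1 : unitInterval) : ℝ)) t = γ'.1.1.sine t := fun t ht => by
    rw [Set.Icc.coe_one, mul_one]
    exact truncSine_eq_sine hκ γ'.2.2 hc ht
  refine CondensedProfile.toCurve_eq hκ hz _ _ (fun t ht => ?_) fun t ht => ?_
  · exact (congrArg (fun y => γ'.1.1.axialSpeed t / √(1 - y ^ 2)) (hs t ht)).trans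
      (graphSpeed_sine γ'.2.2 ht)
  · exact (congrArg (fun y => γ'.1.1.midAngle + Real.arcsin y) (hs t ht)).trans
      (graphAngle_sine γ'.2.2 ht)

theorem BalancedLevel.angle_curve (hκ : 0 < κ₀) (hz : Circle.exp θ₁ = z)
    (w : BalancedLevel κ₀ q z θ₁) {t : ℝ} (ht : t ∈ Icc (0 : ℝ) 1) :
    (w.curve hκ hz).1.1.angle t = w.1.1.2.1.1.midAngle +
      Real.arcsin (w.1.1.2.1.1.truncSine κ₀ w.1.2 (2 * w.1.1.1) t) :=
  CondensedProfile.angle_toRegular hκ _ ht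

theorem CondensedProfile.length_toRegular (hκ : 0 < κ₀) (p : CondensedProfile κ₀ q θ₁) :
    (p.toRegular hκ).length = ∫ t in (0 : ℝ)..1, p.speed t :=
  p.arcLength_toRegular hκ (by simp)

theorem exists_nested_balancedLevel (hκ : 0 < κ₀) {s s' : unitInterval} (hs : s ≤ s')
    (γ : condensedCurves κ₀ (q, z) θ₁) :
    ∃ c ∈ Icc (-1 : ℝ) 1, ∃ c' ∈ Icc (-1 : ℝ) 1,
      γ.1.1.truncHeight κ₀ c (2 * s) = γ.1.1.height ∧
      γ.1.1.truncHeight κ₀ c' (2 * s') = γ.1.1.height ∧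
      c' - 2 * s' ≤ c - 2 * s ∧ c + 2 * s ≤ c' + 2 * s' := by
  obtain ⟨c, hc, h⟩ := exists_level hκ γ.2.2 (two_mul_coe_nonneg s)
  have hs' : (s : ℝ) ≤ s' := hs
  obtain ⟨c', hc', h', h1, h2⟩ := exists_nested_level hκ γ.2.2 hc (two_mul_coe_nonneg s)
    (δ' := 2 * s') (by linarith) h
  exact ⟨c, hc, c', hc', h, h', h1, h2⟩

theorem monotone_amplitude_truncHomotopy (hκ : 0 < κ₀) (hz : Circle.exp θ₁ = z)
    (γ : condensedCurves κ₀ (q, z) θ₁) :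
    Monotone fun s => (truncHomotopy hκ hz (s, γ)).1.1.amplitude := by
  intro s s' hs
  obtain ⟨c, hc, c', hc', h, h', h1, h2⟩ := exists_nested_balancedLevel hκ hs γ
  let w : BalancedLevel κ₀ q z θ₁ := ⟨((s, γ), ⟨c, hc⟩), h⟩
  let w' : BalancedLevel κ₀ q z θ₁ := ⟨((s', γ), ⟨c', hc'⟩), h'⟩
  have e : truncHomotopy hκ hz (s, γ) = w.curve hκ hz := truncHomotopy_eq hκ hz w
  have e' : truncHomotopy hκ hz (s', γ) = w'.curve hκ hz := truncHomotopy_eq hκ hz w'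
  simp only [e, e']
  refine amplitude_le_of_range (fun t ht => ?_) fun t ht => ?_
  · obtain ⟨u, hu, hle⟩ := exists_truncSine_le hκ γ.2.2 hc hc' (two_mul_coe_nonneg s)
      (two_mul_coe_nonneg s') h1 h2 h h' ht
    refine ⟨u, hu, ?_⟩
    rw [w.angle_curve hκ hz ht, w'.angle_curve hκ hz hu]
    exact add_le_add_right (Real.monotone_arcsin hle) _
  · obtain ⟨u, hu, hle⟩ := exists_le_truncSine hκ γ.2.2 hc hc' (two_mul_coe_nonneg s)
      (two_mul_coe_nonneg s') h1 h2 h h' ht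
    refine ⟨u, hu, ?_⟩
    rw [w.angle_curve hκ hz ht, w'.angle_curve hκ hz hu]
    exact add_le_add_right (Real.monotone_arcsin hle) _

theorem monotone_length_truncHomotopy (hκ : 0 < κ₀) (hz : Circle.exp θ₁ = z)
    (γ : condensedCurves κ₀ (q, z) θ₁) :
    Monotone fun s => (truncHomotopy hκ hz (s, γ)).1.1.length := by
  intro s s' hs
  obtain ⟨c, hc, c', hc', h, h', h1, h2⟩ := exists_nested_balancedLevel hκ hs γ
  let w : BalancedLevel κ₀ q z θ₁ := ⟨((s, γ), ⟨c, hc⟩), h⟩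
  let w' : BalancedLevel κ₀ q z θ₁ := ⟨((s', γ), ⟨c', hc'⟩), h'⟩
  have e : truncHomotopy hκ hz (s, γ) = w.curve hκ hz := truncHomotopy_eq hκ hz w
  have e' : truncHomotopy hκ hz (s', γ) = w'.curve hκ hz := truncHomotopy_eq hκ hz w'
  simp only [e, e']
  have l : (w.curve hκ hz).1.1.length = ∫ t in (0 : ℝ)..1, w.1.1.2.1.1.graphSpeed
    (w.1.1.2.1.1.truncSine κ₀ w.1.2 (2 * w.1.1.1)) t := CondensedProfile.length_toRegular hκ _
  have l' : (w'.curve hκ hz).1.1.length = ∫ t in (0 : ℝ)..1, w'.1.1.2.1.1.graphSpeed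
    (w'.1.1.2.1.1.truncSine κ₀ w'.1.2 (2 * w'.1.1.1)) t := CondensedProfile.length_toRegular hκ _
  rw [l, l']
  exact length_trunc_le hκ γ.2.2 hc hc' (two_mul_coe_nonneg s) (two_mul_coe_nonneg s') h1 h2 h h'

end truncation

/-! ### Arc–segment–arc profiles in arc length -/

theorem integral_smul_comp_unit {E : Type*} [NormedAddCommGroup E] [NormedSpace ℝ E]
    {v : ℝ → ℝ} (hv : ContinuousOn v (Icc 0 1)) {F : ℝ → E}
    (hF : Continuous F) {a b : ℝ} (ha : a ∈ Icc (0 : ℝ) 1) (hb : b ∈ Icc (0 : ℝ) 1) :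
    ∫ t in a..b, v t • F (∫ τ in (0 : ℝ)..t, v τ) =
      ∫ s in (∫ τ in (0 : ℝ)..a, v τ)..(∫ τ in (0 : ℝ)..b, v τ), F s := by
  have hsub := uIcc_subset_Icc ha hb
  refine intervalIntegral.integral_deriv_smul_comp'' (f := fun t => ∫ τ in (0 : ℝ)..t, v τ)
    ((IsLip.integral hv).continuousOn.mono hsub) (fun x hx => ?_) (hv.mono hsub)
    hF.continuousOn
  have hx' : x ∈ Ioo (0 : ℝ) 1 :=
    ⟨(le_min ha.1 hb.1).trans_lt hx.1, hx.2.trans_le (max_le ha.2 hb.2)⟩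
  exact (hasDerivAt_integral_unit hv hx').hasDerivWithinAt

theorem eq_of_deriv_eq_zero {F : ℝ → ℝ} (hF : IsLip F) {a b : ℝ} (ha : a ∈ Icc (0 : ℝ) 1)
    (hb : b ∈ Icc (0 : ℝ) 1) (hab : a ≤ b) (h : ∀ t ∈ Ioo a b, deriv F t = 0) : F b = F a := by
  rw [← sub_eq_zero, ← hF.integral_deriv ha hb, intervalIntegral.integral_of_le hab,
    integral_Ioc_eq_integral_Ioo, setIntegral_congr_fun measurableSet_Ioo h, integral_zero]

theorem integral_cos_affine (m k p r : ℝ) (hk : k ≠ 0) :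
    ∫ s in p..r, Real.cos (m + k * s) = (Real.sin (m + k * r) - Real.sin (m + k * p)) / k := by
  rw [intervalIntegral.integral_eq_sub_of_hasDerivAt
    (f := fun s => Real.sin (m + k * s) / k)]
  · ring
  · intro s _
    have h := ((((hasDerivAt_id s).const_mul k).const_add m).sin).div_const k
    exact h.congr_deriv (by rw [mul_one, mul_div_cancel_right₀ _ hk]; rfl)
  · exact (by fun_prop : Continuous fun s => Real.cos (m + k * s)).intervalIntegrable _ _

/-- Here u lies in [d, 2a - d], and a < π places this inside [d, 2π - d], where the cosine is at
most cos d. This is the point at which arcs shorter than π are needed. -/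
theorem cos_le_cos_of_abs_sub_le {u a d : ℝ} (hd : 0 ≤ d) (ha : a < Real.pi)
    (h : |u - a| ≤ a - d) : Real.cos u ≤ Real.cos d := by
  have h' := abs_le.1 h
  rcases le_total u Real.pi with hu | hu
  · exact Real.cos_le_cos_of_nonneg_of_le_pi hd hu (by linarith)
  · rw [← Real.cos_two_pi_sub]
    exact Real.cos_le_cos_of_nonneg_of_le_pi hd (by linarith) (by linarith)

theorem eq_of_cos_eq_cos_of_abs_sub_le {u a d : ℝ} (hd : 0 ≤ d) (ha : a < Real.pi)
    (h : |u - a| ≤ a - d) (heq : Real.cos u = Real.cos d) : u = d := by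
  have h' := abs_le.1 h
  have hdp : d ≤ Real.pi := by linarith
  rcases le_total u Real.pi with hu | hu
  · exact Real.injOn_cos ⟨by linarith, hu⟩ ⟨hd, hdp⟩ heq
  · rw [← Real.cos_two_pi_sub] at heq
    have := Real.injOn_cos ⟨by linarith, by linarith⟩ ⟨hd, hdp⟩ heq
    linarith

/-- The argument of the unit tangent, as a function of arc-length, of an arc of a circle followed
by a segment of direction `ν` and by another arc of a circle. -/
def cscAngle (κ ν ε₁ ε₂ s₁ s₂ s : ℝ) : ℝ :=
  ν + ε₁ * (κ * max 0 (s₁ - s)) + ε₂ * (κ * max 0 (s - s₂))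

theorem continuous_cscAngle (κ ν ε₁ ε₂ s₁ s₂ : ℝ) : Continuous (cscAngle κ ν ε₁ ε₂ s₁ s₂) := by
  unfold cscAngle
  fun_prop

theorem continuous_cos_cscAngle (κ ν ε₁ ε₂ s₁ s₂ : ℝ) :
    Continuous fun s => Real.cos (cscAngle κ ν ε₁ ε₂ s₁ s₂ s - ν) :=
  Real.continuous_cos.comp ((continuous_cscAngle _ _ _ _ _ _).sub continuous_const)

section cscAngle

variable {κ ν ε₁ ε₂ s₁ s₂ s : ℝ}

theorem cscAngle_of_le_left (h12 : s₁ ≤ s₂) (h : s ≤ s₁) :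
    cscAngle κ ν ε₁ ε₂ s₁ s₂ s = ν + ε₁ * (κ * (s₁ - s)) := by
  rw [cscAngle, max_eq_right (by linarith), max_eq_left (by linarith)]
  ring

theorem cscAngle_of_mem (h1 : s₁ ≤ s) (h2 : s ≤ s₂) : cscAngle κ ν ε₁ ε₂ s₁ s₂ s = ν := by
  rw [cscAngle, max_eq_left (by linarith), max_eq_left (by linarith)]
  ring

theorem cscAngle_of_right_le (h12 : s₁ ≤ s₂) (h : s₂ ≤ s) :
    cscAngle κ ν ε₁ ε₂ s₁ s₂ s = ν + ε₂ * (κ * (s - s₂)) := by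
  rw [cscAngle, max_eq_left (by linarith), max_eq_right (by linarith)]
  ring

theorem cos_mul_eq_of_abs_eq_one {ε : ℝ} (hε : |ε| = 1) (x : ℝ) :
    Real.cos (ε * x) = Real.cos x := by
  rcases eq_or_eq_neg_of_abs_eq hε with rfl | rfl
  · rw [one_mul]
  · rw [neg_one_mul, Real.cos_neg]

theorem mul_self_eq_one_of_abs_eq_one {ε : ℝ} (hε : |ε| = 1) : ε * ε = 1 := by
  rw [← abs_mul_abs_self, hε, one_mul]

theorem integral_cos_cscAngle (hκ : 0 < κ) (hε₁ : |ε₁| = 1) (hε₂ : |ε₂| = 1) {L : ℝ}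
    (h1 : 0 ≤ s₁) (h12 : s₁ ≤ s₂) (h2 : s₂ ≤ L) :
    ∫ s in (0 : ℝ)..L, Real.cos (cscAngle κ ν ε₁ ε₂ s₁ s₂ s - ν) =
      Real.sin (κ * s₁) / κ + (s₂ - s₁) + Real.sin (κ * (L - s₂)) / κ := by
  have hc := continuous_cos_cscAngle κ ν ε₁ ε₂ s₁ s₂
  rw [← intervalIntegral.integral_add_adjacent_intervals (hc.intervalIntegrable 0 s₂)
      (hc.intervalIntegrable s₂ L),
    ← intervalIntegral.integral_add_adjacent_intervals (hc.intervalIntegrable 0 s₁)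
      (hc.intervalIntegrable s₁ s₂)]
  have e1 : ∫ s in (0 : ℝ)..s₁, Real.cos (cscAngle κ ν ε₁ ε₂ s₁ s₂ s - ν) =
      ∫ s in (0 : ℝ)..s₁, Real.cos (κ * s₁ + -κ * s) := by
    refine intervalIntegral.integral_congr fun s hs => ?_
    rw [uIcc_of_le h1] at hs
    simp only [cscAngle_of_le_left h12 hs.2, add_sub_cancel_left, cos_mul_eq_of_abs_eq_one hε₁]
    ring_nf
  have e2 : ∫ s in s₁..s₂, Real.cos (cscAngle κ ν ε₁ ε₂ s₁ s₂ s - ν) = ∫ s in s₁..s₂, (1 : ℝ) := by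
    refine intervalIntegral.integral_congr fun s hs => ?_
    rw [uIcc_of_le h12] at hs
    simp only [cscAngle_of_mem hs.1 hs.2, sub_self, Real.cos_zero]
  have e3 : ∫ s in s₂..L, Real.cos (cscAngle κ ν ε₁ ε₂ s₁ s₂ s - ν) =
      ∫ s in s₂..L, Real.cos (-κ * s₂ + κ * s) := by
    refine intervalIntegral.integral_congr fun s hs => ?_
    rw [uIcc_of_le h2] at hs
    simp only [cscAngle_of_right_le h12 hs.1, add_sub_cancel_left, cos_mul_eq_of_abs_eq_one hε₂]
    ring_nf
  rw [e1, e2, e3, integral_cos_affine _ _ _ _ (neg_ne_zero.2 hκ.ne'),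
    integral_cos_affine _ _ _ _ hκ.ne', intervalIntegral.integral_const]
  rw [show κ * s₁ + -κ * s₁ = 0 by ring, show κ * s₁ + -κ * 0 = κ * s₁ by ring,
    show -κ * s₂ + κ * s₂ = 0 by ring, show -κ * s₂ + κ * L = κ * (L - s₂) by ring, Real.sin_zero]
  simp only [smul_eq_mul, mul_one, zero_sub, sub_zero, neg_div_neg_eq]

/-- As s₁ ≤ s₂, the two ramps are never active at the same time, so their rates of change do not add
up. -/
theorem abs_cscAngle_sub_le (hκ : 0 < κ) (hε₁ : |ε₁| = 1) (hε₂ : |ε₂| = 1) (h12 : s₁ ≤ s₂)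
    {x y : ℝ} (hxy : x ≤ y) :
    |cscAngle κ ν ε₁ ε₂ s₁ s₂ y - cscAngle κ ν ε₁ ε₂ s₁ s₂ x| ≤ κ * (y - x) := by
  have h1 : |max 0 (s₁ - y) - max 0 (s₁ - x)| + |max 0 (y - s₂) - max 0 (x - s₂)| ≤ y - x := by
    have e1 : max 0 (s₁ - y) ≤ max 0 (s₁ - x) := by gcongr
    have e2 : max 0 (x - s₂) ≤ max 0 (y - s₂) := by gcongr
    rw [abs_of_nonpos (by linarith), abs_of_nonneg (by linarith)]
    rcases le_total 0 (s₁ - y) with h1 | h1 <;> rcases le_total 0 (y - s₂) with h2 | h2 <;>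
    rcases le_total 0 (s₁ - x) with h3 | h3 <;> rcases le_total 0 (x - s₂) with h4 | h4 <;>
    simp only [max_eq_left, max_eq_right, h1, h2, h3, h4] <;> linarith
  have e : cscAngle κ ν ε₁ ε₂ s₁ s₂ y - cscAngle κ ν ε₁ ε₂ s₁ s₂ x =
      ε₁ * (κ * (max 0 (s₁ - y) - max 0 (s₁ - x))) +
      ε₂ * (κ * (max 0 (y - s₂) - max 0 (x - s₂))) := by
    unfold cscAngle
    ring
  rw [e]
  refine (abs_add_le _ _).trans ?_
  rw [abs_mul, abs_mul, abs_mul, abs_mul, hε₁, hε₂, abs_of_pos hκ, one_mul, one_mul, ← mul_add]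
  exact mul_le_mul_of_nonneg_left h1 hκ.le

end cscAngle

/-- The curve consists of an arc of a circle of curvature `±κ`, a segment of direction `ν` and
another arc of a circle of curvature `±κ`, both arcs being of angle less than `π`. -/
structure RegularCurve.IsCSC (γ : RegularCurve) (κ ν ε₁ ε₂ s₁ s₂ : ℝ) : Prop where
  abs_eq₁ : |ε₁| = 1
  abs_eq₂ : |ε₂| = 1
  nonneg : 0 ≤ s₁
  le : s₁ ≤ s₂
  le_length : s₂ ≤ γ.length
  left_lt : κ * s₁ < Real.pi
  right_lt : κ * (γ.length - s₂) < Real.pi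
  angle_eq : ∀ t ∈ Icc (0 : ℝ) 1, γ.angle t = cscAngle κ ν ε₁ ε₂ s₁ s₂ (γ.arcLength t)

/-! ### Minimality of arc–segment–arc curves -/

namespace CurveSpace

variable {κ₀ : ℝ} {q : ℂ} {z : Circle}

/-- The displacement in direction `ν` depends only on the end point, hence is the same for every
competitor. -/
theorem integral_speed_mul_cos (γ : CurveSpace (-κ₀) κ₀ originFrame (q, z)) (ν : ℝ) :
    ∫ t in (0 : ℝ)..1, γ.1.speed t * Real.cos (γ.1.angle t - ν) =
      (Complex.exp (-ν * Complex.I) * q).re := by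
  have hc : ContinuousOn (fun t => (γ.1.speed t • Complex.exp (γ.1.angle t * Complex.I) : ℂ))
      (Icc 0 1) := γ.1.continuousOn_velocity.congr fun t ht => (γ.velocity_eq ht).symm
  have h1 := γ.path_eq (t := 1) (by simp)
  rw [γ.2.2.1.1] at h1
  change q = _ at h1
  refine Eq.trans ?_ (congrArg (fun p => (Complex.exp (-ν * Complex.I) * p).re) h1.symm)
  simp only
  rw [← intervalIntegral.integral_const_mul]
  have h2 : ∀ f : ℝ → ℂ, IntervalIntegrable f volume 0 1 →
      (∫ t in (0 : ℝ)..1, f t).re = ∫ t in (0 : ℝ)..1, (f t).re := fun f hf =>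
    (Complex.reCLM.intervalIntegral_comp_comm hf).symm
  rw [h2 _ ((intervalIntegrable_unit hc (by simp) (by simp)).const_mul _)]
  refine intervalIntegral.integral_congr fun t _ => ?_
  have e : Complex.exp (-ν * Complex.I) * (γ.1.speed t • Complex.exp (γ.1.angle t * Complex.I)) =
      (γ.1.speed t : ℂ) * Complex.exp (((γ.1.angle t - ν : ℝ) : ℂ) * Complex.I) := by
    rw [Complex.real_smul, mul_left_comm, ← Complex.exp_add]
    push_cast
    ring_nf
  simp only [e]
  rw [Complex.re_ofReal_mul, Complex.exp_ofReal_mul_I_re]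

theorem arcLength_mem (γ : RegularCurve) {t : ℝ} (ht : t ∈ Icc (0 : ℝ) 1) :
    0 ≤ γ.arcLength t ∧ γ.arcLength t ≤ γ.length := by
  have h0 : γ.arcLength 0 = 0 := intervalIntegral.integral_same
  have hm := γ.strictMonoOn_arcLength.monotoneOn
  exact ⟨h0 ▸ hm (by simp) ht ht.1, hm ht (by simp) ht.2⟩

theorem integral_speed_mul_comp (γ : RegularCurve) {F : ℝ → ℝ} (hF : Continuous F) :
    ∫ t in (0 : ℝ)..1, γ.speed t * F (γ.arcLength t) = ∫ s in (0 : ℝ)..γ.length, F s := by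
  have h := integral_smul_comp_unit γ.continuousOn_speed hF (a := 0) (b := 1) (by simp) (by simp)
  rw [intervalIntegral.integral_same] at h
  exact h

theorem continuousOn_arcLength (γ : RegularCurve) : ContinuousOn γ.arcLength (Icc 0 1) :=
  (IsLip.integral γ.continuousOn_speed).continuousOn

theorem integral_speed_cos_le (γ : RegularCurve) {ν : ℝ} {F : ℝ → ℝ} (hF : Continuous F)
    (h : ∀ t ∈ Icc (0 : ℝ) 1, Real.cos (γ.angle t - ν) ≤ F (γ.arcLength t)) :
    ∫ t in (0 : ℝ)..1, γ.speed t * Real.cos (γ.angle t - ν) ≤ ∫ s in (0 : ℝ)..γ.length, F s := by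
  rw [← integral_speed_mul_comp γ hF]
  refine intervalIntegral.integral_mono_on zero_le_one
    (intervalIntegrable_unit (γ.continuousOn_speed.mul (Real.continuous_cos.comp_continuousOn
      (γ.continuousOn_angle.sub continuousOn_const))) (by simp) (by simp))
    (intervalIntegrable_unit (γ.continuousOn_speed.mul
      (hF.comp_continuousOn (continuousOn_arcLength γ))) (by simp) (by simp)) fun t ht => ?_
  exact mul_le_mul_of_nonneg_left (h t ht) (γ.speed_pos ht).le

theorem eq_of_integral_speed_cos_eq (γ : RegularCurve) {ν : ℝ} {F : ℝ → ℝ} (hF : Continuous F)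
    (h : ∀ t ∈ Icc (0 : ℝ) 1, Real.cos (γ.angle t - ν) ≤ F (γ.arcLength t))
    (heq : ∫ t in (0 : ℝ)..1, γ.speed t * Real.cos (γ.angle t - ν) =
      ∫ s in (0 : ℝ)..γ.length, F s) :
    ∀ t ∈ Icc (0 : ℝ) 1, Real.cos (γ.angle t - ν) = F (γ.arcLength t) := by
  rw [← integral_speed_mul_comp γ hF] at heq
  by_contra! hne
  obtain ⟨t, ht, hne⟩ := hne
  refine heq.not_lt (intervalIntegral.integral_lt_integral_of_continuousOn_of_le_of_exists_lt
    zero_lt_one (γ.continuousOn_speed.mul (Real.continuous_cos.comp_continuousOn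
      (γ.continuousOn_angle.sub continuousOn_const)))
    (γ.continuousOn_speed.mul (hF.comp_continuousOn (continuousOn_arcLength γ))) (fun s hs => ?_)
    ⟨t, ht, ?_⟩)
  · have hs' := Ioc_subset_Icc_self hs
    exact mul_le_mul_of_nonneg_left (h s hs') (γ.speed_pos hs').le
  · exact mul_lt_mul_of_pos_left (lt_of_le_of_ne (h t ht) hne) (γ.speed_pos ht)

theorem exists_angle_one_eq (γ ζ : CurveSpace (-κ₀) κ₀ originFrame (q, z)) :
    ∃ n : ℤ, ζ.1.angle 1 = γ.1.angle 1 + n * (2 * Real.pi) := by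
  have h1 := (γ.1.isArgument_angle γ.unitTangent_zero).2 1 (by simp)
  have h2 := (ζ.1.isArgument_angle ζ.unitTangent_zero).2 1 (by simp)
  rw [γ.2.2.1.2] at h1
  rw [ζ.2.2.1.2] at h2
  obtain ⟨n, hn⟩ := Complex.exp_eq_exp_iff_exists_int.1 (h2.symm.trans h1)
  refine ⟨n, ?_⟩
  have := congrArg Complex.im hn
  simpa using this

section minimal

variable {γ ζ : CurveSpace (-κ₀) κ₀ originFrame (q, z)} {ν ε₁ ε₂ s₁ s₂ : ℝ}

/-- The initial angle 0 forces ν = -ε₁κ₀s₁, so the left side is |angle t|. The curvature bound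
limits the turning made so far. -/
theorem csc_left_angle (hγ : γ.1.IsCSC κ₀ ν ε₁ ε₂ s₁ s₂) {t : ℝ} (ht : t ∈ Icc (0 : ℝ) 1) :
    |ε₁ * (ζ.1.angle t - ν) - κ₀ * s₁| ≤ κ₀ * ζ.1.arcLength t := by
  have h0 := hγ.angle_eq 0 (by simp)
  have ha0 : γ.1.arcLength 0 = 0 := intervalIntegral.integral_same
  rw [ha0, cscAngle_of_le_left hγ.le hγ.nonneg, γ.1.angle_zero] at h0
  have hz := ζ.abs_angle_sub_le (a := 0) (by simp) ht ht.1
  rw [ζ.1.angle_zero, sub_zero] at hz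
  have hε := mul_self_eq_one_of_abs_eq_one hγ.abs_eq₁
  have e : ε₁ * (ζ.1.angle t - ν) - κ₀ * s₁ = ε₁ * ζ.1.angle t := by
    have : ν = -(ε₁ * (κ₀ * s₁)) := by linarith
    rw [this]
    linear_combination (κ₀ * s₁) * hε
  rw [e, abs_mul, hγ.abs_eq₁, one_mul]
  exact hz

/-- The same estimate read backwards from the end. Final angles agree only modulo 2π, since the
competitor may have another total turning; the integer `n` absorbs the difference, and the cosine
ignores it. -/
theorem csc_right_angle (hγ : γ.1.IsCSC κ₀ ν ε₁ ε₂ s₁ s₂) : ∃ n : ℤ, ∀ t ∈ Icc (0 : ℝ) 1,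
    |ε₂ * (ζ.1.angle t - n * (2 * Real.pi) - ν) - κ₀ * (γ.1.length - s₂)| ≤
      κ₀ * (ζ.1.length - ζ.1.arcLength t) := by
  obtain ⟨n, hn⟩ := exists_angle_one_eq γ ζ
  refine ⟨n, fun t ht => ?_⟩
  have h1 : γ.1.angle 1 = _ := hγ.angle_eq 1 (by simp)
  have ha1 : γ.1.arcLength 1 = γ.1.length := rfl
  rw [ha1, cscAngle_of_right_le hγ.le hγ.le_length] at h1
  have hz := ζ.abs_angle_sub_le (b := 1) ht (by simp) ht.2
  rw [← ζ.1.arcLength_sub_eq ht (by simp), hn, h1] at hz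
  have hε := mul_self_eq_one_of_abs_eq_one hγ.abs_eq₂
  have e : ε₂ * (ζ.1.angle t - n * (2 * Real.pi) - ν) - κ₀ * (γ.1.length - s₂) =
      -(ε₂ * (ν + ε₂ * (κ₀ * (γ.1.length - s₂)) + n * (2 * Real.pi) - ζ.1.angle t)) := by
    linear_combination (κ₀ * (γ.1.length - s₂)) * hε
  rw [e, abs_neg, abs_mul, hγ.abs_eq₂, one_mul]
  exact hz

theorem cos_le_left (hγ : γ.1.IsCSC κ₀ ν ε₁ ε₂ s₁ s₂) {t : ℝ} (ht : t ∈ Icc (0 : ℝ) 1)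
    (h : 0 ≤ κ₀ * (s₁ - ζ.1.arcLength t)) :
    Real.cos (ζ.1.angle t - ν) ≤ Real.cos (κ₀ * (s₁ - ζ.1.arcLength t)) := by
  rw [← cos_mul_eq_of_abs_eq_one hγ.abs_eq₁]
  refine cos_le_cos_of_abs_sub_le h hγ.left_lt ((csc_left_angle hγ ht).trans_eq ?_)
  ring

theorem cos_le_right (hγ : γ.1.IsCSC κ₀ ν ε₁ ε₂ s₁ s₂) {t : ℝ} (ht : t ∈ Icc (0 : ℝ) 1)
    (h : 0 ≤ κ₀ * (γ.1.length - s₂ - (ζ.1.length - ζ.1.arcLength t))) :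
    Real.cos (ζ.1.angle t - ν) ≤
      Real.cos (κ₀ * (γ.1.length - s₂ - (ζ.1.length - ζ.1.arcLength t))) := by
  obtain ⟨n, hn⟩ := csc_right_angle (ζ := ζ) hγ
  have e : Real.cos (ζ.1.angle t - ν) =
      Real.cos (ε₂ * (ζ.1.angle t - n * (2 * Real.pi) - ν)) := by
    rw [cos_mul_eq_of_abs_eq_one hγ.abs_eq₂, sub_right_comm, Real.cos_sub_int_mul_two_pi]
  rw [e]
  refine cos_le_cos_of_abs_sub_le h hγ.right_lt ((hn t ht).trans_eq ?_)
  ring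

/-- The comparison profile keeps both arcs and adjusts the length of the segment to the length of
the competitor. On each arc it advances along `ν` at the fastest rate permitted by the curvature
bound from the nearest end, and on the segment at full speed. -/
theorem cos_le_cscAngle (hκ : 0 < κ₀) (hγ : γ.1.IsCSC κ₀ ν ε₁ ε₂ s₁ s₂)
    (hle : s₁ ≤ ζ.1.length - (γ.1.length - s₂)) {t : ℝ} (ht : t ∈ Icc (0 : ℝ) 1) :
    Real.cos (ζ.1.angle t - ν) ≤
      Real.cos (cscAngle κ₀ ν ε₁ ε₂ s₁ (ζ.1.length - (γ.1.length - s₂)) (ζ.1.arcLength t) - ν) := by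
  rcases le_total (ζ.1.arcLength t) s₁ with h1 | h1
  · rw [cscAngle_of_le_left hle h1, add_sub_cancel_left, cos_mul_eq_of_abs_eq_one hγ.abs_eq₁]
    exact cos_le_left hγ ht (mul_nonneg hκ.le (sub_nonneg.2 h1))
  · rcases le_total (ζ.1.arcLength t) (ζ.1.length - (γ.1.length - s₂)) with h2 | h2
    · rw [cscAngle_of_mem h1 h2, sub_self, Real.cos_zero]
      exact Real.cos_le_one _
    · rw [cscAngle_of_right_le hle h2, add_sub_cancel_left, cos_mul_eq_of_abs_eq_one hγ.abs_eq₂]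
      have e : ζ.1.arcLength t - (ζ.1.length - (γ.1.length - s₂)) =
        γ.1.length - s₂ - (ζ.1.length - ζ.1.arcLength t) := by ring
      rw [e]
      exact cos_le_right hγ ht (mul_nonneg hκ.le (by linarith))

theorem integral_csc (hκ : 0 < κ₀) (hγ : γ.1.IsCSC κ₀ ν ε₁ ε₂ s₁ s₂) :
    ∫ t in (0 : ℝ)..1, ζ.1.speed t * Real.cos (ζ.1.angle t - ν) =
      Real.sin (κ₀ * s₁) / κ₀ + (s₂ - s₁) + Real.sin (κ₀ * (γ.1.length - s₂)) / κ₀ := by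
  rw [ζ.integral_speed_mul_cos, ← γ.integral_speed_mul_cos,
    ← integral_cos_cscAngle (ν := ν) hκ hγ.abs_eq₁ hγ.abs_eq₂ hγ.nonneg hγ.le hγ.le_length,
    ← integral_speed_mul_comp γ.1 (continuous_cos_cscAngle κ₀ ν ε₁ ε₂ s₁ s₂)]
  refine intervalIntegral.integral_congr fun t ht => ?_
  simp only [hγ.angle_eq t (uIcc_subset_Icc (by simp) (by simp) ht)]

/-- A shorter competitor could not leave the sector of the first arc: its end direction would still
make an angle larger than κ₀(L - s₂) with `ν`, contrary to the prescribed end direction. -/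
theorem sub_le_length_left (hκ : 0 < κ₀) (hγ : γ.1.IsCSC κ₀ ν ε₁ ε₂ s₁ s₂) :
    s₁ - (γ.1.length - s₂) ≤ ζ.1.length := by
  by_contra! hlt
  have hb : 0 ≤ γ.1.length - s₂ := sub_nonneg.2 hγ.le_length
  have ha1 : ζ.1.arcLength 1 = ζ.1.length := rfl
  have h1 := cos_le_left (ζ := ζ) hγ (t := 1) (by simp)
    (mul_nonneg hκ.le (by rw [ha1]; linarith))
  obtain ⟨n, hn⟩ := csc_right_angle (ζ := ζ) hγ
  have h2 := hn 1 (by simp)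
  rw [ha1, sub_self, mul_zero] at h2
  have h3 := sub_eq_zero.1 (abs_nonpos_iff.1 h2)
  have e : Real.cos (ζ.1.angle 1 - ν) = Real.cos (κ₀ * (γ.1.length - s₂)) := by
    rw [← h3, cos_mul_eq_of_abs_eq_one hγ.abs_eq₂, sub_right_comm, Real.cos_sub_int_mul_two_pi]
  rw [e, ha1] at h1
  refine h1.not_gt (Real.cos_lt_cos_of_nonneg_of_le_pi (mul_nonneg hκ.le hb) ?_ ?_)
  · have := mul_nonneg hκ.le (arcLength_mem ζ.1 (t := 1) (by simp)).1
    rw [ha1] at this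
    linarith [hγ.left_lt]
  · exact mul_lt_mul_of_pos_left (by linarith) hκ

theorem sub_le_length_right (hκ : 0 < κ₀) (hγ : γ.1.IsCSC κ₀ ν ε₁ ε₂ s₁ s₂) :
    (γ.1.length - s₂) - s₁ ≤ ζ.1.length := by
  by_contra! hlt
  have ha0 : ζ.1.arcLength 0 = 0 := intervalIntegral.integral_same
  have hs := hγ.nonneg
  have h1 := cos_le_right (ζ := ζ) hγ (t := 0) (by simp)
    (mul_nonneg hκ.le (by rw [ha0]; linarith))
  have h2 := csc_left_angle (ζ := ζ) hγ (t := 0) (by simp)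
  rw [ha0, mul_zero] at h2
  have h3 := sub_eq_zero.1 (abs_nonpos_iff.1 h2)
  have e : Real.cos (ζ.1.angle 0 - ν) = Real.cos (κ₀ * s₁) := by
    rw [← h3, cos_mul_eq_of_abs_eq_one hγ.abs_eq₁]
  rw [e, ha0, sub_zero] at h1
  refine h1.not_gt (Real.cos_lt_cos_of_nonneg_of_le_pi (mul_nonneg hκ.le hs) ?_ ?_)
  · have := mul_nonneg hκ.le (arcLength_mem ζ.1 (t := 1) (by simp)).1
    have ha1 : ζ.1.arcLength 1 = ζ.1.length := rfl
    rw [ha1] at this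
    linarith [hγ.right_lt]
  · exact mul_lt_mul_of_pos_left (by linarith) hκ

/-- The two arcs must fit into the competitor without overlap. If they overlapped, the bounds from
the two ends would together cap the displacement along `ν` strictly below what the two complete arcs
already provide. -/
theorem le_length_of_isCSC (hκ : 0 < κ₀) (hγ : γ.1.IsCSC κ₀ ν ε₁ ε₂ s₁ s₂)
    (ζ : CurveSpace (-κ₀) κ₀ originFrame (q, z)) : s₁ ≤ ζ.1.length - (γ.1.length - s₂) := by
  by_contra! hlt
  have hl := sub_le_length_left (ζ := ζ) hκ hγ
  have hr := sub_le_length_right (ζ := ζ) hκ hγ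
  set b := γ.1.length - s₂ with hb
  set ℓ := ζ.1.length with hℓ
  -- The arc length at which the bounds from the two ends cross; `hl` and `hr` place it in [0, ℓ].
  set m := (ℓ + s₁ - b) / 2 with hm
  have hb0 : 0 ≤ b := sub_nonneg.2 hγ.le_length
  let F : ℝ → ℝ := fun s => Real.cos (max (κ₀ * (s₁ - s)) (κ₀ * (b - (ℓ - s))))
  have hF : Continuous F := by fun_prop
  have hFl : ∀ s, s ≤ m → F s = Real.cos (κ₀ * s₁ + -κ₀ * s) := fun s hs => by
    have : κ₀ * (b - (ℓ - s)) ≤ κ₀ * (s₁ - s) :=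
      mul_le_mul_of_nonneg_left (by linarith) hκ.le
    simp only [F, max_eq_left this]
    ring_nf
  have hFr : ∀ s, m ≤ s → F s = Real.cos (κ₀ * (b - ℓ) + κ₀ * s) := fun s hs => by
    have : κ₀ * (s₁ - s) ≤ κ₀ * (b - (ℓ - s)) :=
      mul_le_mul_of_nonneg_left (by linarith) hκ.le
    simp only [F, max_eq_right this]
    ring_nf
  have hle := integral_speed_cos_le ζ.1 (ν := ν) hF fun t ht => by
    rcases le_total (ζ.1.arcLength t) m with h | h
    · rw [hFl _ h]
      refine (cos_le_left hγ ht (mul_nonneg hκ.le (by linarith))).trans_eq ?_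
      ring_nf
    · rw [hFr _ h]
      refine (cos_le_right hγ ht (mul_nonneg hκ.le (by linarith))).trans_eq ?_
      rw [← hb, ← hℓ]
      ring_nf
  rw [integral_csc hκ hγ, ← intervalIntegral.integral_add_adjacent_intervals
    (hF.intervalIntegrable 0 m) (hF.intervalIntegrable m ζ.1.length)] at hle
  have e1 : ∫ s in (0 : ℝ)..m, F s = ∫ s in (0 : ℝ)..m, Real.cos (κ₀ * s₁ + -κ₀ * s) :=
    intervalIntegral.integral_congr fun s hs => by
      rw [uIcc_of_le (by linarith)] at hs
      exact hFl s hs.2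
  have e2 : ∫ s in m..ℓ, F s = ∫ s in m..ℓ, Real.cos (κ₀ * (b - ℓ) + κ₀ * s) :=
    intervalIntegral.integral_congr fun s hs => by
      rw [uIcc_of_le (by linarith)] at hs
      exact hFr s hs.1
  rw [e1, ← hℓ, e2, integral_cos_affine _ _ _ _ (neg_ne_zero.2 hκ.ne'),
    integral_cos_affine _ _ _ _ hκ.ne', ← hb,
    show κ₀ * (b - ℓ) + κ₀ * ℓ = κ₀ * b by ring,
    show κ₀ * (b - ℓ) + κ₀ * m = κ₀ * s₁ + -κ₀ * m by rw [hm]; ring,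
    show κ₀ * s₁ + -κ₀ * 0 = κ₀ * s₁ by ring] at hle
  -- At the crossing, the angle still to be turned lies in (0, π). The missing displacement is twice
  -- this sine divided by κ₀.
  have hsin : 0 < Real.sin (κ₀ * s₁ + -κ₀ * m) := by
    have e : κ₀ * s₁ + -κ₀ * m = κ₀ * ((s₁ + b - ℓ) / 2) := by rw [hm]; ring
    have e' : κ₀ * s₁ + -κ₀ * m ≤ κ₀ * s₁ := by
      have : 0 ≤ κ₀ * m := mul_nonneg hκ.le (by linarith)
      linarith
    refine Real.sin_pos_of_pos_of_lt_pi ?_ (e'.trans_lt hγ.left_lt)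
    rw [e]
    exact mul_pos hκ (by linarith)
  have hdiv := div_pos hsin hκ
  rw [div_neg, sub_div, sub_div] at hle
  linarith [hγ.le]

/-- Displacements agree, and the arcs contribute the same amounts to both sides. The segment of the
comparison profile must therefore be at least as long as that of `γ`. -/
theorem length_le_of_isCSC (hκ : 0 < κ₀) (hγ : γ.1.IsCSC κ₀ ν ε₁ ε₂ s₁ s₂)
    (ζ : CurveSpace (-κ₀) κ₀ originFrame (q, z)) : γ.1.length ≤ ζ.1.length := by
  have hle := le_length_of_isCSC hκ hγ ζ
  have hb0 : 0 ≤ γ.1.length - s₂ := sub_nonneg.2 hγ.le_length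
  have h := integral_speed_cos_le ζ.1 (ν := ν) (continuous_cos_cscAngle κ₀ ν ε₁ ε₂ s₁
    (ζ.1.length - (γ.1.length - s₂))) fun t ht => cos_le_cscAngle hκ hγ hle ht
  rw [integral_csc hκ hγ, integral_cos_cscAngle hκ hγ.abs_eq₁ hγ.abs_eq₂ hγ.nonneg hle
    (by linarith), sub_sub_cancel] at h
  linarith

/-- Equality of lengths turns the integrated comparison into an equality, so the cosines agree at
every point. The one-sided angle bounds on the arcs then select the right solution; on the segment
cosine 1 determines the angle modulo 2π. -/
theorem exp_angle_eq_of_length_eq (hκ : 0 < κ₀) (hγ : γ.1.IsCSC κ₀ ν ε₁ ε₂ s₁ s₂)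
    (hl : ζ.1.length = γ.1.length) {t : ℝ} (ht : t ∈ Icc (0 : ℝ) 1) :
    Complex.exp (ζ.1.angle t * Complex.I) =
      Complex.exp (cscAngle κ₀ ν ε₁ ε₂ s₁ s₂ (ζ.1.arcLength t) * Complex.I) := by
  have hle := le_length_of_isCSC hκ hγ ζ
  have hF := continuous_cos_cscAngle κ₀ ν ε₁ ε₂ s₁ s₂
  have h := eq_of_integral_speed_cos_eq ζ.1 (ν := ν) hF
    (fun t ht => by simpa [hl] using cos_le_cscAngle hκ hγ hle ht) (by
      rw [integral_csc hκ hγ, hl,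
        integral_cos_cscAngle hκ hγ.abs_eq₁ hγ.abs_eq₂ hγ.nonneg hγ.le hγ.le_length]) t ht
  have hmod : ∀ x y : ℝ, (∃ n : ℤ, x = y + n * (2 * Real.pi)) →
      Complex.exp (x * Complex.I) = Complex.exp (y * Complex.I) := by
    rintro x y ⟨n, rfl⟩
    refine Complex.exp_eq_exp_iff_exists_int.2 ⟨n, ?_⟩
    push_cast
    ring
  refine hmod _ _ ?_
  rcases le_total (ζ.1.arcLength t) s₁ with h1 | h1
  · rw [cscAngle_of_le_left hγ.le h1] at h ⊢
    rw [add_sub_cancel_left, cos_mul_eq_of_abs_eq_one hγ.abs_eq₁,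
      ← cos_mul_eq_of_abs_eq_one hγ.abs_eq₁ (ζ.1.angle t - ν)] at h
    have h2 := eq_of_cos_eq_cos_of_abs_sub_le (mul_nonneg hκ.le (sub_nonneg.2 h1)) hγ.left_lt
      ((csc_left_angle hγ ht).trans_eq (by ring)) h
    refine ⟨0, ?_⟩
    rw [← h2]
    push_cast
    linear_combination (-(ζ.1.angle t - ν)) * mul_self_eq_one_of_abs_eq_one hγ.abs_eq₁
  · rcases le_total (ζ.1.arcLength t) s₂ with h2 | h2
    · rw [cscAngle_of_mem h1 h2] at h ⊢
      rw [sub_self, Real.cos_zero] at h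
      obtain ⟨n, hn⟩ := (Real.cos_eq_one_iff _).1 h
      exact ⟨n, by linarith⟩
    · rw [cscAngle_of_right_le hγ.le h2] at h ⊢
      obtain ⟨n, hn⟩ := csc_right_angle (ζ := ζ) hγ
      have e : Real.cos (ζ.1.angle t - ν) =
          Real.cos (ε₂ * (ζ.1.angle t - n * (2 * Real.pi) - ν)) := by
        rw [cos_mul_eq_of_abs_eq_one hγ.abs_eq₂, sub_right_comm, Real.cos_sub_int_mul_two_pi]
      rw [e, add_sub_cancel_left, cos_mul_eq_of_abs_eq_one hγ.abs_eq₂ (κ₀ * _)] at h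
      have h3 := eq_of_cos_eq_cos_of_abs_sub_le (mul_nonneg hκ.le (sub_nonneg.2 h2)) hγ.right_lt
        ((hn t ht).trans_eq (by rw [hl]; ring)) h
      refine ⟨n, ?_⟩
      rw [← h3]
      linear_combination (-(ζ.1.angle t - n * (2 * Real.pi) - ν)) *
        mul_self_eq_one_of_abs_eq_one hγ.abs_eq₂

end minimal

end CurveSpace

/-! ### Full truncation produces an arc, a segment and an arc -/

/-- `p` and `r` are the changes allowed since the near end and until the far end. As `lam` is within
r' ≤ r of the far value, that constraint is inactive, and only the line from the near end towards
`lam` remains. -/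
theorem max_min_level_eq {g₀ g₁ p r r' lam ε : ℝ} (hr : r' ≤ r)
    (h0 : g₀ - p ≤ g₁ + r) (h0' : g₁ - r ≤ g₀ + p) (hp0 : 0 ≤ p)
    (h1 : g₁ - r' ≤ lam) (h2 : lam ≤ g₁ + r') (hε : |ε| = 1) (hsign : 0 ≤ ε * (g₀ - lam)) :
    max (max (g₀ - p) (g₁ - r)) (min lam (min (g₀ + p) (g₁ + r))) =
      lam + ε * max 0 (ε * (g₀ - lam) - p) := by
  have e1 : max (g₀ - p) (g₁ - r) ≤ min (g₀ + p) (g₁ + r) :=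
    max_le (le_min (by linarith) h0) (le_min h0' (by linarith))
  rcases eq_or_eq_neg_of_abs_eq hε with rfl | rfl
  · rw [one_mul] at hsign
    rw [min_eq_left (le_min (by linarith) (by linarith)), one_mul, one_mul, max_assoc,
      max_eq_right (by linarith : g₁ - r ≤ lam), max_comm, ← max_add_add_left]
    congr 1 <;> ring
  · rw [neg_one_mul] at hsign
    rw [max_eq_right (le_min (max_le (by linarith) (by linarith)) e1), ← min_assoc,
      min_eq_left (b := g₁ + r) ((min_le_left _ _).trans (by linarith)), neg_one_mul, neg_one_mul,
      ← min_neg_neg, ← min_add_add_left]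
    congr 1 <;> ring

theorem exists_abs_eq_one_mul_nonneg (x : ℝ) : ∃ ε : ℝ, |ε| = 1 ∧ ε * x = |x| := by
  rcases le_total 0 x with h | h
  · exact ⟨1, by simp, by rw [abs_of_nonneg h, one_mul]⟩
  · exact ⟨-1, by simp, by rw [abs_of_nonpos h, neg_one_mul]⟩

/-- A level lying wholly above or below the band can be moved to an extremum of the nearest envelope
without changing the clamped function. The new level is reachable at some point, so the middle piece
is never empty, though it may be a single point. -/
theorem exists_level_mem {l u : ℝ → ℝ} (hl : ContinuousOn l (Icc 0 1))
    (hu : ContinuousOn u (Icc 0 1)) (hlu : ∀ t ∈ Icc (0 : ℝ) 1, l t ≤ u t) (lam₀ : ℝ) :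
    ∃ lam, ∃ s ∈ Icc (0 : ℝ) 1, l s ≤ lam ∧ lam ≤ u s ∧
      ∀ t ∈ Icc (0 : ℝ) 1, max (l t) (min lam₀ (u t)) = max (l t) (min lam (u t)) := by
  have hne : (Icc (0 : ℝ) 1).Nonempty := nonempty_Icc.2 zero_le_one
  by_cases hall : ∀ t ∈ Icc (0 : ℝ) 1, u t < lam₀
  · obtain ⟨s, hs, hmax⟩ := isCompact_Icc.exists_isMaxOn hne hu
    refine ⟨u s, s, hs, hlu s hs, le_rfl, fun t ht => ?_⟩
    rw [min_eq_right (hall t ht).le, min_eq_right (hmax ht)]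
  by_cases hall' : ∀ t ∈ Icc (0 : ℝ) 1, lam₀ < l t
  · obtain ⟨s, hs, hmin⟩ := isCompact_Icc.exists_isMinOn hne hl
    refine ⟨l s, s, hs, le_rfl, hlu s hs, fun t ht => ?_⟩
    have h1 : l s ≤ l t := hmin ht
    rw [min_eq_left ((hall' t ht).le.trans (hlu t ht)), min_eq_left (h1.trans (hlu t ht)),
      max_eq_left (hall' t ht).le, max_eq_left h1]
  push Not at hall hall'
  obtain ⟨a, ha, ha'⟩ := hall
  obtain ⟨b, hb, hb'⟩ := hall'
  have hc : ContinuousOn (fun t => max (l t) (min lam₀ (u t))) (Icc 0 1) := by fun_prop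
  obtain ⟨s, hs, heq⟩ := isPreconnected_Icc.intermediate_value hb ha hc
    (show lam₀ ∈ Icc _ _ from ⟨max_le hb' (min_le_left _ _),
      le_max_of_le_right (le_min le_rfl ha')⟩)
  simp only at heq
  have h1 : l s ≤ lam₀ := heq ▸ le_max_left _ _
  have h2 : lam₀ ≤ u s := by
    rw [← heq]
    exact max_le (hlu s hs) (min_le_right _ _)
  exact ⟨lam₀, s, hs, h1, h2, fun _ _ => rfl⟩

namespace RegularCurve

/-- Where the sine is affine in the abscissa, the curvature is its constant slope σ, so the angle is
affine in arc length with the same slope. -/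
theorem graphAngle_sub_eq {γ : RegularCurve} {κ₀ : ℝ} (hκ : 0 < κ₀) (hγ : γ.IsCondensed)
    {f : ℝ → ℝ} (hf : γ.IsAdmissible κ₀ f) {a b m σ : ℝ} (ha : a ∈ Icc (0 : ℝ) 1)
    (hb : b ∈ Icc (0 : ℝ) 1) (hab : a ≤ b)
    (h : ∀ t ∈ Icc a b, f t = m + σ * γ.abscissa t) :
    γ.graphAngle f b - γ.graphAngle f a = σ * ((∫ τ in (0 : ℝ)..b, γ.graphSpeed f τ) -
      ∫ τ in (0 : ℝ)..a, γ.graphSpeed f τ) := by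
  have hc := hf.continuousOn_graphSpeed hκ hγ
  have hF := (hf.isLip_graphAngle hκ hγ).add ((IsLip.integral hc).const_mul (-σ))
  have key := eq_of_deriv_eq_zero hF ha hb hab fun t ht => by
    have ht' : t ∈ Ioo (0 : ℝ) 1 := ⟨ha.1.trans_lt ht.1, ht.2.trans_le hb.2⟩
    have ht'' := Ioo_subset_Icc_self ht'
    have hd : HasDerivAt f (σ * γ.axialSpeed t) t := by
      refine (((hasDerivAt_integral_unit γ.continuousOn_axialSpeed ht').const_mul
        σ).const_add m).congr_of_eventuallyEq ?_
      filter_upwards [Icc_mem_nhds ht.1 ht.2] with s hs using h s hs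
    have h1 := hf.deriv_graphAngle hγ ht'' hd.differentiableAt
    have hs := (hf.sqrt_pos hγ ht'').ne'
    have h2 : DifferentiableAt ℝ (γ.graphAngle f) t := by
      have h3 := _root_.abs_le.1 (hf.abs_le t ht'')
      have h4 := maxSine_lt_one hγ
      exact ((Real.hasDerivAt_arcsin (x := f t) (by linarith) (by linarith)).comp t
        hd).differentiableAt.const_add γ.midAngle
    have h3 := (hasDerivAt_integral_unit hc ht').const_mul (-σ)
    rw [deriv_fun_add h2 h3.differentiableAt, h1, h3.deriv, hd.deriv, graphSpeed]
    field_simp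
    ring
  linarith

theorem lowerEnvelope_eq (γ : RegularCurve) (κ t : ℝ) : γ.lowerEnvelope κ t =
    max (γ.sine 0 - κ * γ.abscissa t) (γ.sine 1 - κ * (γ.abscissa 1 - γ.abscissa t)) := by
  rw [lowerEnvelope]
  congr 1 <;> ring

theorem upperEnvelope_eq (γ : RegularCurve) (κ t : ℝ) : γ.upperEnvelope κ t =
    min (γ.sine 0 + κ * γ.abscissa t) (γ.sine 1 + κ * (γ.abscissa 1 - γ.abscissa t)) := by
  rw [upperEnvelope]
  congr 1
  ring

theorem continuousOn_abscissa (γ : RegularCurve) : ContinuousOn γ.abscissa (Icc 0 1) :=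
  γ.isLip_abscissa.continuousOn

theorem abscissa_mono {γ : RegularCurve} (hγ : γ.IsCondensed) : MonotoneOn γ.abscissa (Icc 0 1) := by
  intro a ha b hb hab
  rw [← sub_nonneg, γ.abscissa_sub ha hb]
  exact intervalIntegral.integral_nonneg hab fun t ht =>
    (axialSpeed_pos hγ ⟨ha.1.trans ht.1, ht.2.trans hb.2⟩).le

theorem truncSine_level_zero (γ : RegularCurve) {κ c : ℝ} (hc : c ∈ Icc (-1 : ℝ) 1) (t : ℝ) :
    γ.truncSine κ c 0 t =
      max (γ.lowerEnvelope κ t) (min (γ.maxSine * c) (γ.upperEnvelope κ t)) := by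
  rw [truncSine, lowLevel, highLevel, sub_zero, add_zero, max_eq_right hc.1, min_eq_right hc.2,
    truncate.eq_level]

section structure_of_truncation

variable {κ₀ : ℝ} {Q : ℂ × Circle} {γ : CurveSpace (-κ₀) κ₀ originFrame Q}

theorem exists_truncSine_form (hκ : 0 < κ₀) (hγ : γ.1.IsCondensed) {c : ℝ}
    (hc : c ∈ Icc (-1 : ℝ) 1) :
    ∃ lam ε₁ ε₂ : ℝ, |ε₁| = 1 ∧ |ε₂| = 1 ∧ ∃ t₁ ∈ Icc (0 : ℝ) 1, ∃ t₂ ∈ Icc (0 : ℝ) 1, t₁ ≤ t₂ ∧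
      (∃ m, ∀ t ∈ Icc 0 t₁, γ.1.truncSine κ₀ c 0 t = m + (-(ε₁ * κ₀)) * γ.1.abscissa t) ∧
      (∀ t ∈ Icc t₁ t₂, γ.1.truncSine κ₀ c 0 t = lam) ∧
      ∃ m, ∀ t ∈ Icc t₂ 1, γ.1.truncSine κ₀ c 0 t = m + (ε₂ * κ₀) * γ.1.abscissa t := by
  have h0 : (0 : ℝ) ∈ Icc (0 : ℝ) 1 := by simp
  have h1 : (1 : ℝ) ∈ Icc (0 : ℝ) 1 := by simp
  set x := γ.1.abscissa with hx
  have hxc : ContinuousOn x (Icc 0 1) := γ.1.continuousOn_abscissa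
  have hxm : MonotoneOn x (Icc 0 1) := abscissa_mono hγ
  have hx0 : x 0 = 0 := γ.1.abscissa_zero
  set g₀ := γ.1.sine 0
  set g₁ := γ.1.sine 1
  have hl : ∀ t, γ.1.lowerEnvelope κ₀ t = max (g₀ - κ₀ * x t) (g₁ - κ₀ * (x 1 - x t)) :=
    γ.1.lowerEnvelope_eq κ₀
  have hu : ∀ t, γ.1.upperEnvelope κ₀ t = min (g₀ + κ₀ * x t) (g₁ + κ₀ * (x 1 - x t)) :=
    γ.1.upperEnvelope_eq κ₀
  have hlu : ∀ t ∈ Icc (0 : ℝ) 1, γ.1.lowerEnvelope κ₀ t ≤ γ.1.upperEnvelope κ₀ t := fun t ht =>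
    (lowerEnvelope_le hκ hγ ht).trans (le_upperEnvelope hκ hγ ht)
  obtain ⟨lam, s, hs, hls, hus, hlev⟩ := exists_level_mem
    (l := γ.1.lowerEnvelope κ₀) (u := γ.1.upperEnvelope κ₀)
    (by simp only [funext hl]; fun_prop) (by simp only [funext hu]; fun_prop) hlu
    (γ.1.maxSine * c)
  have hf : ∀ t ∈ Icc (0 : ℝ) 1, γ.1.truncSine κ₀ c 0 t =
      max (γ.1.lowerEnvelope κ₀ t) (min lam (γ.1.upperEnvelope κ₀ t)) := fun t ht =>
    (γ.1.truncSine_level_zero hc t).trans (hlev t ht)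
  rw [hl] at hls
  rw [hu] at hus
  have hls1 := (le_max_left _ _).trans hls
  have hls2 := (le_max_right _ _).trans hls
  have hus1 := hus.trans (min_le_left _ _)
  have hus2 := hus.trans (min_le_right _ _)
  obtain ⟨ε₁, hε₁, hsg₁⟩ := exists_abs_eq_one_mul_nonneg (g₀ - lam)
  obtain ⟨ε₂, hε₂, hsg₂⟩ := exists_abs_eq_one_mul_nonneg (g₁ - lam)
  have hin : ∀ t ∈ Icc (0 : ℝ) 1, g₀ - κ₀ * x t ≤ g₁ + κ₀ * (x 1 - x t) ∧
      g₁ - κ₀ * (x 1 - x t) ≤ g₀ + κ₀ * x t := fun t ht => by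
    have h := hlu t ht
    rw [hl, hu] at h
    exact ⟨((le_max_left _ _).trans h).trans (min_le_right _ _),
      ((le_max_right _ _).trans h).trans (min_le_left _ _)⟩
  have hleft : ∀ t ∈ Icc 0 s, γ.1.truncSine κ₀ c 0 t =
      lam + ε₁ * max 0 (|g₀ - lam| - κ₀ * x t) := fun t ht => by
    have ht' : t ∈ Icc (0 : ℝ) 1 := ⟨ht.1, ht.2.trans hs.2⟩
    have hle : κ₀ * x t ≤ κ₀ * x s := mul_le_mul_of_nonneg_left (hxm ht' hs ht.2) hκ.le
    rw [hf t ht', hl, hu, ← hsg₁]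
    exact max_min_level_eq (r' := κ₀ * (x 1 - x s)) (by linarith) (hin t ht').1 (hin t ht').2
      (mul_nonneg hκ.le (hx0 ▸ hxm h0 ht' ht.1)) hls2 hus2 hε₁ (hsg₁ ▸ abs_nonneg _)
  have hright : ∀ t ∈ Icc s 1, γ.1.truncSine κ₀ c 0 t =
      lam + ε₂ * max 0 (|g₁ - lam| - κ₀ * (x 1 - x t)) := fun t ht => by
    have ht' : t ∈ Icc (0 : ℝ) 1 := ⟨hs.1.trans ht.1, ht.2⟩
    have hle : κ₀ * x s ≤ κ₀ * x t := mul_le_mul_of_nonneg_left (hxm hs ht' ht.1) hκ.le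
    rw [hf t ht', hl, hu, ← hsg₂, max_comm (g₀ - _), min_comm (g₀ + _)]
    exact max_min_level_eq hle (hin t ht').2 (hin t ht').1
      (mul_nonneg hκ.le (sub_nonneg.2 (hxm ht' h1 ht.2))) hls1 hus1 hε₂ (hsg₂ ▸ abs_nonneg _)
  have hkc : ContinuousOn (fun t => κ₀ * x t) (Icc 0 1) := continuousOn_const.mul hxc
  -- t₁ is where the line of slope ±κ₀ issuing from the initial value reaches `lam`. It comes no
  -- later than `s`, since `lam` lies between the envelopes at `s`.
  obtain ⟨t₁, ht₁, hxt₁⟩ : ∃ t ∈ Icc 0 s, κ₀ * x t = |g₀ - lam| := by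
    refine intermediate_value_Icc (f := fun t => κ₀ * x t) hs.1
      (hkc.mono (Icc_subset_Icc_right hs.2)) ⟨?_, ?_⟩
    · rw [hx0, mul_zero]
      exact abs_nonneg _
    · exact abs_le.2 ⟨by linarith, by linarith⟩
  obtain ⟨t₂, ht₂, hxt₂⟩ : ∃ t ∈ Icc s 1, κ₀ * x t = κ₀ * x 1 - |g₁ - lam| := by
    refine intermediate_value_Icc (f := fun t => κ₀ * x t) hs.2
      (hkc.mono (Icc_subset_Icc_left hs.1)) ⟨?_, ?_⟩
    · have : |g₁ - lam| ≤ κ₀ * (x 1 - x s) := abs_le.2 ⟨by linarith, by linarith⟩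
      linarith
    · linarith [abs_nonneg (g₁ - lam)]
  have ht₁' : t₁ ∈ Icc (0 : ℝ) 1 := ⟨ht₁.1, ht₁.2.trans hs.2⟩
  have ht₂' : t₂ ∈ Icc (0 : ℝ) 1 := ⟨hs.1.trans ht₂.1, ht₂.2⟩
  refine ⟨lam, ε₁, ε₂, hε₁, hε₂, t₁, ht₁', t₂, ht₂', ht₁.2.trans ht₂.1,
    ⟨lam + ε₁ * |g₀ - lam|, fun t ht => ?_⟩, fun t ht => ?_,
    ⟨lam + ε₂ * (|g₁ - lam| - κ₀ * x 1), fun t ht => ?_⟩⟩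
  · have ht' : t ∈ Icc (0 : ℝ) 1 := ⟨ht.1, ht.2.trans ht₁'.2⟩
    have hle : κ₀ * x t ≤ κ₀ * x t₁ := mul_le_mul_of_nonneg_left (hxm ht' ht₁' ht.2) hκ.le
    rw [hleft t ⟨ht.1, ht.2.trans ht₁.2⟩, max_eq_right (by linarith)]
    ring
  · have ht' : t ∈ Icc (0 : ℝ) 1 := ⟨ht₁'.1.trans ht.1, ht.2.trans ht₂'.2⟩
    rcases le_total t s with h | h
    · have hle : κ₀ * x t₁ ≤ κ₀ * x t := mul_le_mul_of_nonneg_left (hxm ht₁' ht' ht.1) hκ.le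
      rw [hleft t ⟨ht'.1, h⟩, max_eq_left (by linarith)]
      ring
    · have hle : κ₀ * x t ≤ κ₀ * x t₂ := mul_le_mul_of_nonneg_left (hxm ht' ht₂' ht.2) hκ.le
      rw [hright t ⟨h, ht'.2⟩, max_eq_left (by linarith)]
      ring
  · have ht' : t ∈ Icc (0 : ℝ) 1 := ⟨ht₂'.1.trans ht.1, ht.2⟩
    have hle : κ₀ * x t₂ ≤ κ₀ * x t := mul_le_mul_of_nonneg_left (hxm ht₂' ht' ht.1) hκ.le
    rw [hright t ⟨ht₂.1.trans ht.1, ht.2⟩, max_eq_right (by linarith)]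
    ring

end structure_of_truncation

end RegularCurve

open RegularCurve in
theorem exists_isCSC_truncHomotopy_zero {κ₀ : ℝ} {q : ℂ} {z : Circle} {θ₁ : ℝ} (hκ : 0 < κ₀)
    (hz : Circle.exp θ₁ = z) (γ : condensedCurves κ₀ (q, z) θ₁) :
    ∃ ν ε₁ ε₂ s₁ s₂, (truncHomotopy hκ hz (0, γ)).1.1.IsCSC κ₀ ν ε₁ ε₂ s₁ s₂ := by
  obtain ⟨c, hc, h⟩ := exists_level hκ γ.2.2 (δ := 2 * ((0 : unitInterval) : ℝ)) (by simp)
  let w : BalancedLevel κ₀ q z θ₁ := ⟨((0, γ), ⟨c, hc⟩), h⟩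
  have e : truncHomotopy hκ hz (0, γ) = w.curve hκ hz := truncHomotopy_eq hκ hz w
  set η := w.curve hκ hz with hη
  have h0 : (0 : ℝ) ∈ Icc (0 : ℝ) 1 := by simp
  have h1 : (1 : ℝ) ∈ Icc (0 : ℝ) 1 := by simp
  have h20 : (2 * ((0 : unitInterval) : ℝ)) = 0 := by simp
  set f := γ.1.1.truncSine κ₀ c (2 * ((0 : unitInterval) : ℝ)) with hfdef
  have hf : γ.1.1.IsAdmissible κ₀ f := w.isAdmissible hκ
  have hang : ∀ t ∈ Icc (0 : ℝ) 1, η.1.1.angle t = γ.1.1.graphAngle f t := fun t ht =>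
    w.angle_curve hκ hz ht
  have hlen : ∀ t ∈ Icc (0 : ℝ) 1, η.1.1.arcLength t = ∫ τ in (0 : ℝ)..t, γ.1.1.graphSpeed f τ :=
    fun t ht => CondensedProfile.arcLength_toRegular hκ _ ht
  obtain ⟨lam, ε₁, ε₂, hε₁, hε₂, t₁, ht₁, t₂, ht₂, h12, ⟨m, hm⟩, hmid, m', hm'⟩ :=
    exists_truncSine_form hκ γ.2.2 hc
  have hff : ∀ t, f t = γ.1.1.truncSine κ₀ c 0 t := fun t => by rw [hfdef, h20]
  replace hm := fun t ht => (hff t).trans (hm t ht)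
  replace hmid := fun t ht => (hff t).trans (hmid t ht)
  replace hm' := fun t ht => (hff t).trans (hm' t ht)
  have hmono := η.1.1.strictMonoOn_arcLength.monotoneOn
  have hν : ∀ t ∈ Icc t₁ t₂, η.1.1.angle t = γ.1.1.midAngle + Real.arcsin lam := fun t ht => by
    rw [hang t ⟨ht₁.1.trans ht.1, ht.2.trans ht₂.2⟩, graphAngle, hmid t ht]
  have hleft : ∀ t ∈ Icc 0 t₁, η.1.1.angle t = γ.1.1.midAngle + Real.arcsin lam +
      ε₁ * (κ₀ * (η.1.1.arcLength t₁ - η.1.1.arcLength t)) := fun t ht => by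
    have ht' : t ∈ Icc (0 : ℝ) 1 := ⟨ht.1, ht.2.trans ht₁.2⟩
    have := graphAngle_sub_eq hκ γ.2.2 hf ht' ht₁ ht.2
      fun s hs => hm s ⟨ht.1.trans hs.1, hs.2⟩
    rw [← hang _ ht', ← hang _ ht₁, ← hlen _ ht', ← hlen _ ht₁, hν t₁ ⟨le_rfl, h12⟩] at this
    linarith
  have hright : ∀ t ∈ Icc t₂ 1, η.1.1.angle t = γ.1.1.midAngle + Real.arcsin lam +
      ε₂ * (κ₀ * (η.1.1.arcLength t - η.1.1.arcLength t₂)) := fun t ht => by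
    have ht' : t ∈ Icc (0 : ℝ) 1 := ⟨ht₂.1.trans ht.1, ht.2⟩
    have := graphAngle_sub_eq hκ γ.2.2 hf ht₂ ht' ht.1
      fun s hs => hm' s ⟨hs.1, hs.2.trans ht.2⟩
    rw [← hang _ ht', ← hang _ ht₂, ← hlen _ ht', ← hlen _ ht₂, hν t₂ ⟨h12, le_rfl⟩] at this
    linarith
  -- The turning along either arc is at most the amplitude of the truncated curve, which is itself
  -- condensed; hence the arcs have angle less than π.
  have hlt : ∀ ε x : ℝ, |ε| = 1 → ∀ a ∈ Icc (0 : ℝ) 1, ∀ b ∈ Icc (0 : ℝ) 1,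
      η.1.1.angle a - η.1.1.angle b = ε * x → x < Real.pi := by
    intro ε x hε a ha b hb hx
    have hc : η.1.1.amplitude < Real.pi := η.2.2
    have h3 := η.1.1.angle_sub_le_amplitude ha hb
    have h4 := η.1.1.angle_sub_le_amplitude hb ha
    rcases eq_or_eq_neg_of_abs_eq hε with rfl | rfl <;> linarith
  have harc0 : η.1.1.arcLength 0 = 0 := intervalIntegral.integral_same
  rw [e]
  refine ⟨γ.1.1.midAngle + Real.arcsin lam, ε₁, ε₂, η.1.1.arcLength t₁, η.1.1.arcLength t₂,
    hε₁, hε₂, ?_, hmono ht₁ ht₂ h12, hmono ht₂ h1 ht₂.2, ?_, ?_, fun t ht => ?_⟩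
  · exact harc0.ge.trans (hmono h0 ht₁ ht₁.1)
  · refine hlt ε₁ _ hε₁ 0 h0 t₁ ht₁ ?_
    rw [hleft 0 ⟨le_rfl, ht₁.1⟩, hν t₁ ⟨le_rfl, h12⟩, harc0]
    ring
  · refine hlt ε₂ _ hε₂ 1 h1 t₂ ht₂ ?_
    rw [hright 1 ⟨ht₂.2, le_rfl⟩, hν t₂ ⟨h12, le_rfl⟩]
    change _ = ε₂ * (κ₀ * (η.1.1.arcLength 1 - η.1.1.arcLength t₂))
    ring
  · rcases le_total t t₁ with h3 | h3
    · rw [cscAngle_of_le_left (hmono ht₁ ht₂ h12) (hmono ht ht₁ h3), hleft t ⟨ht.1, h3⟩]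
    · rcases le_total t t₂ with h4 | h4
      · rw [cscAngle_of_mem (hmono ht₁ ht h3) (hmono ht ht₂ h4), hν t ⟨h3, h4⟩]
      · rw [cscAngle_of_right_le (hmono ht₁ ht₂ h12) (hmono ht₂ ht h4), hright t ⟨h4, ht.2⟩]

/-! ### Reparametrization towards constant speed -/

theorem L2Tendsto.add {E : Type*} [NormedAddCommGroup E] {f f' : ℕ → ℝ → E} {g g' : ℝ → E}
    (h : L2Tendsto f g) (h' : L2Tendsto f' g') (hf : ∀ n, AEStronglyMeasurable (f n) unitMeasure)
    (hg : AEStronglyMeasurable g unitMeasure)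
    (hf' : ∀ n, AEStronglyMeasurable (f' n) unitMeasure)
    (hg' : AEStronglyMeasurable g' unitMeasure) :
    L2Tendsto (fun n t => f n t + f' n t) (fun t => g t + g' t) := by
  have h0 := Tendsto.add h h'
  rw [add_zero] at h0
  refine tendsto_of_tendsto_of_tendsto_of_le_of_le tendsto_const_nhds h0 (fun _ => zero_le)
    fun n => ?_
  refine le_trans (le_of_eq ?_)
    (eLpNorm_add_le ((hf n).sub hg) ((hf' n).sub hg') one_le_two)
  exact congrArg (eLpNorm · 2 unitMeasure) (add_sub_add_comm (f n) (f' n) g g')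

theorem RegularCurve.arcLength_zero (γ : RegularCurve) : γ.arcLength 0 = 0 :=
  intervalIntegral.integral_same

theorem RegularCurve.length_pos (γ : RegularCurve) : 0 < γ.length := by
  have h := γ.strictMonoOn_arcLength (a := 0) (b := 1) (by simp) (by simp) zero_lt_one
  rwa [γ.arcLength_zero] at h

theorem RegularCurve.exists_arcLength_eq (γ : RegularCurve) {s : ℝ} (hs : s ∈ Icc 0 γ.length) :
    ∃ t ∈ Icc (0 : ℝ) 1, γ.arcLength t = s := by
  refine intermediate_value_Icc zero_le_one (CurveSpace.continuousOn_arcLength γ) ?_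
  rwa [γ.arcLength_zero]

theorem RegularCurve.amplitude_le_of_angle_eq {γ η : RegularCurve} {Θ : ℝ → ℝ}
    (hγ : ∀ t ∈ Icc (0 : ℝ) 1, γ.angle t = Θ (γ.arcLength t))
    (hη : ∀ t ∈ Icc (0 : ℝ) 1, η.angle t = Θ (η.arcLength t)) (hl : γ.length = η.length) :
    γ.amplitude ≤ η.amplitude := by
  have h : ∀ t ∈ Icc (0 : ℝ) 1, ∃ u ∈ Icc (0 : ℝ) 1, γ.angle t = η.angle u := fun t ht => by
    obtain ⟨u, hu, h⟩ := η.exists_arcLength_eq (hl ▸ CurveSpace.arcLength_mem γ ht)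
    exact ⟨u, hu, by rw [hγ t ht, hη u hu, h]⟩
  refine amplitude_le_of_range (fun t ht => ?_) fun t ht => ?_
  · obtain ⟨u, hu, e⟩ := h t ht
    exact ⟨u, hu, e.le⟩
  · obtain ⟨u, hu, e⟩ := h t ht
    exact ⟨u, hu, e.ge⟩

theorem continuous_exp_cscAngle (κ ν ε₁ ε₂ s₁ s₂ : ℝ) :
    Continuous fun s => Complex.exp (cscAngle κ ν ε₁ ε₂ s₁ s₂ s * Complex.I) :=
  Complex.continuous_exp.comp
    ((Complex.continuous_ofReal.comp (continuous_cscAngle _ _ _ _ _ _)).mul continuous_const)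

theorem LipTendsto.cscAngle {f : ℕ → ℝ → ℝ} {g : ℝ → ℝ} (h : LipTendsto f g)
    (κ ν ε₁ ε₂ s₁ s₂ : ℝ) :
    LipTendsto (fun n t => cscAngle κ ν ε₁ ε₂ s₁ s₂ (f n t))
      (fun t => cscAngle κ ν ε₁ ε₂ s₁ s₂ (g t)) := by
  have hc : ∀ c : ℝ, LipTendsto (fun _ _ => c) (fun _ => c) :=
    fun c => LipTendsto.const tendsto_const_nhds
  have h1 := (((hc 0).max ((hc s₁).add (h.const_mul (-1)))).const_mul κ).const_mul ε₁
  have h2 := (((hc 0).max (h.add (hc (-s₂)))).const_mul κ).const_mul ε₂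
  simpa only [_root_.cscAngle, sub_eq_add_neg, neg_one_mul] using ((hc ν).add h1).add h2

section speed

variable {κ₀ : ℝ} {q : ℂ} {z : Circle} {θ₁ ν ε₁ ε₂ s₁ s₂ : ℝ}

theorem CurveSpace.path_eq_integral_cscAngle (ζ : CurveSpace (-κ₀) κ₀ originFrame (q, z))
    (h : ∀ t ∈ Icc (0 : ℝ) 1, Complex.exp (ζ.1.angle t * Complex.I) =
      Complex.exp (cscAngle κ₀ ν ε₁ ε₂ s₁ s₂ (ζ.1.arcLength t) * Complex.I))
    {t : ℝ} (ht : t ∈ Icc (0 : ℝ) 1) :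
    ζ.1.path t = ∫ s in (0 : ℝ)..ζ.1.arcLength t,
      Complex.exp (cscAngle κ₀ ν ε₁ ε₂ s₁ s₂ s * Complex.I) := by
  have key := integral_smul_comp_unit ζ.1.continuousOn_speed
    (continuous_exp_cscAngle κ₀ ν ε₁ ε₂ s₁ s₂) (a := 0) (by simp) ht
  rw [intervalIntegral.integral_same] at key
  rw [ζ.path_eq ht]
  refine Eq.trans (intervalIntegral.integral_congr fun τ hτ => ?_) key
  exact congrArg (ζ.1.speed τ • ·) (h τ (uIcc_subset_Icc (by simp) ht hτ))

variable (γ : condensedCurves κ₀ (q, z) θ₁)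

/-- The positive continuous functions on `[0,1]` with integral the length of `γ`: the speeds of
the reparametrizations of `γ`. -/
structure IsSpeed (γ : RegularCurve) (v : ℝ → ℝ) : Prop where
  continuousOn : ContinuousOn v (Icc 0 1)
  pos : ∀ t ∈ Icc (0 : ℝ) 1, 0 < v t
  integral_eq : ∫ t in (0 : ℝ)..1, v t = γ.length

variable {γ}

theorem IsSpeed.integral_mem {v : ℝ → ℝ} (hv : IsSpeed γ.1.1 v) {t : ℝ}
    (ht : t ∈ Icc (0 : ℝ) 1) : ∫ τ in (0 : ℝ)..t, v τ ∈ Icc 0 γ.1.1.length := by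
  have h : ∀ {a b : ℝ}, a ∈ Icc (0 : ℝ) 1 → b ∈ Icc (0 : ℝ) 1 → a ≤ b → 0 ≤ ∫ τ in a..b, v τ :=
    fun ha hb hab => intervalIntegral.integral_nonneg hab fun s hs =>
      (hv.pos s ⟨ha.1.trans hs.1, hs.2.trans hb.2⟩).le
  refine ⟨h (by simp) ht ht.1, ?_⟩
  rw [← hv.integral_eq, ← sub_nonneg, integral_unit_sub hv.continuousOn ht (by simp)]
  exact h ht (by simp) ht.2

/-- The reparametrization of `γ` of given speed. -/
def cscProfile (hκ : 0 < κ₀) (hγ : γ.1.1.IsCSC κ₀ ν ε₁ ε₂ s₁ s₂) {v : ℝ → ℝ}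
    (hv : IsSpeed γ.1.1 v) : CondensedProfile κ₀ q θ₁ where
  speed := v
  angle t := cscAngle κ₀ ν ε₁ ε₂ s₁ s₂ (∫ τ in (0 : ℝ)..t, v τ)
  continuousOn_speed := hv.continuousOn
  speed_pos := hv.pos
  abs_angle_sub_le a ha b hb hab := by
    have h := integral_unit_sub hv.continuousOn ha hb
    rw [← h]
    refine abs_cscAngle_sub_le hκ hγ.abs_eq₁ hγ.abs_eq₂ hγ.le (sub_nonneg.1 ?_)
    rw [h]
    exact intervalIntegral.integral_nonneg hab fun s hs =>
      (hv.pos s ⟨ha.1.trans hs.1, hs.2.trans hb.2⟩).le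
  angle_zero := by
    have h := hγ.angle_eq 0 (by simp)
    rw [γ.1.1.angle_zero, γ.1.1.arcLength_zero] at h
    exact (congrArg _ intervalIntegral.integral_same).trans h.symm
  angle_one := by
    rw [hv.integral_eq]
    exact (hγ.angle_eq 1 (by simp)).symm.trans γ.2.1
  integral_eq := by
    refine (integral_smul_comp_unit hv.continuousOn
      (continuous_exp_cscAngle κ₀ ν ε₁ ε₂ s₁ s₂) (by simp) (by simp)).trans ?_
    rw [intervalIntegral.integral_same, hv.integral_eq]
    exact (γ.1.path_eq_integral_cscAngle (fun t ht => by rw [hγ.angle_eq t ht])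
      (by simp)).symm.trans γ.1.2.2.1.1
  condensed a ha b hb := by
    obtain ⟨t, ht, h1⟩ := γ.1.1.exists_arcLength_eq (hv.integral_mem ha)
    obtain ⟨u, hu, h2⟩ := γ.1.1.exists_arcLength_eq (hv.integral_mem hb)
    rw [← h1, ← h2, ← hγ.angle_eq t ht, ← hγ.angle_eq u hu]
    exact (γ.1.1.angle_sub_le_amplitude hu ht).trans_lt γ.2.2

theorem tendsto_cscProfile (hκ : 0 < κ₀) (hz : Circle.exp θ₁ = z)
    (hγ : γ.1.1.IsCSC κ₀ ν ε₁ ε₂ s₁ s₂) {v : ℕ → ℝ → ℝ} {w : ℝ → ℝ}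
    (hv : ∀ n, IsSpeed γ.1.1 (v n)) (hw : IsSpeed γ.1.1 w) (h : L2Tendsto v w)
    (hae : ∀ᵐ t ∂unitMeasure, Tendsto (fun n => v n t) atTop (𝓝 (w t))) :
    Tendsto (fun n => (cscProfile hκ hγ (hv n)).toCurve hκ hz) atTop
      (𝓝 ((cscProfile hκ hγ hw).toCurve hκ hz)) := by
  have hS : LipTendsto (fun n t => ∫ τ in (0 : ℝ)..t, v n τ) (fun t => ∫ τ in (0 : ℝ)..t, w τ) :=
    { isLip := fun n => IsLip.integral (hv n).continuousOn
      isLip_lim := IsLip.integral hw.continuousOn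
      tendsto := fun t ht => h.integral (fun n => memLp_two_unit (hv n).continuousOn)
        (memLp_two_unit hw.continuousOn) ht
      tendsto_deriv := by
        filter_upwards [hae, ae_unit_mem_Ioo] with t h1 ht
        rw [(hasDerivAt_integral_unit hw.continuousOn ht).deriv]
        exact h1.congr fun n => (hasDerivAt_integral_unit (hv n).continuousOn ht).deriv.symm }
  have hΘ := hS.cscAngle κ₀ ν ε₁ ε₂ s₁ s₂
  refine CondensedProfile.tendsto_toCurve hκ hz h hΘ.tendsto ?_
  filter_upwards [hΘ.tendsto_deriv, hae, ae_unit_mem_Ioo] with t h1 h2 ht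
  exact h1.div h2 (hw.pos t (Ioo_subset_Icc_self ht)).ne'

theorem isSpeed_speed {η : RegularCurve} (hl : η.length = γ.1.1.length) :
    IsSpeed γ.1.1 η.speed where
  continuousOn := η.continuousOn_speed
  pos _ ht := η.speed_pos ht
  integral_eq := hl

theorem isSpeed_const : IsSpeed γ.1.1 fun _ => γ.1.1.length where
  continuousOn := continuousOn_const
  pos _ _ := γ.1.1.length_pos
  integral_eq := by simp

theorem IsSpeed.convex {v w : ℝ → ℝ} (hv : IsSpeed γ.1.1 v) (hw : IsSpeed γ.1.1 w)
    (r : unitInterval) : IsSpeed γ.1.1 fun t => (1 - r) * v t + r * w t where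
  continuousOn := (hv.continuousOn.const_mul _).add (hw.continuousOn.const_mul _)
  pos t ht := by
    rcases r.2.1.eq_or_lt with h | h
    · rw [← h]
      simpa using hv.pos t ht
    · exact add_pos_of_nonneg_of_pos (mul_nonneg (sub_nonneg.2 r.2.2) (hv.pos t ht).le)
        (mul_pos h (hw.pos t ht))
  integral_eq := by
    rw [intervalIntegral.integral_add, intervalIntegral.integral_const_mul,
      intervalIntegral.integral_const_mul, hv.integral_eq, hw.integral_eq]
    · ring
    · exact (intervalIntegrable_unit hv.continuousOn (by simp) (by simp)).const_mul _
    · exact (intervalIntegrable_unit hw.continuousOn (by simp) (by simp)).const_mul _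

/-- Equality modulo 2π becomes equality: both sides are continuous arguments of the same tangent and
vanish at 0. In particular a minimizer has the same total turning as `γ`. -/
theorem angle_eq_of_length_eq (hκ : 0 < κ₀) (hγ : γ.1.1.IsCSC κ₀ ν ε₁ ε₂ s₁ s₂)
    {η : CurveSpace (-κ₀) κ₀ originFrame (q, z)} (hl : η.1.length = γ.1.1.length) {t : ℝ}
    (ht : t ∈ Icc (0 : ℝ) 1) :
    η.1.angle t = cscAngle κ₀ ν ε₁ ε₂ s₁ s₂ (η.1.arcLength t) := by
  refine RegularCurve.IsArgument.angle_eq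
    (θ := fun t => cscAngle κ₀ ν ε₁ ε₂ s₁ s₂ (η.1.arcLength t)) ⟨?_, fun s hs => ?_⟩ ?_ ht
  · exact (continuous_cscAngle _ _ _ _ _ _).comp_continuousOn (CurveSpace.continuousOn_arcLength η.1)
  · exact ((η.1.isArgument_angle η.unitTangent_zero).2 s hs).trans
      (CurveSpace.exp_angle_eq_of_length_eq hκ hγ hl hs)
  · have h := hγ.angle_eq 0 (by simp)
    rw [γ.1.1.angle_zero, γ.1.1.arcLength_zero] at h
    simp only [η.1.arcLength_zero, ← h]

/-- The curve of the same trace as `γ` whose speed is a convex combination of a constant and the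
speed of `η`. -/
def respeed (hκ : 0 < κ₀) (hz : Circle.exp θ₁ = z) (hγ : γ.1.1.IsCSC κ₀ ν ε₁ ε₂ s₁ s₂)
    {η : condensedCurves κ₀ (q, z) θ₁} (hl : η.1.1.length = γ.1.1.length) (r : unitInterval) :
    condensedCurves κ₀ (q, z) θ₁ :=
  (cscProfile hκ hγ (isSpeed_const.convex (isSpeed_speed hl) r)).toCurve hκ hz

section respeed

variable (hκ : 0 < κ₀) (hz : Circle.exp θ₁ = z) (hγ : γ.1.1.IsCSC κ₀ ν ε₁ ε₂ s₁ s₂)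
  {η : condensedCurves κ₀ (q, z) θ₁} (hl : η.1.1.length = γ.1.1.length)

theorem respeed_one : respeed hκ hz hγ hl 1 = η := by
  refine CondensedProfile.toCurve_eq hκ hz _ η (fun t ht => ?_) fun t ht => ?_
  · simp [cscProfile]
  · rw [angle_eq_of_length_eq hκ hγ hl ht]
    simp [cscProfile, RegularCurve.arcLength, RegularCurve.speed]

theorem respeed_zero :
    respeed hκ hz hγ hl 0 = (cscProfile hκ hγ isSpeed_const).toCurve hκ hz :=
  CondensedProfile.toCurve_congr hκ hz (by simp [cscProfile]) (by simp [cscProfile])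

theorem length_respeed (r : unitInterval) :
    (respeed hκ hz hγ hl r).1.1.length = γ.1.1.length :=
  ((cscProfile hκ hγ _).length_toRegular hκ).trans
    (isSpeed_const.convex (isSpeed_speed hl) r).integral_eq

theorem amplitude_respeed (r : unitInterval) :
    (respeed hκ hz hγ hl r).1.1.amplitude = γ.1.1.amplitude := by
  have h : ∀ t ∈ Icc (0 : ℝ) 1, (respeed hκ hz hγ hl r).1.1.angle t =
      cscAngle κ₀ ν ε₁ ε₂ s₁ s₂ ((respeed hκ hz hγ hl r).1.1.arcLength t) := fun t ht =>
    angle_eq_of_length_eq hκ hγ (length_respeed hκ hz hγ hl r) ht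
  exact le_antisymm
    (RegularCurve.amplitude_le_of_angle_eq h hγ.angle_eq (length_respeed hκ hz hγ hl r))
    (RegularCurve.amplitude_le_of_angle_eq hγ.angle_eq h (length_respeed hκ hz hγ hl r).symm)

/-- With the profile fixed as a function of arc length, continuity reduces to that of the
interpolated speeds, in L² and, along a subsequence, almost everywhere. -/
theorem tendsto_respeed {η : ℕ → condensedCurves κ₀ (q, z) θ₁} {ζ : condensedCurves κ₀ (q, z) θ₁}
    (hl : ∀ n, (η n).1.1.length = γ.1.1.length) (hl' : ζ.1.1.length = γ.1.1.length)
    {r : ℕ → unitInterval} {r' : unitInterval} (hη : Tendsto η atTop (𝓝 ζ))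
    (hr : Tendsto r atTop (𝓝 r')) :
    Tendsto (fun n => respeed hκ hz hγ (hl n) (r n)) atTop (𝓝 (respeed hκ hz hγ hl' r')) := by
  refine tendsto_of_subseq_tendsto fun ns hns => ?_
  have hη' : Tendsto (fun n => (η (ns n)).1) atTop (𝓝 ζ.1) :=
    (tendsto_subtype_rng.1 hη).comp hns
  obtain ⟨ms, hms, hae⟩ := CurveSpace.exists_seq_ae hη'
  have hr' : Tendsto (fun n => ((r (ns (ms n)) : unitInterval) : ℝ)) atTop (𝓝 r') :=
    ((continuous_subtype_val.tendsto r').comp hr).comp (hns.comp hms.tendsto_atTop)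
  have hv := (CurveSpace.l2Tendsto_speed hη').comp hms.tendsto_atTop
  have hle : ∀ r : unitInterval, ‖(1 - (r : ℝ)) * γ.1.1.length‖ ≤ γ.1.1.length := fun r => by
    have h0 := γ.1.1.length_pos.le
    rw [Real.norm_eq_abs, abs_of_nonneg (mul_nonneg (sub_nonneg.2 r.2.2) h0)]
    exact mul_le_of_le_one_left h0 (sub_le_self _ r.2.1)
  have hle1 : ∀ r : unitInterval, ‖(r : ℝ)‖ ≤ 1 := fun r => by
    rw [Real.norm_eq_abs, abs_of_nonneg r.2.1]
    exact r.2.2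
  refine ⟨ms, tendsto_cscProfile hκ hz hγ _ _ ?_ ?_⟩
  · have h1 : L2Tendsto (fun n t => (1 - (r (ns (ms n)) : ℝ)) * γ.1.1.length)
        (fun t => (1 - (r' : ℝ)) * γ.1.1.length) :=
      L2Tendsto.of_bounded (fun _ => aestronglyMeasurable_const) aestronglyMeasurable_const
        γ.1.1.length (fun n => Eventually.of_forall fun _ => hle _)
        (Eventually.of_forall fun _ => hle _)
        (Eventually.of_forall fun _ => (tendsto_const_nhds.sub hr').mul_const _)
    have h2 : L2Tendsto (fun n t => (η (ns (ms n))).1.1.speed t • (r (ns (ms n)) : ℝ))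
        (fun t => ζ.1.1.speed t • (r' : ℝ)) :=
      hv.smul_of_ae (fun n => aestronglyMeasurable_unit (η _).1.1.continuousOn_speed)
        ζ.1.1.continuousOn_speed (fun _ => aestronglyMeasurable_const)
        aestronglyMeasurable_const 1 (fun n => Eventually.of_forall fun _ => hle1 _)
        (Eventually.of_forall fun _ => hle1 _) (Eventually.of_forall fun _ => hr')
    have h3 := h1.add h2 (fun _ => aestronglyMeasurable_const) aestronglyMeasurable_const
      (fun n => (aestronglyMeasurable_unit (η _).1.1.continuousOn_speed).smul
        aestronglyMeasurable_const)
      ((aestronglyMeasurable_unit ζ.1.1.continuousOn_speed).smul aestronglyMeasurable_const)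
    simpa only [smul_eq_mul, mul_comm (RegularCurve.speed _ _)] using h3
  · filter_upwards [hae] with t ht
    exact ((tendsto_const_nhds.sub hr').mul_const _).add (hr'.mul ht.1)

end respeed

end speed

/-! ### Concatenation of the homotopies and uniqueness of the minimizer -/

section contraction

variable {κ₀ : ℝ} {q : ℂ} {z : Circle} {θ₁ ν ε₁ ε₂ s₁ s₂ : ℝ} {γ : condensedCurves κ₀ (q, z) θ₁}

/-- Both curves are arc–segment–arc curves with the same end data, so each is no longer than the
other. -/
theorem length_truncHomotopy_zero (hκ : 0 < κ₀) (hz : Circle.exp θ₁ = z)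
    (hγ : γ.1.1.IsCSC κ₀ ν ε₁ ε₂ s₁ s₂) (η : condensedCurves κ₀ (q, z) θ₁) :
    (truncHomotopy hκ hz (0, η)).1.1.length = γ.1.1.length := by
  obtain ⟨ν', ε₁', ε₂', s₁', s₂', h⟩ := exists_isCSC_truncHomotopy_zero hκ hz η
  exact le_antisymm (CurveSpace.length_le_of_isCSC hκ h γ.1)
    (CurveSpace.length_le_of_isCSC hκ hγ (truncHomotopy hκ hz (0, η)).1)

/-- The homotopy of reparametrizations of the curves given by truncation. -/
def respeedHomotopy (hκ : 0 < κ₀) (hz : Circle.exp θ₁ = z)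
    (hγ : γ.1.1.IsCSC κ₀ ν ε₁ ε₂ s₁ s₂) :
    ContinuousMap.Homotopy
      (ContinuousMap.const (condensedCurves κ₀ (q, z) θ₁)
        ((cscProfile hκ hγ isSpeed_const).toCurve hκ hz))
      ((truncHomotopy hκ hz).comp ((ContinuousMap.const _ 0).prodMk (ContinuousMap.id _))) where
  toFun x := respeed hκ hz hγ (length_truncHomotopy_zero hκ hz hγ x.2) x.1
  continuous_toFun := by
    rw [continuous_iff_seqContinuous]
    intro x y h
    refine tendsto_respeed hκ hz hγ (η := fun n => truncHomotopy hκ hz (0, (x n).2))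
      (fun n => length_truncHomotopy_zero hκ hz hγ (x n).2)
      (length_truncHomotopy_zero hκ hz hγ y.2) ?_
      ((continuous_fst.tendsto y).comp h)
    exact ((by fun_prop : Continuous fun x : unitInterval × condensedCurves κ₀ (q, z) θ₁ =>
      truncHomotopy hκ hz (0, x.2)).tendsto y).comp h
  map_zero_left _ := respeed_zero hκ hz hγ _
  map_one_left _ := respeed_one hκ hz hγ _

/-- Truncation as a homotopy. -/
def truncationHomotopy (hκ : 0 < κ₀) (hz : Circle.exp θ₁ = z) :
    ContinuousMap.Homotopy
      ((truncHomotopy hκ hz).comp ((ContinuousMap.const _ 0).prodMk (ContinuousMap.id _)))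
      (ContinuousMap.id (condensedCurves κ₀ (q, z) θ₁)) where
  toContinuousMap := truncHomotopy hκ hz
  map_zero_left _ := rfl
  map_one_left := truncHomotopy_one hκ hz

theorem ContinuousMap.Homotopy.monotone_trans {X Y : Type*} [TopologicalSpace X]
    [TopologicalSpace Y] {f₀ f₁ f₂ : C(X, Y)} (F : f₀.Homotopy f₁) (G : f₁.Homotopy f₂)
    {m : Y → ℝ} {x : X} (hF : Monotone fun s => m (F (s, x)))
    (hG : Monotone fun s => m (G (s, x))) : Monotone fun s => m (F.trans G (s, x)) := by
  intro s s' hs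
  have hs' : (s : ℝ) ≤ s' := hs
  simp only [trans_apply]
  split_ifs with h h' h'
  · exact hF (Subtype.mk_le_mk.2 (by linarith))
  · refine (hF le_top).trans (le_trans (le_of_eq ?_) (hG bot_le))
    exact congrArg m ((F.apply_one x).trans (G.apply_zero x).symm)
  · linarith
  · exact hG (Subtype.mk_le_mk.2 (by linarith))

/-- Both positions are the same function of arc length, so with `ζ` of constant speed the normalized
arc length of `η` is the change of parameter. -/
theorem isReparametrization_of_length_eq (hκ : 0 < κ₀) (hγ : γ.1.1.IsCSC κ₀ ν ε₁ ε₂ s₁ s₂)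
    {ζ : CurveSpace (-κ₀) κ₀ originFrame (q, z)} (hζ : ζ.1.length = γ.1.1.length)
    (hs : ∀ t ∈ Icc (0 : ℝ) 1, ζ.1.arcLength t = t * γ.1.1.length)
    {η : CurveSpace (-κ₀) κ₀ originFrame (q, z)} (hη : η.1.length = γ.1.1.length) :
    η.1.IsReparametrization ζ.1 := by
  have hL := γ.1.1.length_pos
  have hd : ∀ t ∈ Icc (0 : ℝ) 1, HasDerivWithinAt (fun t => η.1.arcLength t / γ.1.1.length)
      (η.1.speed t / γ.1.1.length) (Icc 0 1) t := fun t ht =>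
    (hasDerivWithinAt_integral_unit η.1.continuousOn_speed ht).div_const _
  refine ⟨fun t => η.1.arcLength t / γ.1.1.length,
    contDiffOn_one_of_hasDerivWithinAt (η.1.continuousOn_speed.div_const _) hd, ?_, ?_,
    fun t ht => ?_, fun t ht => ?_⟩
  · simp only [η.1.arcLength_zero, zero_div]
  · exact (congrArg (· / γ.1.1.length) hη).trans (div_self hL.ne')
  · rw [(hd t ht).derivWithin (uniqueDiffWithinAt_unit ht)]
    exact div_pos (η.1.speed_pos ht) hL
  · have hm := CurveSpace.arcLength_mem η.1 ht
    have hu : η.1.arcLength t / γ.1.1.length ∈ Icc (0 : ℝ) 1 :=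
      ⟨div_nonneg hm.1 hL.le, (div_le_one hL).2 (hm.2.trans_eq hη)⟩
    rw [η.path_eq_integral_cscAngle
        (fun t ht => CurveSpace.exp_angle_eq_of_length_eq hκ hγ hη ht) ht,
      ζ.path_eq_integral_cscAngle
        (fun t ht => CurveSpace.exp_angle_eq_of_length_eq hκ hγ hζ ht) hu,
      hs _ hu, div_mul_cancel₀ _ hL.ne']

end contraction
theorem propositionP (κ₀ : ℝ) (hκ₀ : 0 < κ₀) (q : ℂ) (z : Circle) (θ₁ : ℝ)
    (hθ₁ : Circle.exp θ₁ = z) (hne : (condensedCurves κ₀ (q, z) θ₁).Nonempty) :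
    (∃ (H : C(unitInterval × condensedCurves κ₀ (q, z) θ₁, condensedCurves κ₀ (q, z) θ₁))
        (γ₀ : condensedCurves κ₀ (q, z) θ₁),
      (∀ γ, H (1, γ) = γ ∧ H (0, γ) = γ₀) ∧
      (∀ γ, Monotone fun s => (H (s, γ)).1.1.amplitude) ∧
      (∀ γ, Monotone fun s => (H (s, γ)).1.1.length) ∧
      ∀ η : CurveSpace (-κ₀) κ₀ originFrame (q, z),
        γ₀.1.1.length ≤ η.1.length ∧
          (η.1.length = γ₀.1.1.length → η.1.IsReparametrization γ₀.1.1)) ∧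
    ContractibleSpace (condensedCurves κ₀ (q, z) θ₁) := by
  obtain ⟨η, hη⟩ := hne
  obtain ⟨ν, ε₁, ε₂, s₁, s₂, hγ⟩ := exists_isCSC_truncHomotopy_zero hκ₀ hθ₁ ⟨η, hη⟩
  set γ := truncHomotopy hκ₀ hθ₁ (0, ⟨η, hη⟩)
  -- `F` moves only parametrizations and keeps amplitude and length constant; `G` undoes the
  -- truncation. Run in this order, they lead from `γ₀` to the identity with both quantities
  -- nondecreasing.
  let F := respeedHomotopy hκ₀ hθ₁ hγ
  let G := truncationHomotopy (q := q) hκ₀ hθ₁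
  let γ₀ := (cscProfile hκ₀ hγ isSpeed_const).toCurve hκ₀ hθ₁
  have hl : γ₀.1.1.length = γ.1.1.length :=
    ((cscProfile hκ₀ hγ isSpeed_const).length_toRegular hκ₀).trans isSpeed_const.integral_eq
  have h0 := length_truncHomotopy_zero (q := q) hκ₀ hθ₁ hγ
  refine ⟨⟨(F.trans G).toContinuousMap, γ₀, fun ζ => ⟨(F.trans G).apply_one ζ,
    (F.trans G).apply_zero ζ⟩, fun ζ => ?_, fun ζ => ?_, fun ζ => ⟨?_, fun hζ => ?_⟩⟩, ?_⟩
  · refine F.monotone_trans G (m := fun ζ => ζ.1.1.amplitude) ?_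
      (monotone_amplitude_truncHomotopy hκ₀ hθ₁ ζ)
    exact fun s s' _ => ((amplitude_respeed hκ₀ hθ₁ hγ (h0 ζ) s).trans
      (amplitude_respeed hκ₀ hθ₁ hγ (h0 ζ) s').symm).le
  · refine F.monotone_trans G (m := fun ζ => ζ.1.1.length) ?_
      (monotone_length_truncHomotopy hκ₀ hθ₁ ζ)
    exact fun s s' _ => ((length_respeed hκ₀ hθ₁ hγ (h0 ζ) s).trans
      (length_respeed hκ₀ hθ₁ hγ (h0 ζ) s').symm).le
  · exact hl.trans_le (CurveSpace.length_le_of_isCSC hκ₀ hγ ζ)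
  · refine isReparametrization_of_length_eq hκ₀ hγ hl (fun t ht => ?_) (hζ.trans hl)
    rw [CondensedProfile.toCurve_coe, CondensedProfile.arcLength_toRegular hκ₀ _ ht]
    exact (intervalIntegral.integral_const γ.1.1.length).trans (by rw [sub_zero, smul_eq_mul])
  · refine (contractible_iff_id_nullhomotopic _).2 ?_
    exact ⟨γ₀, ⟨(F.trans G).symm⟩⟩

end
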